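/- For symmetric $X,Z\in\mathbb{R}^{n\times n}$ put $\hat X_n=\frac{X}{\sqrt n}+\frac{Z}{n}$. For every $k\ge 0$ let $F_k:\mathbb{R}^{k+1}\to\mathbb{R}$ be a Lipschitz function that does not depend on $n$. Given $u^0\in\mathbb{R}^n$, the generalized AMP orbit of $(X,Z)$ started at $u^0$ is the sequence of vectors $u^{[k]}(X)\in\mathbb{R}^n$ defined by $u^{[0]}(X)=u^0$ and $$u^{[k+1]}(X)=F_k\bigl(\hat X_n u^{[k]}(X),\,u^{[k-1]}(X),\,\dots,\,u^{[0]}(X)\bigr),\qquad k\ge 0,$$ where $F_k$ is applied coordinate by coordinate. Fix $\sigma>0$ and $C<\infty$. For every $n\ge 1$ let the following be given on a common probability space. (i) A random vector $u^0=(u^0_i)_{i\le n}$ in $\mathbb{R}^n$ and a random symmetric $n\times n$ matrix $Z=(z_{ij})$, possibly dependent on each other, such that for all $i,j\le n$ $$\mathbb{E}\exp\Bigl(\frac{\|u^0\|_2^2}{\sigma n}\Bigr)\le C,\qquad \mathbb{E}\exp\Bigl(\frac{|u^0_i|}{\sigma}\Bigr)\le C,\qquad \mathbb{E}\exp\Bigl(\frac{|z_{ij}|}{\sigma}\Bigr)\le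 C .$$ (ii) A random symmetric $n\times n$ matrix $A=(a_{ij})$, independent of $(u^0,Z)$, whose entries $a_{ij}$, $i\le j$, are independent, have mean $0$ and variance $1$, and are $\sigma$-subgaussian, i.e. $\mathbb{E}e^{\lambda a_{ij}}\le e^{\lambda^2\sigma^2/2}$ for all $\lambda\in\mathbb{R}$. (iii) A random symmetric $n\times n$ matrix $G=(g_{ij})$, independent of $(u^0,Z)$, whose entries $g_{ij}$, $i\le j$, are independent standard normal variables. (The joint law of $A$ and $G$ is otherwise arbitrary.) Then for every $k\ge 0$ and every Lipschitz function $\phi:\mathbb{R}^{k+1}\to\mathbb{R}$, with $$\Phi_{k,n}(X)=\frac1n\sum_{i=1}^n\phi\bigl(u^{[k]}_i(X),\dots,u^{[0]}_i(X)\bigr),$$ where the orbits are driven by $(X,Z)$ and started at $u^0$, one has $$\lim_{n\to\infty}\bigl|\Phi_{k,n}(A)-\Phi_{k,n}(G)\bigr|=0\quad\text{in probability.}$$ -/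

import Mathlib

open MeasureTheory ProbabilityTheory Filter Topology
open scoped NNReal ENNReal Matrix

namespace GenAMP

/-- The matrix `X / √n + Z / n`. -/
noncomputable def hatMatrix {n : ℕ} (X Z : Matrix (Fin n) (Fin n) ℝ) : Matrix (Fin n) (Fin n) ℝ :=
  (Real.sqrt n)⁻¹ • X + (n : ℝ)⁻¹ • Z

/-- The generalized AMP orbit `u^[0], u^[1], …` driven by `M`, started at `u0`:
`u^[k+1] = F_k(M u^[k], u^[k-1], …, u^[0])`, coordinate by coordinate.
A function of the variables `(x_k, …, x_0)` is a function on `Fin (k + 1) → ℝ` whose argument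
has the value of the variable `x_j` at the index `j`. -/
noncomputable def orbit {n : ℕ} (F : (k : ℕ) → (Fin (k + 1) → ℝ) → ℝ)
    (M : Matrix (Fin n) (Fin n) ℝ) (u0 : Fin n → ℝ) : ℕ → Fin n → ℝ
  | 0 => u0
  | k + 1 => fun i => F k fun j =>
      if (j : ℕ) = k then (M *ᵥ orbit F M u0 k) i else orbit F M u0 j i
termination_by k => k
decreasing_by all_goals omega

theorem orbit_zero {n : ℕ} (F : (k : ℕ) → (Fin (k + 1) → ℝ) → ℝ)
    (M : Matrix (Fin n) (Fin n) ℝ) (u0 : Fin n → ℝ) : orbit F M u0 0 = u0 := by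
  rw [orbit]

theorem orbit_succ {n : ℕ} (F : (k : ℕ) → (Fin (k + 1) → ℝ) → ℝ)
    (M : Matrix (Fin n) (Fin n) ℝ) (u0 : Fin n → ℝ) (k : ℕ) (i : Fin n) :
    orbit F M u0 (k + 1) i = F k fun j =>
      if (j : ℕ) = k then (M *ᵥ orbit F M u0 k) i else orbit F M u0 j i := by
  rw [orbit]

/-- The empirical average `(1/n) ∑ᵢ φ(u_i^[k](X), …, u_i^[0](X))` along the generalized AMP orbit
of `(X, Z)` started at `u0`. -/
noncomputable def empAverage {n : ℕ} (F : (k : ℕ) → (Fin (k + 1) → ℝ) → ℝ) (k : ℕ)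
    (φ : (Fin (k + 1) → ℝ) → ℝ) (u0 : Fin n → ℝ) (Z X : Matrix (Fin n) (Fin n) ℝ) : ℝ :=
  (n : ℝ)⁻¹ * ∑ i, φ fun j => orbit F (hatMatrix X Z) u0 j i

/-- A random symmetric matrix whose entries on and above the diagonal are independent. -/
structure IsSymmIndep {Ω : Type*} [MeasurableSpace Ω] (P : Measure Ω) {n : ℕ}
    (A : Ω → Matrix (Fin n) (Fin n) ℝ) : Prop where
  measurable : ∀ i j, Measurable fun ω => A ω i j
  symm : ∀ ω, (A ω).IsSymm
  indep : iIndepFun (fun (p : {p : Fin n × Fin n // p.1 ≤ p.2}) ω => A ω p.1.1 p.1.2) P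

/-- A random symmetric matrix whose entries on and above the diagonal are independent, centered,
of unit variance and `σ`-subgaussian: `𝔼 exp (t a) ≤ exp (σ² t² / 2)` for all real `t`. -/
structure IsSubgaussianNoise {Ω : Type*} [MeasurableSpace Ω] (P : Measure Ω) (σ : ℝ≥0) {n : ℕ}
    (A : Ω → Matrix (Fin n) (Fin n) ℝ) : Prop extends IsSymmIndep P A where
  mean_zero : ∀ i j, ∫ ω, A ω i j ∂P = 0
  unit_variance : ∀ i j, variance (fun ω => A ω i j) P = 1
  subgaussian : ∀ i j, HasSubgaussianMGF (fun ω => A ω i j) (σ ^ 2) P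

/-- A random symmetric matrix whose entries on and above the diagonal are independent
standard normal variables. -/
structure IsGaussianNoise {Ω : Type*} [MeasurableSpace Ω] (P : Measure Ω) {n : ℕ}
    (G : Ω → Matrix (Fin n) (Fin n) ℝ) : Prop extends IsSymmIndep P G where
  law : ∀ i j, P.map (fun ω => G ω i j) = gaussianReal 0 1

/-- A random vector `u0` and a random symmetric matrix `Z`, possibly dependent, such that the
expectations of `exp (‖u0‖₂² / (σ n))`, `exp (|u0_i| / σ)` and `exp (|z_ij| / σ)`
are all at most `C`. -/
structure IsInitialData {Ω : Type*} [MeasurableSpace Ω] (P : Measure Ω) (σ C : ℝ≥0) {n : ℕ}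
    (u0 : Ω → Fin n → ℝ) (Z : Ω → Matrix (Fin n) (Fin n) ℝ) : Prop where
  measurable_init : ∀ i, Measurable fun ω => u0 ω i
  measurable_signal : ∀ i j, Measurable fun ω => Z ω i j
  symm : ∀ ω, (Z ω).IsSymm
  exp_norm_le : ∫⁻ ω, ENNReal.ofReal (Real.exp ((∑ i, u0 ω i ^ 2) / (σ * n))) ∂P ≤ C
  exp_init_le : ∀ i, ∫⁻ ω, ENNReal.ofReal (Real.exp (|u0 ω i| / σ)) ∂P ≤ C
  exp_signal_le : ∀ i j, ∫⁻ ω, ENNReal.ofReal (Real.exp (|Z ω i j| / σ)) ∂P ≤ C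

/-- The random matrix `A` is independent of the pair `(u0, Z)`. -/
def IndepOfData {Ω : Type*} [MeasurableSpace Ω] (P : Measure Ω) {n : ℕ}
    (A : Ω → Matrix (Fin n) (Fin n) ℝ) (u0 : Ω → Fin n → ℝ)
    (Z : Ω → Matrix (Fin n) (Fin n) ℝ) : Prop :=
  IndepFun (β := Fin n → Fin n → ℝ) (γ := (Fin n → ℝ) × (Fin n → Fin n → ℝ))
    (fun ω i j => A ω i j) (fun ω => (u0 ω, fun i j => Z ω i j)) P

end GenAMP

/-! Reduction. Freeze the data `(u0, Z)` and adjoin an independent Gaussian matrix. It is enough to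
compare `A` with that matrix and `G` with that matrix, so the joint law of `A` and `G` plays no
role. For frozen data the noise is a product law on the entries on and above the diagonal. The claim
then is that the two empirical averages concentrate, and that their means agree asymptotically.

Smooth case. Let the `F k` and `φ` be bounded with bounded derivatives, let `u0` be bounded, and
view the empirical average as a function `Ψ` of the entries. A change of one entry perturbs the
matrix by a matrix of rank at most two and norm of order `n^(-1/2)`. By induction along the orbit,
the `j`-th derivative of the orbit in one entry has Euclidean norm of order `n^(-j/2)`, with a
constant polynomial in the operator norm. Hence `Ψ` has derivatives of order `n^(-(j+1)/2)`, and the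
fourth-order errors of an exchange of all `n^2` entries add up to `n^(-1/2)`.

The first two moments match, but the third ones need not, and `n^2` third derivatives of order
`n^(-2)` would only give a bounded error. The gain comes from summing before taking absolute values:
for weights `|c m| ≤ 1` the vector `∑ c m ∂_m^3 u` has bounded Euclidean norm. Its linear part is
carried through the iteration by bounded operators, and the products of lower derivatives are summed
by Cauchy–Schwarz. This is `IsGood`, preserved by `IsGood.comp` and `IsGood.mulVec`, and it leads to
`exists_entryBounds`. The bound concerns all entries at one point, while a Lindeberg exchange moves
the point after each replacement. So the order of replacement is chosen greedily: if the increments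
over all possible next replacements add up to at most `δ`, some replacement costs at most the
average, and the total is `δ` times a harmonic number (`le_add_mul_harmonic`). Only a logarithm is
lost. The variance is bounded by the Efron–Stein inequality `variance_pi_le` and the gradient bound
`∑ (∂_m Ψ)^2 ≤ q^2 / n`. The operator norm has bounded moments because the exponential of the
bilinear form can be integrated over balls (`lintegral_exp_opN_div_le`).

Lipschitz case. The functions are clipped and mollified and `u0` is truncated, with an error that is
a small multiple of one plus the square of the arguments and values. The Euclidean norm of such an
error is governed by empirical fourth moments of the orbit. These are tight by a cavity argument:
after erasing row and column `i`, the field at `i` is a linear form in an independent row, and it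
controls the true orbit at `i` (`exists_abs_orbit_le_cavityField`, `exists_tight`). The truncated
problem is then compared by Chebyshev's inequality (`exists_compare`). -/

namespace GenAMP

open scoped ContDiff

/-! ### The Euclidean norm on coordinate vectors -/

/-- The Euclidean norm of a coordinate vector. -/
noncomputable def l2 {ι : Type*} [Fintype ι] (v : ι → ℝ) : ℝ := ‖WithLp.toLp 2 v‖

section l2
variable {ι κ : Type*} [Fintype ι]

theorem l2_eq_sqrt (v : ι → ℝ) : l2 v = √(∑ i, v i ^ 2) := by
  simp [l2, EuclideanSpace.norm_eq]

theorem l2_sq (v : ι → ℝ) : l2 v ^ 2 = ∑ i, v i ^ 2 := by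
  rw [l2_eq_sqrt, Real.sq_sqrt (Finset.sum_nonneg fun i _ => sq_nonneg _)]

theorem l2_nonneg (v : ι → ℝ) : 0 ≤ l2 v := norm_nonneg _

theorem l2_add (v w : ι → ℝ) : l2 (fun i => v i + w i) ≤ l2 v + l2 w :=
  norm_add_le (WithLp.toLp 2 v) (WithLp.toLp 2 w)

theorem l2_smul (c : ℝ) (v : ι → ℝ) : l2 (fun i => c * v i) = |c| * l2 v :=
  norm_smul c (WithLp.toLp 2 v)

theorem l2_zero : l2 (fun _ : ι => (0 : ℝ)) = 0 := by simp [l2_eq_sqrt]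

theorem l2_mono {v w : ι → ℝ} (h : ∀ i, |v i| ≤ |w i|) : l2 v ≤ l2 w := by
  rw [l2_eq_sqrt, l2_eq_sqrt]
  exact Real.sqrt_le_sqrt (Finset.sum_le_sum fun i _ => sq_le_sq.2 (h i))

theorem l2_mono_of_le {v w : ι → ℝ} (h : ∀ i, |v i| ≤ w i) : l2 v ≤ l2 w :=
  l2_mono fun i => (h i).trans (le_abs_self _)

theorem l2_le_of_sum_sq_le {v : ι → ℝ} {c : ℝ} (hc : 0 ≤ c) (h : ∑ i, v i ^ 2 ≤ c ^ 2) :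
    l2 v ≤ c := by
  rw [l2_eq_sqrt]; exact Real.sqrt_le_iff.2 ⟨hc, h⟩

theorem abs_le_l2 (v : ι → ℝ) (i : ι) : |v i| ≤ l2 v := by
  rw [l2_eq_sqrt]
  exact Real.abs_le_sqrt (Finset.single_le_sum (f := fun i => v i ^ 2)
    (fun i _ => sq_nonneg _) (Finset.mem_univ i))

theorem l2_mul (v w : ι → ℝ) : l2 (fun i => v i * w i) ≤ l2 v * l2 w := by
  calc l2 (fun i => v i * w i) ≤ l2 (fun i => l2 v * w i) := l2_mono fun i => by
        rw [abs_mul, abs_mul, abs_of_nonneg (l2_nonneg v)]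
        exact mul_le_mul_of_nonneg_right (abs_le_l2 v i) (abs_nonneg _)
    _ = l2 v * l2 w := by rw [l2_smul, abs_of_nonneg (l2_nonneg v)]

theorem l2_sum (s : Finset κ) (v : κ → ι → ℝ) :
    l2 (fun i => ∑ k ∈ s, v k i) ≤ ∑ k ∈ s, l2 (v k) := by
  classical
  induction s using Finset.induction_on with
  | empty => simp [l2_zero]
  | insert a s ha ih =>
    simp only [Finset.sum_insert ha]
    exact (l2_add _ _).trans (by gcongr)

theorem abs_sum_mul_le_l2 (v w : ι → ℝ) : |∑ i, v i * w i| ≤ l2 v * l2 w := by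
  have := Finset.sum_mul_sq_le_sq_mul_sq Finset.univ v w
  rw [← l2_sq, ← l2_sq, ← mul_pow] at this
  exact abs_le_of_sq_le_sq this (mul_nonneg (l2_nonneg _) (l2_nonneg _))

theorem l2_const (c : ℝ) : l2 (fun _ : ι => c) = √(Fintype.card ι) * |c| := by
  rw [l2_eq_sqrt, Finset.sum_const, nsmul_eq_mul, Finset.card_univ,
    Real.sqrt_mul (Nat.cast_nonneg _), Real.sqrt_sq_eq_abs]

theorem abs_sum_le_l2 (v : ι → ℝ) : |∑ i, v i| ≤ √(Fintype.card ι) * l2 v := by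
  have := abs_sum_mul_le_l2 (fun _ : ι => (1 : ℝ)) v
  simpa [l2_const] using this

theorem l2_le_of_abs_le {v : ι → ℝ} {B : ℝ} (h : ∀ i, |v i| ≤ B) :
    l2 v ≤ √(Fintype.card ι) * B := by
  rcases isEmpty_or_nonempty ι with h' | ⟨⟨i⟩⟩
  · simp [l2_eq_sqrt]
  · have hB : 0 ≤ B := (abs_nonneg _).trans (h i)
    calc l2 v ≤ l2 (fun _ : ι => B) := l2_mono_of_le h
      _ = _ := by rw [l2_const, abs_of_nonneg hB]

end l2

/-- The operator norm of a matrix with respect to the Euclidean norm. -/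
noncomputable def opN {n : ℕ} (M : Matrix (Fin n) (Fin n) ℝ) : ℝ :=
  ‖Matrix.toEuclideanCLM (n := Fin n) (𝕜 := ℝ) M‖

/-! ### The operator norm for the Euclidean norm -/

section opN
variable {n : ℕ} (M N : Matrix (Fin n) (Fin n) ℝ)

theorem opN_nonneg : 0 ≤ opN M := norm_nonneg _

theorem l2_mulVec_le (v : Fin n → ℝ) : l2 (M *ᵥ v) ≤ opN M * l2 v :=
  (Matrix.toEuclideanCLM (n := Fin n) (𝕜 := ℝ) M).le_opNorm (WithLp.toLp 2 v)

theorem opN_le {c : ℝ} (hc : 0 ≤ c) (h : ∀ v, l2 (M *ᵥ v) ≤ c * l2 v) : opN M ≤ c :=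
  ContinuousLinearMap.opNorm_le_bound _ hc fun v => h v.ofLp

theorem opN_add : opN (M + N) ≤ opN M + opN N := by
  unfold opN; rw [map_add]; exact norm_add_le _ _

theorem opN_smul (c : ℝ) : opN (c • M) = |c| * opN M := by
  unfold opN; rw [map_smul, norm_smul, Real.norm_eq_abs]

theorem l2_mulVec_le_frobenius (v : Fin n → ℝ) :
    l2 (M *ᵥ v) ≤ √(∑ i, ∑ j, M i j ^ 2) * l2 v := by
  have h0 : 0 ≤ ∑ i, ∑ j, M i j ^ 2 :=
    Finset.sum_nonneg fun i _ => Finset.sum_nonneg fun j _ => sq_nonneg _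
  refine l2_le_of_sum_sq_le (mul_nonneg (Real.sqrt_nonneg _) (l2_nonneg _)) ?_
  rw [mul_pow, Real.sq_sqrt h0, l2_sq, Finset.sum_mul]
  exact Finset.sum_le_sum fun i _ => Finset.sum_mul_sq_le_sq_mul_sq Finset.univ (M i) v

theorem opN_le_frobenius : opN M ≤ √(∑ i, ∑ j, M i j ^ 2) :=
  opN_le _ (Real.sqrt_nonneg _) (l2_mulVec_le_frobenius M)

theorem continuous_opN : Continuous (opN (n := n)) := by
  unfold opN
  exact continuous_norm.comp (LinearMap.continuous_of_finiteDimensional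
    (Matrix.toEuclideanCLM (n := Fin n) (𝕜 := ℝ)).toAlgEquiv.toLinearMap)

end opN

/-! ### Derivatives of a composition along a curve -/

section comp
variable {E : Type*} [NormedAddCommGroup E] [NormedSpace ℝ E]

theorem hasDerivAt_iteratedDeriv {γ : ℝ → E} (hγ : ContDiff ℝ ∞ γ) (j : ℕ) (x : ℝ) :
    HasDerivAt (iteratedDeriv j γ) (iteratedDeriv (j + 1) γ x) x := by
  rw [iteratedDeriv_succ]
  exact ((hγ.differentiable_iteratedDeriv j (by exact_mod_cast ENat.natCast_lt_top j)) x).hasDerivAt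

variable {f : E → ℝ} {γ : ℝ → E} (hf : ContDiff ℝ ∞ f) (hγ : ContDiff ℝ ∞ γ)
include hf hγ

theorem iteratedDeriv_one_comp : iteratedDeriv 1 (f ∘ γ) =
    fun x => fderiv ℝ f (γ x) (iteratedDeriv 1 γ x) := by
  funext x
  rw [iteratedDeriv_one, iteratedDeriv_one]
  exact fderiv_comp_deriv x (hf.differentiable (by simp) _) (hγ.differentiable (by simp) _)

theorem iteratedDeriv_two_comp : iteratedDeriv 2 (f ∘ γ) = fun x =>
    fderiv ℝ (fderiv ℝ f) (γ x) (iteratedDeriv 1 γ x) (iteratedDeriv 1 γ x) +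
      fderiv ℝ f (γ x) (iteratedDeriv 2 γ x) := by
  have h1 : ContDiff ℝ ∞ (fderiv ℝ f) := hf.fderiv_right (by simp)
  funext x
  rw [iteratedDeriv_succ, iteratedDeriv_one_comp hf hγ]
  have g0 := hasDerivAt_iteratedDeriv hγ 0 x
  rw [iteratedDeriv_zero] at g0
  have g1 := hasDerivAt_iteratedDeriv hγ 1 x
  have e1 := ((h1.differentiable (by simp) (γ x)).hasFDerivAt.comp_hasDerivAt x g0)
  exact (e1.clm_apply g1).deriv

/-- The terms are kept as the product rule produces them. Symmetry of the higher derivatives is not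
needed, since each term is later bounded by the product of the norms of its arguments. -/
theorem iteratedDeriv_three_comp : iteratedDeriv 3 (f ∘ γ) = fun x =>
    (fderiv ℝ (fderiv ℝ (fderiv ℝ f)) (γ x)
        (iteratedDeriv 1 γ x) (iteratedDeriv 1 γ x) (iteratedDeriv 1 γ x) +
      fderiv ℝ (fderiv ℝ f) (γ x) (iteratedDeriv 2 γ x) (iteratedDeriv 1 γ x) +
      fderiv ℝ (fderiv ℝ f) (γ x) (iteratedDeriv 1 γ x) (iteratedDeriv 2 γ x)) +
      (fderiv ℝ (fderiv ℝ f) (γ x) (iteratedDeriv 1 γ x) (iteratedDeriv 2 γ x) +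
      fderiv ℝ f (γ x) (iteratedDeriv 3 γ x)) := by
  have h1 : ContDiff ℝ ∞ (fderiv ℝ f) := hf.fderiv_right (by simp)
  have h2 : ContDiff ℝ ∞ (fderiv ℝ (fderiv ℝ f)) := h1.fderiv_right (by simp)
  funext x
  rw [iteratedDeriv_succ, iteratedDeriv_two_comp hf hγ]
  have g0 := hasDerivAt_iteratedDeriv hγ 0 x
  rw [iteratedDeriv_zero] at g0
  have g1 := hasDerivAt_iteratedDeriv hγ 1 x
  have g2 := hasDerivAt_iteratedDeriv hγ 2 x
  have e1 := ((h1.differentiable (by simp) (γ x)).hasFDerivAt.comp_hasDerivAt x g0)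
  have e2 := ((h2.differentiable (by simp) (γ x)).hasFDerivAt.comp_hasDerivAt x g0)
  exact (((e2.clm_apply g1).clm_apply g1).add (e1.clm_apply g2)).deriv

set_option maxSynthPendingDepth 4 in
theorem iteratedDeriv_four_comp : iteratedDeriv 4 (f ∘ γ) = fun x =>
    let D1 := fderiv ℝ f (γ x)
    let D2 := fderiv ℝ (fderiv ℝ f) (γ x)
    let D3 := fderiv ℝ (fderiv ℝ (fderiv ℝ f)) (γ x)
    let D4 := fderiv ℝ (fderiv ℝ (fderiv ℝ (fderiv ℝ f))) (γ x)
    let a := iteratedDeriv 1 γ x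
    let b := iteratedDeriv 2 γ x
    let c := iteratedDeriv 3 γ x
    let d := iteratedDeriv 4 γ x
    ((D4 a a a a + D3 b a a + D3 a b a + D3 a a b) + (D3 a b a + D2 c a + D2 b b) +
      (D3 a a b + D2 b b + D2 a c)) + ((D3 a a b + D2 b b + D2 a c) + (D2 a c + D1 d)) := by
  have h1 : ContDiff ℝ ∞ (fderiv ℝ f) := hf.fderiv_right (by simp)
  have h2 : ContDiff ℝ ∞ (fderiv ℝ (fderiv ℝ f)) := h1.fderiv_right (by simp)
  have h3 : ContDiff ℝ ∞ (fderiv ℝ (fderiv ℝ (fderiv ℝ f))) := h2.fderiv_right (by simp)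
  funext x
  rw [iteratedDeriv_succ, iteratedDeriv_three_comp hf hγ]
  have g0 := hasDerivAt_iteratedDeriv hγ 0 x
  rw [iteratedDeriv_zero] at g0
  have g1 := hasDerivAt_iteratedDeriv hγ 1 x
  have g2 := hasDerivAt_iteratedDeriv hγ 2 x
  have g3 := hasDerivAt_iteratedDeriv hγ 3 x
  have e1 := ((h1.differentiable (by simp) (γ x)).hasFDerivAt.comp_hasDerivAt x g0)
  have e2 := ((h2.differentiable (by simp) (γ x)).hasFDerivAt.comp_hasDerivAt x g0)
  have e3 := ((h3.differentiable (by simp) (γ x)).hasFDerivAt.comp_hasDerivAt x g0)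
  refine HasDerivAt.deriv ((((((e3.clm_apply g1).clm_apply g1).clm_apply g1).add
    ((e2.clm_apply g2).clm_apply g1)).add ((e2.clm_apply g1).clm_apply g2)).add
    (((e2.clm_apply g1).clm_apply g2).add (e1.clm_apply g3)) |>.congr_deriv ?_)
  simp only [add_apply, Function.comp_apply]

end comp

end GenAMP

namespace GenAMP

open scoped ContDiff

/-! ### Functions with bounded derivatives, composed with curves -/

theorem iteratedDeriv_pi_apply {ι : Type*} [Fintype ι] {ξ : ι → ℝ → ℝ}
    (hξ : ∀ a, ContDiff ℝ ∞ (ξ a)) (j : ℕ) (x : ℝ) (a : ι) :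
    iteratedDeriv j (fun x a => ξ a x) x a = iteratedDeriv j (ξ a) x := by
  have hΓ : ContDiff ℝ ∞ (fun x a => ξ a x) := contDiff_pi.2 hξ
  induction j generalizing x with
  | zero => simp
  | succ j ih =>
    have h1 := hasDerivAt_pi.1 (hasDerivAt_iteratedDeriv hΓ j x) a
    have h2 : (fun y => iteratedDeriv j (fun x a => ξ a x) y a) = iteratedDeriv j (ξ a) :=
      funext ih
    rw [h2] at h1
    exact h1.unique (hasDerivAt_iteratedDeriv (hξ a) j x)

set_option maxSynthPendingDepth 6 in
/-- A smooth real function whose derivatives of orders one to four are bounded by `K`. -/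
structure SmoothBdd {E : Type*} [NormedAddCommGroup E] [NormedSpace ℝ E] (f : E → ℝ) (K : ℝ) :
    Prop where
  smooth : ContDiff ℝ ∞ f
  d1 : ∀ x, ‖fderiv ℝ f x‖ ≤ K
  d2 : ∀ x, ‖fderiv ℝ (fderiv ℝ f) x‖ ≤ K
  d3 : ∀ x, ‖fderiv ℝ (fderiv ℝ (fderiv ℝ f)) x‖ ≤ K
  d4 : ∀ x, ‖fderiv ℝ (fderiv ℝ (fderiv ℝ (fderiv ℝ f))) x‖ ≤ K

namespace SmoothBdd
variable {E : Type*} [NormedAddCommGroup E] [NormedSpace ℝ E] {f : E → ℝ} {K : ℝ}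
  {γ : ℝ → E}

theorem nonneg (hf : SmoothBdd f K) : 0 ≤ K := (norm_nonneg _).trans (hf.d1 0)

theorem abs_d1_le (hf : SmoothBdd f K) (x a : E) : |fderiv ℝ f x a| ≤ K * ‖a‖ :=
  (fderiv ℝ f x).le_of_opNorm_le (hf.d1 x) a

theorem abs_d2_le (hf : SmoothBdd f K) (x a b : E) :
    |fderiv ℝ (fderiv ℝ f) x a b| ≤ K * ‖a‖ * ‖b‖ :=
  ContinuousLinearMap.le_of_opNorm_le _
    (ContinuousLinearMap.le_of_opNorm_le _ (hf.d2 x) a) b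

set_option maxSynthPendingDepth 6 in
theorem abs_d3_le (hf : SmoothBdd f K) (x a b c : E) :
    |fderiv ℝ (fderiv ℝ (fderiv ℝ f)) x a b c| ≤ K * ‖a‖ * ‖b‖ * ‖c‖ :=
  ContinuousLinearMap.le_of_opNorm_le _ (ContinuousLinearMap.le_of_opNorm_le _
    (ContinuousLinearMap.le_of_opNorm_le _ (hf.d3 x) a) b) c

set_option maxSynthPendingDepth 6 in
theorem abs_d4_le (hf : SmoothBdd f K) (x a b c d : E) :
    |fderiv ℝ (fderiv ℝ (fderiv ℝ (fderiv ℝ f))) x a b c d| ≤ K * ‖a‖ * ‖b‖ * ‖c‖ * ‖d‖ :=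
  ContinuousLinearMap.le_of_opNorm_le _ (ContinuousLinearMap.le_of_opNorm_le _
    (ContinuousLinearMap.le_of_opNorm_le _
      (ContinuousLinearMap.le_of_opNorm_le _ (hf.d4 x) a) b) c) d

variable (hf : SmoothBdd f K) (hγ : ContDiff ℝ ∞ γ) (x : ℝ)
include hf hγ

theorem abs_iteratedDeriv_one_comp_le :
    |iteratedDeriv 1 (f ∘ γ) x| ≤ K * ‖iteratedDeriv 1 γ x‖ := by
  rw [iteratedDeriv_one_comp hf.smooth hγ]; exact hf.abs_d1_le _ _

theorem abs_iteratedDeriv_two_comp_le :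
    |iteratedDeriv 2 (f ∘ γ) x| ≤ K * (‖iteratedDeriv 1 γ x‖ ^ 2 + ‖iteratedDeriv 2 γ x‖) := by
  rw [iteratedDeriv_two_comp hf.smooth hγ]
  refine (abs_add_le _ _).trans ((add_le_add (hf.abs_d2_le _ _ _) (hf.abs_d1_le _ _)).trans ?_)
  exact le_of_eq (by ring)

/-- The term linear in the third derivative of the curve is split off because it is the one whose
sum over all entries must keep its signs. The remaining terms are products of lower derivatives and
can be summed in absolute value. -/
theorem abs_iteratedDeriv_three_comp_sub_le :
    |iteratedDeriv 3 (f ∘ γ) x - fderiv ℝ f (γ x) (iteratedDeriv 3 γ x)| ≤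
      K * (‖iteratedDeriv 1 γ x‖ ^ 3 + 3 * (‖iteratedDeriv 1 γ x‖ * ‖iteratedDeriv 2 γ x‖)) := by
  rw [iteratedDeriv_three_comp hf.smooth hγ]
  set a := iteratedDeriv 1 γ x
  set b := iteratedDeriv 2 γ x
  have h1 := abs_le.1 (hf.abs_d3_le (γ x) a a a)
  have h2 := abs_le.1 (hf.abs_d2_le (γ x) b a)
  have h3 := abs_le.1 (hf.abs_d2_le (γ x) a b)
  rw [abs_le]
  constructor <;> ring_nf at * <;> linarith

theorem abs_iteratedDeriv_three_comp_le :
    |iteratedDeriv 3 (f ∘ γ) x| ≤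
      K * (‖iteratedDeriv 1 γ x‖ ^ 3 + 3 * (‖iteratedDeriv 1 γ x‖ * ‖iteratedDeriv 2 γ x‖)
        + ‖iteratedDeriv 3 γ x‖) := by
  have h1 := abs_le.1 (hf.abs_iteratedDeriv_three_comp_sub_le hγ x)
  have h2 := abs_le.1 (hf.abs_d1_le (γ x) (iteratedDeriv 3 γ x))
  rw [abs_le]
  constructor <;> linarith

/-- The coefficients 1, 6, 4, 3, 1 count the partitions of a four-element set by block sizes. -/
theorem abs_iteratedDeriv_four_comp_le :
    |iteratedDeriv 4 (f ∘ γ) x| ≤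
      K * (‖iteratedDeriv 1 γ x‖ ^ 4 + 6 * (‖iteratedDeriv 1 γ x‖ ^ 2 * ‖iteratedDeriv 2 γ x‖)
        + 4 * (‖iteratedDeriv 1 γ x‖ * ‖iteratedDeriv 3 γ x‖)
        + 3 * ‖iteratedDeriv 2 γ x‖ ^ 2 + ‖iteratedDeriv 4 γ x‖) := by
  rw [iteratedDeriv_four_comp hf.smooth hγ]
  dsimp only
  set a := iteratedDeriv 1 γ x
  set b := iteratedDeriv 2 γ x
  set c := iteratedDeriv 3 γ x
  set d := iteratedDeriv 4 γ x
  have h1 := abs_le.1 (hf.abs_d4_le (γ x) a a a a)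
  have h2 := abs_le.1 (hf.abs_d3_le (γ x) b a a)
  have h3 := abs_le.1 (hf.abs_d3_le (γ x) a b a)
  have h4 := abs_le.1 (hf.abs_d3_le (γ x) a a b)
  have h5 := abs_le.1 (hf.abs_d2_le (γ x) a c)
  have h6 := abs_le.1 (hf.abs_d2_le (γ x) c a)
  have h7 := abs_le.1 (hf.abs_d2_le (γ x) b b)
  have h8 := abs_le.1 (hf.abs_d1_le (γ x) d)
  rw [abs_le]
  constructor <;> ring_nf at * <;> linarith

end SmoothBdd

/-! ### Symmetric matrices and their entries on and above the diagonal -/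

/-- The positions on and above the diagonal. -/
abbrev Pair (n : ℕ) : Type := {p : Fin n × Fin n // p.1 ≤ p.2}

/-- The position on or above the diagonal corresponding to `(i, j)`. -/
def pairOf {n : ℕ} (i j : Fin n) : Pair n := ⟨(min i j, max i j), min_le_max⟩

/-- The symmetric matrix with the given entries on and above the diagonal. -/
def symM {n : ℕ} (x : Pair n → ℝ) : Matrix (Fin n) (Fin n) ℝ := fun i j => x (pairOf i j)

/-- The symmetric matrix with entry `1 / √n` at the position `m`, and zero elsewhere. -/
noncomputable def unitM {n : ℕ} (m : Pair n) : Matrix (Fin n) (Fin n) ℝ :=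
  fun i j => if pairOf i j = m then (√(n : ℝ))⁻¹ else 0

section unitM
variable {n : ℕ}

theorem pairOf_eq_iff (i j : Fin n) (m : Pair n) :
    pairOf i j = m ↔ (i = m.1.1 ∧ j = m.1.2) ∨ (i = m.1.2 ∧ j = m.1.1) := by
  obtain ⟨⟨p, r⟩, h⟩ := m
  simp only [pairOf, Subtype.mk.injEq, Prod.mk.injEq]
  simp only at h
  rcases le_total i j with hij | hij
  · rw [min_eq_left hij, max_eq_right hij]; grind
  · rw [min_eq_right hij, max_eq_left hij]; grind

/-- The nested conditional makes a diagonal position count once and an off-diagonal position twice.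
-/
theorem unitM_mulVec (m : Pair n) (v : Fin n → ℝ) (l : Fin n) :
    (unitM m *ᵥ v) l = (√(n : ℝ))⁻¹ *
      (if l = m.1.1 then v m.1.2 else if l = m.1.2 then v m.1.1 else 0) := by
  simp only [Matrix.mulVec, dotProduct, unitM, pairOf_eq_iff, ite_mul, zero_mul]
  split_ifs with h1 h2
  · by_cases h : m.1.1 = m.1.2
    · subst h1; simp [h]
    · subst h1; simp [h]
  · subst h2
    have : ¬ m.1.2 = m.1.1 := h1
    simp [this]
  · simp [h1, h2]

/-- Up to the factor `1 / √n`, the matrix swaps two coordinates and kills the others, and the swap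
is an isometry. -/
theorem l2_unitM_mulVec_le (m : Pair n) (v : Fin n → ℝ) :
    l2 (unitM m *ᵥ v) ≤ (√(n : ℝ))⁻¹ * l2 v := by
  have h : l2 (unitM m *ᵥ v) ≤
      l2 (fun l => (√(n : ℝ))⁻¹ * v (Equiv.swap m.1.1 m.1.2 l)) := l2_mono fun l => by
    rw [unitM_mulVec, abs_mul, abs_mul]
    refine mul_le_mul_of_nonneg_left ?_ (abs_nonneg _)
    split_ifs with h1 h2
    · rw [h1, Equiv.swap_apply_left]
    · rw [h2, Equiv.swap_apply_right]
    · simp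
  refine h.trans_eq ?_
  rw [l2_smul, abs_of_nonneg (by positivity), l2_eq_sqrt, l2_eq_sqrt,
    Equiv.sum_comp (Equiv.swap m.1.1 m.1.2) (fun l => v l ^ 2)]

theorem opN_unitM_le (m : Pair n) : opN (unitM m) ≤ (√(n : ℝ))⁻¹ :=
  opN_le _ (by positivity) (l2_unitM_mulVec_le m)

/-- Only two coordinates of `v` enter, so a uniform bound replaces the Euclidean norm. This is
needed for the undifferentiated orbit, whose Euclidean norm may be of order `√n`. -/
theorem l2_unitM_mulVec_le_of_abs_le (m : Pair n) {v : Fin n → ℝ} {B : ℝ} (hB : 0 ≤ B)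
    (h : ∀ l, |v l| ≤ B) : l2 (unitM m *ᵥ v) ≤ 2 * (√(n : ℝ))⁻¹ * B := by
  have h1 : l2 (unitM m *ᵥ v) ≤ l2 (fun l => (√(n : ℝ))⁻¹ *
      ((if l = m.1.1 then B else 0) + (if l = m.1.2 then B else 0))) := l2_mono fun l => by
    rw [unitM_mulVec, abs_mul, abs_mul]
    refine mul_le_mul_of_nonneg_left ?_ (abs_nonneg _)
    rw [abs_of_nonneg (a := _ + _) (by positivity)]
    split_ifs with h1 h2 h2
    · linarith [h m.1.2]
    · linarith [h m.1.2]
    · linarith [h m.1.1]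
    · simp
  have h2 : ∀ p : Fin n, l2 (fun l => if l = p then B else 0) = B := fun p => by
    rw [l2_eq_sqrt]; simp [ite_pow, Real.sqrt_sq hB]
  refine h1.trans ?_
  rw [l2_smul, abs_of_nonneg (by positivity)]
  have h3 := l2_add (fun l => if l = m.1.1 then B else 0) (fun l => if l = m.1.2 then B else 0)
  rw [h2, h2] at h3
  calc _ ≤ (√(n : ℝ))⁻¹ * (B + B) := by gcongr
    _ = _ := by ring

theorem unitM_mulVec_eq_zero {m : Pair n} {l : Fin n} (v : Fin n → ℝ)
    (h : m ∉ Finset.univ.image (pairOf l)) : (unitM m *ᵥ v) l = 0 := by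
  simp only [Matrix.mulVec, dotProduct, unitM]
  refine Finset.sum_eq_zero fun j _ => ?_
  rw [if_neg, zero_mul]
  rintro rfl
  exact h (Finset.mem_image_of_mem _ (Finset.mem_univ j))

theorem card_image_pairOf_le (l : Fin n) : (Finset.univ.image (pairOf l)).card ≤ n :=
  Finset.card_image_le.trans (by simp)

theorem card_pair_le : (Fintype.card (Pair n) : ℝ) ≤ (n : ℝ) ^ 2 := by
  have := Fintype.card_subtype_le (fun p : Fin n × Fin n => p.1 ≤ p.2)
  rw [Fintype.card_prod, Fintype.card_fin] at this
  rw [sq]; exact_mod_cast this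

/-- The weighted one-entry perturbations assemble into a single symmetric matrix, so their sum can
be estimated by a Frobenius norm instead of entry by entry. -/
theorem sum_mul_unitM_mulVec (c : Pair n → ℝ) (v : Fin n → ℝ) (l : Fin n) :
    ∑ m, c m * (unitM m *ᵥ v) l = (√(n : ℝ))⁻¹ * (symM c *ᵥ v) l := by
  simp only [Matrix.mulVec, dotProduct, unitM, symM, Finset.mul_sum]
  rw [Finset.sum_comm]
  refine Finset.sum_congr rfl fun j _ => ?_
  rw [Finset.sum_eq_single (pairOf l j)]
  · simp; ring
  · intro m _ hm; rw [if_neg (Ne.symm hm)]; ring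
  · simp

theorem card_fiber_pairOf_le (m : Pair n) :
    (Finset.univ.filter (fun p : Fin n × Fin n => pairOf p.1 p.2 = m)).card ≤ 2 := by
  have h2 : Finset.univ.filter (fun p : Fin n × Fin n => pairOf p.1 p.2 = m) ⊆
      {(m.1.1, m.1.2), (m.1.2, m.1.1)} := fun p hp => by
    rw [Finset.mem_filter, pairOf_eq_iff] at hp
    simp only [Finset.mem_insert, Finset.mem_singleton, Prod.ext_iff]
    exact hp.2
  exact (Finset.card_le_card h2).trans Finset.card_le_two

theorem sum_symM_sq_le (c : Pair n → ℝ) : ∑ i, ∑ j, symM c i j ^ 2 ≤ 2 * ∑ m, c m ^ 2 := by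
  rw [← Fintype.sum_prod_type', ← Finset.sum_fiberwise (s := Finset.univ)
    (g := fun p : Fin n × Fin n => pairOf p.1 p.2), Finset.mul_sum]
  refine Finset.sum_le_sum fun m _ => ?_
  have h1 : ∀ p ∈ Finset.univ.filter (fun p : Fin n × Fin n => pairOf p.1 p.2 = m),
      symM c p.1 p.2 ^ 2 = c m ^ 2 := fun p hp => by
    rw [Finset.mem_filter] at hp; simp only [symM, hp.2]
  rw [Finset.sum_congr rfl h1, Finset.sum_const, nsmul_eq_mul]
  refine mul_le_mul_of_nonneg_right ?_ (sq_nonneg _)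
  exact_mod_cast card_fiber_pairOf_le m

end unitM

end GenAMP

namespace GenAMP

open scoped ContDiff

/-! ### Families of curves with controlled derivatives -/

/-- The size of the perturbation of the matrix by a change of one entry. -/
noncomputable def entryScale (n : ℕ) : ℝ := 2 * (√(n : ℝ))⁻¹

theorem entryScale_nonneg (n : ℕ) : 0 ≤ entryScale n := by unfold entryScale; positivity

/-- At most `n ^ 2` positions against `(2 / √n) ^ 4`: squares of second-order quantities are
summable over all entries. -/
theorem card_pair_mul_entryScale_pow_le (n : ℕ) :
    (Fintype.card (Pair n) : ℝ) * entryScale n ^ 4 ≤ 16 := by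
  rcases Nat.eq_zero_or_pos n with rfl | hn
  · simp [entryScale]
  have hn' : (0 : ℝ) < n := by exact_mod_cast hn
  have : entryScale n ^ 4 = 16 / (n : ℝ) ^ 2 := by
    rw [entryScale, mul_pow, inv_pow, show (√(n : ℝ)) ^ 4 = ((√(n : ℝ)) ^ 2) ^ 2 by ring,
      Real.sq_sqrt hn'.le]
    norm_num [div_eq_mul_inv]
  rw [this]
  calc (Fintype.card (Pair n) : ℝ) * (16 / (n : ℝ) ^ 2) ≤ (n : ℝ) ^ 2 * (16 / (n : ℝ) ^ 2) := by
        gcongr; exact card_pair_le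
    _ = 16 := by field_simp

/-- A family of curves in `ℝⁿ`, indexed by the entries of a symmetric matrix, with common value at
zero. The `j`-th derivatives at zero have the size of a `j`-th power of the scale of an entry,
and there are bounds for linear combinations of the first and of the third derivatives. -/
structure IsGood {n : ℕ} (Q : ℝ) (ξ : Pair n → Fin n → ℝ → ℝ) : Prop where
  smooth : ∀ m l, ContDiff ℝ ∞ (ξ m l)
  base : ∀ m m' l, ξ m l 0 = ξ m' l 0
  deriv_le : ∀ j, 1 ≤ j → j ≤ 4 → ∀ m,
    l2 (fun l => iteratedDeriv j (ξ m l) 0) ≤ Q * entryScale n ^ j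
  grad_le : ∀ c : Pair n → ℝ, l2 (fun l => ∑ m, c m * iteratedDeriv 1 (ξ m l) 0) ≤ Q * l2 c
  third_le : ∀ c : Pair n → ℝ, (∀ m, |c m| ≤ 1) →
    l2 (fun l => ∑ m, c m * iteratedDeriv 3 (ξ m l) 0) ≤ Q

namespace IsGood
variable {n : ℕ} {Q : ℝ} {ξ : Pair n → Fin n → ℝ → ℝ}

theorem nonneg (h : IsGood Q ξ) : 0 ≤ Q :=
  (l2_nonneg _).trans (h.third_le 0 (by simp))

theorem mono (h : IsGood Q ξ) {Q' : ℝ} (hQ : Q ≤ Q') : IsGood Q' ξ where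
  smooth := h.smooth
  base := h.base
  deriv_le j h1 h2 m := (h.deriv_le j h1 h2 m).trans
    (mul_le_mul_of_nonneg_right hQ (pow_nonneg (entryScale_nonneg n) _))
  grad_le c := (h.grad_le c).trans (mul_le_mul_of_nonneg_right hQ (l2_nonneg _))
  third_le c hc := (h.third_le c hc).trans hQ

theorem const (u : Fin n → ℝ) (hQ : 0 ≤ Q) : IsGood Q (fun (_ : Pair n) l _ => u l) where
  smooth _ _ := contDiff_const
  base _ _ _ := rfl
  deriv_le j h1 _ _ := by
    have : ∀ l, iteratedDeriv j (fun _ : ℝ => u l) 0 = 0 := fun l => by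
      rw [iteratedDeriv_const, if_neg (by omega)]
    simp only [this, l2_zero]
    exact mul_nonneg hQ (pow_nonneg (entryScale_nonneg n) _)
  grad_le c := by
    simp only [iteratedDeriv_const, one_ne_zero, if_false, mul_zero, Finset.sum_const_zero,
      l2_zero]
    exact mul_nonneg hQ (l2_nonneg _)
  third_le c _ := by
    simpa [iteratedDeriv_const, l2_zero] using hQ

/-- Duality: with the weights `c` equal to the gradient of coordinate `l` itself, coordinate `l` of
the bound `grad_le` reads `l2 c ^ 2 ≤ Q * l2 c`. Thus the norm of the Jacobian bounds each of its
rows. -/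
theorem sum_deriv_sq_le (h : IsGood Q ξ) (l : Fin n) :
    ∑ m, iteratedDeriv 1 (ξ m l) 0 ^ 2 ≤ Q ^ 2 := by
  set c : Pair n → ℝ := fun m => iteratedDeriv 1 (ξ m l) 0
  have h1 := (le_abs_self _).trans
    ((abs_le_l2 (fun l => ∑ m, c m * iteratedDeriv 1 (ξ m l) 0) l).trans (h.grad_le c))
  have h2 : ∑ m, c m * iteratedDeriv 1 (ξ m l) 0 = l2 c ^ 2 := by
    rw [l2_sq]; exact Finset.sum_congr rfl fun m _ => by simp only [c]; ring
  rw [h2] at h1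
  rw [show ∑ m, iteratedDeriv 1 (ξ m l) 0 ^ 2 = l2 c ^ 2 from (l2_sq c).symm]
  have h3 : l2 c ≤ Q := by
    by_contra hcon
    push Not at hcon
    nlinarith [h.nonneg]
  exact pow_le_pow_left₀ (l2_nonneg _) h3 2

end IsGood

theorem norm_pi_le_l2 {d : ℕ} (v : Fin d → ℝ) : ‖v‖ ≤ l2 v :=
  (pi_norm_le_iff_of_nonneg (l2_nonneg v)).2 fun a => abs_le_l2 v a

theorem norm_pi_le_sum {d : ℕ} (v : Fin d → ℝ) : ‖v‖ ≤ ∑ a, |v a| :=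
  (pi_norm_le_iff_of_nonneg (Finset.sum_nonneg fun _ _ => abs_nonneg _)).2 fun a =>
    Finset.single_le_sum (f := fun a => |v a|) (fun _ _ => abs_nonneg _) (Finset.mem_univ a)

theorem l2_abs {ι : Type*} [Fintype ι] (v : ι → ℝ) : l2 (fun i => |v i|) = l2 v := by
  simp [l2_eq_sqrt]

/-! ### Derivative bounds under coordinatewise composition -/

section comp
variable {n d : ℕ} {Q K : ℝ} {ξ : Fin d → Pair n → Fin n → ℝ → ℝ}
  (hξ : ∀ a, IsGood Q (ξ a))
include hξ

theorem l2_norm_jet_le {j : ℕ} (h1 : 1 ≤ j) (h4 : j ≤ 4) (m : Pair n) :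
    l2 (fun l => ‖iteratedDeriv j (fun x a => ξ a m l x) 0‖) ≤ d * Q * entryScale n ^ j := by
  calc _ ≤ l2 (fun l => ∑ a, |iteratedDeriv j (ξ a m l) 0|) := l2_mono_of_le fun l => by
        rw [abs_norm]
        refine (norm_pi_le_sum _).trans_eq (Finset.sum_congr rfl fun a _ => ?_)
        rw [iteratedDeriv_pi_apply fun a => (hξ a).smooth m l]
    _ ≤ ∑ a : Fin d, l2 (fun l => |iteratedDeriv j (ξ a m l) 0|) := l2_sum _ _
    _ ≤ ∑ a : Fin d, Q * entryScale n ^ j := Finset.sum_le_sum fun a _ => by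
        rw [l2_abs]; exact (hξ a).deriv_le j h1 h4 m
    _ = _ := by simp; ring

theorem sum_norm_jet_sq_le (l : Fin n) :
    ∑ m, ‖iteratedDeriv 1 (fun x a => ξ a m l x) 0‖ ^ 2 ≤ d * Q ^ 2 := by
  calc _ ≤ ∑ m, ∑ a, iteratedDeriv 1 (ξ a m l) 0 ^ 2 := Finset.sum_le_sum fun m _ => by
        refine (pow_le_pow_left₀ (norm_nonneg _) (norm_pi_le_l2 _) 2).trans_eq ?_
        rw [l2_sq]
        refine Finset.sum_congr rfl fun a _ => ?_
        rw [iteratedDeriv_pi_apply fun a => (hξ a).smooth m l]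
    _ = ∑ a, ∑ m, iteratedDeriv 1 (ξ a m l) 0 ^ 2 := Finset.sum_comm
    _ ≤ ∑ a : Fin d, Q ^ 2 := Finset.sum_le_sum fun a _ => (hξ a).sum_deriv_sq_le l
    _ = _ := by simp

/-- The base point `b` does not depend on the entry, so the differential is one linear map, and the
weighted sum passes inside it with all cancellations intact. -/
theorem abs_sum_fderiv_jet_le {f : (Fin d → ℝ) → ℝ} (hf : SmoothBdd f K) (j : ℕ)
    (c : Pair n → ℝ) (l : Fin n) (b : Fin d → ℝ) :
    |∑ m, c m * fderiv ℝ f b (iteratedDeriv j (fun x a => ξ a m l x) 0)| ≤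
      K * ∑ a, |∑ m, c m * iteratedDeriv j (ξ a m l) 0| := by
  have h1 : ∑ m, c m * fderiv ℝ f b (iteratedDeriv j (fun x a => ξ a m l x) 0) =
      fderiv ℝ f b (fun a => ∑ m, c m * iteratedDeriv j (ξ a m l) 0) := by
    have : (fun a => ∑ m, c m * iteratedDeriv j (ξ a m l) 0) =
        ∑ m, c m • iteratedDeriv j (fun x a => ξ a m l x) 0 := by
      funext a
      rw [Finset.sum_apply]
      refine Finset.sum_congr rfl fun m _ => ?_
      rw [Pi.smul_apply, iteratedDeriv_pi_apply fun a => (hξ a).smooth m l, smul_eq_mul]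
    rw [this, map_sum]
    simp
  rw [h1]
  exact (hf.abs_d1_le _ _).trans (mul_le_mul_of_nonneg_left (norm_pi_le_sum _) hf.nonneg)

theorem l2_sum_fderiv_jet_le {f : (Fin d → ℝ) → ℝ} (hf : SmoothBdd f K) (j : ℕ)
    (c : Pair n → ℝ) (b : Fin n → Fin d → ℝ) {R : ℝ}
    (hR : ∀ a, l2 (fun l => ∑ m, c m * iteratedDeriv j (ξ a m l) 0) ≤ R) :
    l2 (fun l => ∑ m, c m * fderiv ℝ f (b l) (iteratedDeriv j (fun x a => ξ a m l x) 0)) ≤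
      K * (d * R) := by
  calc _ ≤ l2 (fun l => K * ∑ a, |∑ m, c m * iteratedDeriv j (ξ a m l) 0|) :=
        l2_mono_of_le fun l => abs_sum_fderiv_jet_le hξ hf j c l (b l)
    _ = K * l2 (fun l => ∑ a, |∑ m, c m * iteratedDeriv j (ξ a m l) 0|) := by
        rw [l2_smul, abs_of_nonneg hf.nonneg]
    _ ≤ K * ∑ a : Fin d, R := by
        refine mul_le_mul_of_nonneg_left ((l2_sum _ _).trans ?_) hf.nonneg
        exact Finset.sum_le_sum fun a _ => by rw [l2_abs]; exact hR a
    _ = _ := by simp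

/-- Cauchy–Schwarz over the entries at each site. The first derivatives are square-summable by
`sum_norm_jet_sq_le`, and the second-order factors by the count in
`card_pair_mul_entryScale_pow_le`, whose bound 16 gives the factor 4. -/
theorem l2_sum_jet_mul_le {h : Pair n → Fin n → ℝ} {R : ℝ} (hR : 0 ≤ R)
    (hh : ∀ m, l2 (h m) ≤ R * entryScale n ^ 2) :
    l2 (fun l => ∑ m, ‖iteratedDeriv 1 (fun x a => ξ a m l x) 0‖ * h m l) ≤
      4 * (√(d * Q ^ 2) * R) := by
  have hd : (0 : ℝ) ≤ d * Q ^ 2 := by positivity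
  refine l2_le_of_sum_sq_le (by positivity) ?_
  calc _ ≤ ∑ l, d * Q ^ 2 * ∑ m, h m l ^ 2 := Finset.sum_le_sum fun l _ =>
        (Finset.sum_mul_sq_le_sq_mul_sq _ _ _).trans
          (mul_le_mul_of_nonneg_right (sum_norm_jet_sq_le hξ l)
            (Finset.sum_nonneg fun _ _ => sq_nonneg _))
    _ = d * Q ^ 2 * ∑ m, l2 (h m) ^ 2 := by
        rw [← Finset.mul_sum, Finset.sum_comm]; simp only [l2_sq]
    _ ≤ d * Q ^ 2 * ∑ m : Pair n, (R * entryScale n ^ 2) ^ 2 := by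
        gcongr with m; exacts [l2_nonneg _, hh m]
    _ = d * Q ^ 2 * (R ^ 2 * (Fintype.card (Pair n) * entryScale n ^ 4)) := by
        rw [Finset.sum_const, nsmul_eq_mul, Finset.card_univ]; ring
    _ ≤ d * Q ^ 2 * (R ^ 2 * 16) := by
        gcongr; exact card_pair_mul_entryScale_pow_le n
    _ = (4 * (√(d * Q ^ 2) * R)) ^ 2 := by
        rw [mul_pow, mul_pow, Real.sq_sqrt hd]; ring

/-- A smooth function applied coordinate by coordinate preserves control of derivatives. -/
theorem IsGood.comp {f : (Fin d → ℝ) → ℝ} (hf : SmoothBdd f K) (hd : 1 ≤ d) (hQ : 1 ≤ Q) :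
    IsGood (17 * K * (d * Q) ^ 4) (fun m l x => f fun a => ξ a m l x) := by
  have hΓ : ∀ m l, ContDiff ℝ ∞ (fun x a => ξ a m l x) := fun m l =>
    contDiff_pi.2 fun a => (hξ a).smooth m l
  have hK := hf.nonneg
  have he := entryScale_nonneg n
  set e := entryScale n
  have hd' : (1 : ℝ) ≤ d := by exact_mod_cast hd
  set D : ℝ := d * Q with hD
  have hD1 : 1 ≤ D := by nlinarith
  have hD0 : 0 ≤ D := by linarith
  -- Since `D ≥ 1`, all powers up to the fourth are absorbed in `D ^ 4`. The constant 17 is `1 + 4 +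
  -- 12` from the weighted third derivatives; the fourth derivative needs only `1 + 6 + 7 + 1`.
  have p12 : D ≤ D ^ 2 := le_self_pow₀ hD1 (by norm_num)
  have p23 : D ^ 2 ≤ D ^ 3 := pow_le_pow_right₀ hD1 (by norm_num)
  have p34 : D ^ 3 ≤ D ^ 4 := pow_le_pow_right₀ hD1 (by norm_num)
  let g : ℕ → Pair n → Fin n → ℝ := fun j m l => ‖iteratedDeriv j (fun x a => ξ a m l x) 0‖
  have hg0 : ∀ j m l, 0 ≤ g j m l := fun j m l => norm_nonneg _
  have hg : ∀ j, 1 ≤ j → j ≤ 4 → ∀ m, l2 (g j m) ≤ D * e ^ j :=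
    fun j h1 h4 m => l2_norm_jet_le hξ h1 h4 m
  have hmul : ∀ {v w : Fin n → ℝ} {a b : ℝ}, l2 v ≤ a → l2 w ≤ b →
      l2 (fun l => v l * w l) ≤ a * b := fun {v w a b} h1 h2 =>
    (l2_mul v w).trans (mul_le_mul h1 h2 (l2_nonneg _) ((l2_nonneg _).trans h1))
  have h11 : ∀ m, l2 (fun l => g 1 m l * g 1 m l) ≤ (D * e ^ 1) * (D * e ^ 1) := fun m =>
    hmul (hg 1 le_rfl (by norm_num) m) (hg 1 le_rfl (by norm_num) m)
  have h12 : ∀ m, l2 (fun l => g 1 m l * g 2 m l) ≤ (D * e ^ 1) * (D * e ^ 2) := fun m =>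
    hmul (hg 1 le_rfl (by norm_num) m) (hg 2 (by norm_num) (by norm_num) m)
  have hadd : ∀ {v w : Fin n → ℝ} {a b : ℝ}, l2 v ≤ a → l2 w ≤ b →
      l2 (fun l => v l + w l) ≤ a + b := fun {v w a b} h1 h2 =>
    (l2_add v w).trans (add_le_add h1 h2)
  have hsm : ∀ {v : Fin n → ℝ} {a : ℝ} {c : ℝ}, 0 ≤ c → l2 v ≤ a →
      l2 (fun l => c * v l) ≤ c * a := fun {v a c} hc h1 => by
    rw [l2_smul, abs_of_nonneg hc]; exact mul_le_mul_of_nonneg_left h1 hc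
  refine ⟨fun m l => hf.smooth.comp (hΓ m l), fun m m' l => ?_, fun j h1 h4 m => ?_,
    fun c => ?_, fun c hc => ?_⟩
  · simp only [fun a => (hξ a).base m m' l]
  · have hj : j = 1 ∨ j = 2 ∨ j = 3 ∨ j = 4 := by omega
    rcases hj with rfl | rfl | rfl | rfl
    · refine (l2_mono_of_le (w := fun l => K * g 1 m l) fun l =>
        hf.abs_iteratedDeriv_one_comp_le (hΓ m l) 0).trans
        ((hsm hK (hg 1 le_rfl (by norm_num) m)).trans ?_)
      rw [← mul_assoc]
      refine mul_le_mul_of_nonneg_right ?_ (pow_nonneg he _)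
      nlinarith
    · refine (l2_mono_of_le (w := fun l => K * (g 1 m l * g 1 m l + g 2 m l)) fun l =>
        (hf.abs_iteratedDeriv_two_comp_le (hΓ m l) 0).trans_eq (by ring)).trans
        ((hsm hK (hadd (h11 m) (hg 2 (by norm_num) (by norm_num) m))).trans ?_)
      calc _ = K * (D ^ 2 + D) * e ^ 2 := by ring
        _ ≤ _ := by
          refine mul_le_mul_of_nonneg_right ?_ (pow_nonneg he _)
          nlinarith
    · refine (l2_mono_of_le (w := fun l => K * (g 1 m l * g 1 m l * g 1 m l
          + 3 * (g 1 m l * g 2 m l) + g 3 m l)) fun l =>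
        (hf.abs_iteratedDeriv_three_comp_le (hΓ m l) 0).trans_eq (by ring)).trans
        ((hsm hK (hadd (hadd (hmul (h11 m) (hg 1 le_rfl (by norm_num) m))
          (hsm (by norm_num) (h12 m))) (hg 3 (by norm_num) (by norm_num) m))).trans ?_)
      calc _ = K * (D ^ 3 + 3 * D ^ 2 + D) * e ^ 3 := by ring
        _ ≤ _ := by
          refine mul_le_mul_of_nonneg_right ?_ (pow_nonneg he _)
          nlinarith
    · refine (l2_mono_of_le (w := fun l => K * ((g 1 m l * g 1 m l) * (g 1 m l * g 1 m l)
          + 6 * ((g 1 m l * g 1 m l) * g 2 m l) + 4 * (g 1 m l * g 3 m l)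
          + 3 * (g 2 m l * g 2 m l) + g 4 m l)) fun l =>
        (hf.abs_iteratedDeriv_four_comp_le (hΓ m l) 0).trans_eq (by ring)).trans
        ((hsm hK (hadd (hadd (hadd (hadd (hmul (h11 m) (h11 m))
          (hsm (by norm_num) (hmul (h11 m) (hg 2 (by norm_num) (by norm_num) m))))
          (hsm (by norm_num) (hmul (hg 1 le_rfl (by norm_num) m)
            (hg 3 (by norm_num) (by norm_num) m))))
          (hsm (by norm_num) (hmul (hg 2 (by norm_num) (by norm_num) m)
            (hg 2 (by norm_num) (by norm_num) m))))
          (hg 4 (by norm_num) (by norm_num) m))).trans ?_)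
      calc _ = K * (D ^ 4 + 6 * D ^ 3 + 7 * D ^ 2 + D) * e ^ 4 := by ring
        _ ≤ _ := by
          refine mul_le_mul_of_nonneg_right ?_ (pow_nonneg he _)
          nlinarith
  · rcases isEmpty_or_nonempty (Pair n) with hem | ⟨⟨m₀⟩⟩
    · simp only [Finset.univ_eq_empty, Finset.sum_empty, l2_zero]
      exact mul_nonneg (by positivity) (l2_nonneg _)
    -- All curves agree at zero, so the differential can be taken at the base point of `m₀` for
    -- every `m`.
    have h1 : ∀ m l, iteratedDeriv 1 (fun x => f fun a => ξ a m l x) 0 =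
        fderiv ℝ f (fun a => ξ a m₀ l 0) (iteratedDeriv 1 (fun x a => ξ a m l x) 0) :=
      fun m l => by
      have := congrFun (iteratedDeriv_one_comp hf.smooth (hΓ m l)) 0
      simp only [fun a => (hξ a).base m₀ m l]
      exact this
    simp only [h1]
    refine (l2_sum_fderiv_jet_le hξ hf 1 c _ fun a => (hξ a).grad_le c).trans ?_
    rw [← mul_assoc (d : ℝ), ← mul_assoc]
    refine mul_le_mul_of_nonneg_right ?_ (l2_nonneg _)
    nlinarith
  · rcases isEmpty_or_nonempty (Pair n) with hem | ⟨⟨m₀⟩⟩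
    · simp only [Finset.univ_eq_empty, Finset.sum_empty, l2_zero]
      positivity
    let b : Fin n → Fin d → ℝ := fun l a => ξ a m₀ l 0
    -- The linear term keeps the weights and uses `third_le` of the arguments. The products of lower
    -- derivatives are summed in absolute value, the weights being at most one.
    have hlin := l2_sum_fderiv_jet_le hξ hf 3 c b fun a => (hξ a).third_le c hc
    have hquad := l2_sum_jet_mul_le hξ (R := D ^ 2) (by positivity)
      (h := fun m l => g 1 m l * g 1 m l) fun m => (h11 m).trans_eq (by ring)
    have hmix := l2_sum_jet_mul_le hξ (R := D) (by positivity)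
      (h := fun m l => g 2 m l) fun m => hg 2 (by norm_num) (by norm_num) m
    have hsqrt : √(d * Q ^ 2) ≤ D := by
      refine Real.sqrt_le_iff.2 ⟨hD0, ?_⟩
      rw [hD, mul_pow]
      refine mul_le_mul_of_nonneg_right ?_ (sq_nonneg _)
      nlinarith
    have hpt : ∀ l, |∑ m, c m * iteratedDeriv 3 (fun x => f fun a => ξ a m l x) 0| ≤
        |∑ m, c m * fderiv ℝ f (b l) (iteratedDeriv 3 (fun x a => ξ a m l x) 0)| +
        K * ((∑ m, g 1 m l * (g 1 m l * g 1 m l)) + 3 * ∑ m, g 1 m l * g 2 m l) := fun l => by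
      have e1 : ∑ m, c m * iteratedDeriv 3 (fun x => f fun a => ξ a m l x) 0 =
          ∑ m, c m * fderiv ℝ f (b l) (iteratedDeriv 3 (fun x a => ξ a m l x) 0) +
          ∑ m, c m * (iteratedDeriv 3 (fun x => f fun a => ξ a m l x) 0 -
            fderiv ℝ f (b l) (iteratedDeriv 3 (fun x a => ξ a m l x) 0)) := by
        rw [← Finset.sum_add_distrib]; exact Finset.sum_congr rfl fun m _ => by ring
      rw [e1]
      refine (abs_add_le _ _).trans (add_le_add le_rfl ?_)
      refine (Finset.abs_sum_le_sum_abs _ _).trans ?_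
      rw [Finset.mul_sum, ← Finset.sum_add_distrib, Finset.mul_sum]
      refine Finset.sum_le_sum fun m _ => ?_
      have h3 := hf.abs_iteratedDeriv_three_comp_sub_le (hΓ m l) 0
      have hb : b l = fun a => ξ a m l 0 := funext fun a => (hξ a).base m₀ m l
      rw [abs_mul, hb]
      refine (mul_le_of_le_one_left (abs_nonneg _) (hc m)).trans (h3.trans_eq ?_)
      simp only [g]; ring
    refine (l2_mono_of_le hpt).trans ((hadd ((l2_abs _).trans_le hlin)
      (hsm hK (hadd (hquad.trans (mul_le_mul_of_nonneg_left
        (mul_le_mul_of_nonneg_right hsqrt (by positivity)) (by norm_num)))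
      (hsm (by norm_num) (hmix.trans (mul_le_mul_of_nonneg_left
        (mul_le_mul_of_nonneg_right hsqrt (by positivity)) (by norm_num))))))).trans ?_)
    calc _ = K * (D + 4 * D ^ 3 + 12 * D ^ 2) := by rw [hD]; ring
      _ ≤ K * (17 * D ^ 4) := mul_le_mul_of_nonneg_left (by linarith) hK
      _ = _ := by ring

end comp
end GenAMP

namespace GenAMP

open scoped ContDiff

/-! ### Derivative bounds under multiplication by the perturbed matrix -/

section mul
variable {n : ℕ} (M E : Matrix (Fin n) (Fin n) ℝ) {u : Fin n → ℝ → ℝ}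

theorem contDiff_affine_mulVec (hu : ∀ l, ContDiff ℝ ∞ (u l)) (l : Fin n) :
    ContDiff ℝ ∞ (fun x => ((M + x • E) *ᵥ fun i => u i x) l) := by
  simp only [Matrix.mulVec, dotProduct, Matrix.add_apply, Matrix.smul_apply, smul_eq_mul]
  exact ContDiff.sum fun i _ =>
    (contDiff_const.add (contDiff_id.mul contDiff_const)).mul (hu i)

/-- The Leibniz rule with a factor affine in `x`: at most one derivative falls on the matrix. -/
theorem iteratedDeriv_affine_mulVec (hu : ∀ l, ContDiff ℝ ∞ (u l)) (j : ℕ) (l : Fin n) (x : ℝ) :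
    iteratedDeriv (j + 1) (fun x => ((M + x • E) *ᵥ fun i => u i x) l) x =
      ((M + x • E) *ᵥ fun i => iteratedDeriv (j + 1) (u i) x) l +
        (j + 1 : ℕ) * (E *ᵥ fun i => iteratedDeriv j (u i) x) l := by
  have key : ∀ (j : ℕ) (x : ℝ),
      HasDerivAt (fun x => ((M + x • E) *ᵥ fun i => iteratedDeriv j (u i) x) l)
        (((M + x • E) *ᵥ fun i => iteratedDeriv (j + 1) (u i) x) l +
          (E *ᵥ fun i => iteratedDeriv j (u i) x) l) x := fun j x => by
    simp only [Matrix.mulVec, dotProduct, Matrix.add_apply, Matrix.smul_apply, smul_eq_mul]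
    rw [← Finset.sum_add_distrib]
    refine HasDerivAt.fun_sum fun i _ => ?_
    have h1 : HasDerivAt (fun x : ℝ => M l i + x * E l i) (E l i) x := by
      simpa using ((hasDerivAt_id x).mul_const (E l i)).const_add (M l i)
    exact (h1.mul (hasDerivAt_iteratedDeriv (hu i) j x)).congr_deriv (by ring)
  have key' : ∀ (j : ℕ) (x : ℝ), HasDerivAt (fun x => (E *ᵥ fun i => iteratedDeriv j (u i) x) l)
      ((E *ᵥ fun i => iteratedDeriv (j + 1) (u i) x) l) x := fun j x => by
    simp only [Matrix.mulVec, dotProduct]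
    exact HasDerivAt.fun_sum fun i _ => (hasDerivAt_iteratedDeriv (hu i) j x).const_mul _
  induction j generalizing x with
  | zero =>
    rw [zero_add, iteratedDeriv_one]
    have := (key 0 x).deriv
    simp only [iteratedDeriv_zero, zero_add] at this
    rw [this]; simp
  | succ j ih =>
    rw [iteratedDeriv_succ, funext ih,
      ((key (j + 1) x).fun_add ((key' j x).const_mul ((j + 1 : ℕ) : ℝ))).deriv]
    push_cast; ring

/-- Multiplication by the perturbed matrix preserves control of derivatives. -/
theorem IsGood.mulVec {Q B : ℝ} {ξ : Pair n → Fin n → ℝ → ℝ} (hξ : IsGood Q ξ) (hB : 0 ≤ B)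
    (hbd : ∀ m l, |ξ m l 0| ≤ B) :
    IsGood ((opN M + 24) * (Q + B))
      (fun m l x => ((M + x • unitM m) *ᵥ fun i => ξ m i x) l) := by
  have hQ := hξ.nonneg
  have hM := opN_nonneg M
  have he := entryScale_nonneg n
  have hes : (√(n : ℝ))⁻¹ ≤ entryScale n := by
    unfold entryScale
    have : 0 ≤ (√(n : ℝ))⁻¹ := by positivity
    linarith
  have hform : ∀ (j : ℕ) (m : Pair n) (l : Fin n),
      iteratedDeriv (j + 1) (fun x => ((M + x • unitM m) *ᵥ fun i => ξ m i x) l) 0 =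
      (M *ᵥ fun i => iteratedDeriv (j + 1) (ξ m i) 0) l +
        (j + 1 : ℕ) * (unitM m *ᵥ fun i => iteratedDeriv j (ξ m i) 0) l := fun j m l => by
    rw [iteratedDeriv_affine_mulVec M (unitM m) (hξ.smooth m)]; simp
  have hsumM : ∀ (c : Pair n → ℝ) (j : ℕ) (l : Fin n),
      ∑ m, c m * (M *ᵥ fun i => iteratedDeriv j (ξ m i) 0) l =
        (M *ᵥ fun i => ∑ m, c m * iteratedDeriv j (ξ m i) 0) l := fun c j l => by
    simp only [Matrix.mulVec, dotProduct, Finset.mul_sum]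
    rw [Finset.sum_comm]
    exact Finset.sum_congr rfl fun i _ => Finset.sum_congr rfl fun m _ => by ring
  refine ⟨fun m l => contDiff_affine_mulVec M _ (hξ.smooth m) l, fun m m' l => ?_,
    fun j h1 h4 m => ?_, fun c => ?_, fun c hc => ?_⟩
  · simp only [zero_smul, add_zero, fun i => hξ.base m m' i]
  · obtain ⟨j, rfl⟩ : ∃ i, j = i + 1 := ⟨j - 1, by omega⟩
    simp only [hform]
    refine (l2_add _ _).trans ?_
    rw [l2_smul, abs_of_nonneg (Nat.cast_nonneg _)]
    have e1 : l2 (M *ᵥ fun i => iteratedDeriv (j + 1) (ξ m i) 0) ≤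
        opN M * (Q * entryScale n ^ (j + 1)) :=
      (l2_mulVec_le M _).trans (mul_le_mul_of_nonneg_left (hξ.deriv_le _ h1 h4 m) hM)
    have e2 : l2 (unitM m *ᵥ fun i => iteratedDeriv j (ξ m i) 0) ≤
        (Q + B) * entryScale n ^ (j + 1) := by
      -- For `j = 0` the matrix acts on the orbit itself and the uniform bound `B` is used; the
      -- resulting `2 / √n` is the reason for the factor 2 in `entryScale`. For `j > 0` the vector
      -- is already small in Euclidean norm.
      rcases Nat.eq_zero_or_pos j with rfl | hj
      · simp only [iteratedDeriv_zero]
        refine (l2_unitM_mulVec_le_of_abs_le m hB (hbd m)).trans ?_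
        rw [show 2 * (√(n : ℝ))⁻¹ = entryScale n from rfl, zero_add, pow_one]
        nlinarith
      · refine (l2_unitM_mulVec_le m _).trans ?_
        calc _ ≤ entryScale n * (Q * entryScale n ^ j) :=
              mul_le_mul hes (hξ.deriv_le j hj (by omega) m) (l2_nonneg _) he
          _ = Q * entryScale n ^ (j + 1) := by ring
          _ ≤ _ := mul_le_mul_of_nonneg_right (by linarith) (by positivity)
    have hj4 : ((j + 1 : ℕ) : ℝ) ≤ 4 := by exact_mod_cast h4
    calc _ ≤ opN M * (Q * entryScale n ^ (j + 1)) + 4 * ((Q + B) * entryScale n ^ (j + 1)) :=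
          add_le_add e1 (mul_le_mul hj4 e2 (l2_nonneg _) (by norm_num))
      _ = (opN M * Q + 4 * (Q + B)) * entryScale n ^ (j + 1) := by ring
      _ ≤ _ := by
        refine mul_le_mul_of_nonneg_right ?_ (by positivity)
        nlinarith [mul_nonneg hM hB]
  · rcases isEmpty_or_nonempty (Pair n) with hem | ⟨⟨m₀⟩⟩
    · simp only [Finset.univ_eq_empty, Finset.sum_empty, l2_zero]
      exact mul_nonneg (by positivity) (l2_nonneg _)
    have e0 : ∀ m l, iteratedDeriv 1 (fun x => ((M + x • unitM m) *ᵥ fun i => ξ m i x) l) 0 =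
        (M *ᵥ fun i => iteratedDeriv 1 (ξ m i) 0) l + (unitM m *ᵥ fun i => ξ m₀ i 0) l :=
      fun m l => by
        have := hform 0 m l
        simp only [zero_add, Nat.cast_one, one_mul, iteratedDeriv_zero] at this
        rw [this]; simp only [fun i => hξ.base m m₀ i]
    simp only [e0, mul_add, Finset.sum_add_distrib, hsumM, sum_mul_unitM_mulVec]
    refine (l2_add _ _).trans ?_
    rw [l2_smul, abs_of_nonneg (by positivity)]
    have e1 := (l2_mulVec_le M (fun i => ∑ m, c m * iteratedDeriv 1 (ξ m i) 0)).trans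
      (mul_le_mul_of_nonneg_left (hξ.grad_le c) hM)
    -- The Frobenius norm of `symM c` is at most `2 * l2 c`, and the base vector has norm at most
    -- `√n * B`. The `√n` is cancelled by the scale of the entries.
    have e2 : l2 (symM c *ᵥ fun i => ξ m₀ i 0) ≤ (2 * l2 c) * (√(n : ℝ) * B) := by
      refine (l2_mulVec_le_frobenius _ _).trans (mul_le_mul ?_ ?_ (l2_nonneg _)
        (mul_nonneg (by norm_num) (l2_nonneg _)))
      · refine Real.sqrt_le_iff.2 ⟨mul_nonneg (by norm_num) (l2_nonneg _),
          (sum_symM_sq_le c).trans ?_⟩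
        rw [mul_pow, l2_sq]
        refine mul_le_mul_of_nonneg_right (by norm_num) (Finset.sum_nonneg fun _ _ => sq_nonneg _)
      · simpa using l2_le_of_abs_le (v := fun i => ξ m₀ i 0) (hbd m₀)
    have e3 : (√(n : ℝ))⁻¹ * ((2 * l2 c) * (√(n : ℝ) * B)) ≤ 2 * l2 c * B := by
      have : (√(n : ℝ))⁻¹ * √(n : ℝ) ≤ 1 := inv_mul_le_one
      calc _ = ((√(n : ℝ))⁻¹ * √(n : ℝ)) * (2 * l2 c * B) := by ring
        _ ≤ _ := mul_le_of_le_one_left (mul_nonneg (mul_nonneg (by norm_num) (l2_nonneg _)) hB) this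
    calc _ ≤ opN M * (Q * l2 c) + 2 * l2 c * B :=
          add_le_add e1 ((mul_le_mul_of_nonneg_left e2 (by positivity)).trans e3)
      _ = (opN M * Q + 2 * B) * l2 c := by ring
      _ ≤ _ := by
        refine mul_le_mul_of_nonneg_right ?_ (l2_nonneg _)
        nlinarith [mul_nonneg hM hB]
  · have hform3 := hform 2
    simp only [Nat.reduceAdd] at hform3
    simp only [hform3, mul_add, Finset.sum_add_distrib, hsumM]
    have e1 := (l2_mulVec_le M (fun i => ∑ m, c m * iteratedDeriv 3 (ξ m i) 0)).trans
      (mul_le_mul_of_nonneg_left (hξ.third_le c hc) hM)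
    let w : Pair n → Fin n → ℝ := fun m => unitM m *ᵥ fun i => iteratedDeriv 2 (ξ m i) 0
    -- At a site `l` only the at most `n` positions of row `l` contribute, so Cauchy–Schwarz costs
    -- `n` and not `n ^ 2`. The remaining sum has `n ^ 2` terms `l2 (w m) ^ 2` of order `n ^ (-3)`.
    -- Together with the Leibniz factor 3, this is the source of the constant 24.
    have e2 : l2 (fun l => ∑ m, c m * w m l) ≤ 8 * Q := by
      refine l2_le_of_sum_sq_le (by positivity) ?_
      have hw : ∀ l, (∑ m, c m * w m l) ^ 2 ≤ n * ∑ m, w m l ^ 2 := fun l => by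
        set S := Finset.univ.image (pairOf l)
        have h0 : ∑ m, c m * w m l = ∑ m ∈ S, c m * w m l := by
          refine (Finset.sum_subset (Finset.subset_univ S) fun m _ hm => ?_).symm
          simp only [w]; rw [unitM_mulVec_eq_zero _ hm, mul_zero]
        rw [h0]
        refine (Finset.sum_mul_sq_le_sq_mul_sq S c (fun m => w m l)).trans ?_
        refine mul_le_mul ?_ (Finset.sum_le_sum_of_subset_of_nonneg (Finset.subset_univ S)
          fun _ _ _ => sq_nonneg _) (Finset.sum_nonneg fun _ _ => sq_nonneg _) (Nat.cast_nonneg _)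
        calc ∑ m ∈ S, c m ^ 2 ≤ ∑ m ∈ S, (1 : ℝ) := Finset.sum_le_sum fun m _ => by
              rw [← sq_abs]; exact pow_le_one₀ (abs_nonneg _) (hc m)
          _ = S.card := by simp
          _ ≤ n := by exact_mod_cast card_image_pairOf_le l
      have hwm : ∀ m, l2 (w m) ≤ (√(n : ℝ))⁻¹ * (Q * entryScale n ^ 2) := fun m =>
        (l2_unitM_mulVec_le m _).trans (mul_le_mul_of_nonneg_left
          (hξ.deriv_le 2 (by norm_num) (by norm_num) m) (by positivity))
      calc _ ≤ ∑ l, n * ∑ m, w m l ^ 2 := Finset.sum_le_sum fun l _ => hw l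
        _ = n * ∑ m, l2 (w m) ^ 2 := by
          rw [← Finset.mul_sum, Finset.sum_comm]; simp only [l2_sq]
        _ ≤ n * ∑ m : Pair n, ((√(n : ℝ))⁻¹ * (Q * entryScale n ^ 2)) ^ 2 := by
          gcongr with m; exacts [l2_nonneg _, hwm m]
        _ = (n * ((√(n : ℝ)) ^ 2)⁻¹) *
            (Q ^ 2 * (Fintype.card (Pair n) * entryScale n ^ 4)) := by
          rw [Finset.sum_const, nsmul_eq_mul, Finset.card_univ]; ring
        _ ≤ 1 * (Q ^ 2 * 16) := by
          refine mul_le_mul ?_ (mul_le_mul_of_nonneg_left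
            (card_pair_mul_entryScale_pow_le n) (sq_nonneg _)) (by positivity) (by norm_num)
          rw [Real.sq_sqrt (Nat.cast_nonneg _)]
          exact mul_inv_le_one
        _ ≤ _ := by nlinarith [sq_nonneg Q]
    have e3 : ∀ l, ∑ m, c m * (((2 + 1 : ℕ) : ℝ) *
        (unitM m *ᵥ fun i => iteratedDeriv 2 (ξ m i) 0) l) = 3 * ∑ m, c m * w m l := fun l => by
      rw [Finset.mul_sum]; exact Finset.sum_congr rfl fun m _ => by simp only [w]; push_cast; ring
    simp only [Nat.reduceAdd] at e3
    simp only [e3]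
    refine (l2_add _ _).trans ?_
    rw [l2_smul, abs_of_nonneg (by norm_num : (0 : ℝ) ≤ 3)]
    nlinarith [mul_nonneg hM hB]

end mul

/-! ### The orbit of a smooth iteration -/

/-- The curve of the orbit under a perturbation of one entry. -/
noncomputable def orbitCurve {n : ℕ} (F : (k : ℕ) → (Fin (k + 1) → ℝ) → ℝ)
    (M : Matrix (Fin n) (Fin n) ℝ) (u0 : Fin n → ℝ) (k : ℕ) (m : Pair n) (l : Fin n) (x : ℝ) : ℝ :=
  orbit F (M + x • unitM m) u0 k l

theorem abs_orbit_le {F : (k : ℕ) → (Fin (k + 1) → ℝ) → ℝ} {B : ℝ}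
    (hFB : ∀ k x, |F k x| ≤ B) {n : ℕ} (M : Matrix (Fin n) (Fin n) ℝ) {u0 : Fin n → ℝ}
    (hu0 : ∀ l, |u0 l| ≤ B) (k : ℕ) (l : Fin n) : |orbit F M u0 k l| ≤ B := by
  cases k with
  | zero => rw [orbit_zero]; exact hu0 l
  | succ k => rw [orbit_succ]; exact hFB _ _

/-- Each iteration is one multiplication by the matrix and one composition. The constants `C` and
`p` are independent of `n`, and the dependence on the matrix is polynomial in its norm, so that it
can later be integrated over the noise. The uniform bound on the orbit feeds `IsGood.mulVec`. -/
theorem exists_isGood_orbitCurve {F : (k : ℕ) → (Fin (k + 1) → ℝ) → ℝ} {B : ℝ} {K : ℕ → ℝ}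
    (hF : ∀ k, SmoothBdd (F k) (K k)) (hB : 0 ≤ B) (k : ℕ) :
    ∃ C : ℝ, 1 ≤ C ∧ ∃ p : ℕ, ∀ (n : ℕ) (M : Matrix (Fin n) (Fin n) ℝ) (u0 : Fin n → ℝ),
      (∀ k l, |orbit F M u0 k l| ≤ B) → ∀ k' ≤ k,
        IsGood (C * (1 + opN M) ^ p) (orbitCurve F M u0 k') := by
  induction k with
  | zero =>
    refine ⟨1, le_rfl, 0, fun n M u0 _ k' hk' => ?_⟩
    obtain rfl : k' = 0 := by omega
    have : orbitCurve F M u0 0 = fun _ l _ => u0 l := by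
      funext m l x; simp [orbitCurve, orbit_zero]
    rw [this]
    exact IsGood.const _ (by simp)
  | succ k ih =>
    obtain ⟨C, hC, p, h⟩ := ih
    refine ⟨17 * (K k + 1) * (((k + 1 : ℕ) : ℝ) * (24 * (C + B + 1))) ^ 4 + C, ?_,
      (p + 1) * 4, fun n M u0 hu k' hk' => ?_⟩
    · have := (hF k).nonneg
      have : 0 ≤ 17 * (K k + 1) * (((k + 1 : ℕ) : ℝ) * (24 * (C + B + 1))) ^ 4 := by positivity
      linarith
    have hK := (hF k).nonneg
    have hq : 1 ≤ 1 + opN M := by linarith [opN_nonneg M]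
    set q := 1 + opN M with hqdef
    have hqp : 1 ≤ q ^ p := one_le_pow₀ hq
    have hqp1 : q ^ p ≤ q ^ (p + 1) := pow_le_pow_right₀ hq (by omega)
    have hqp4 : q ^ p ≤ q ^ ((p + 1) * 4) := pow_le_pow_right₀ hq (by omega)
    rcases Nat.lt_or_ge k' (k + 1) with hlt | hge
    · refine (h n M u0 hu k' (by omega)).mono ?_
      have : 0 ≤ 17 * (K k + 1) * (((k + 1 : ℕ) : ℝ) * (24 * (C + B + 1))) ^ 4 := by positivity
      exact mul_le_mul (by linarith) hqp4 (by positivity) (by positivity)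
    obtain rfl : k' = k + 1 := by omega
    have hbd : ∀ j m l, |orbitCurve F M u0 j m l 0| ≤ B := fun j m l => by
      simpa [orbitCurve] using hu j l
    set Q' := 24 * (C + B + 1) * q ^ (p + 1) with hQ'
    have hQ'1 : 1 ≤ Q' := by
      have : 1 ≤ q ^ (p + 1) := one_le_pow₀ hq
      nlinarith
    let ξ : Fin (k + 1) → Pair n → Fin n → ℝ → ℝ := fun a m l x =>
      if (a : ℕ) = k then ((M + x • unitM m) *ᵥ fun i => orbitCurve F M u0 k m i x) l
        else orbitCurve F M u0 a m l x
    have hξ : ∀ a, IsGood Q' (ξ a) := fun a => by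
      by_cases ha : (a : ℕ) = k
      · have hg := ((h n M u0 hu k le_rfl).mulVec M hB (hbd k))
        have : ξ a = fun m l x => ((M + x • unitM m) *ᵥ fun i => orbitCurve F M u0 k m i x) l := by
          funext m l x; simp only [ξ, ha, if_true]
        rw [this]
        refine hg.mono ?_
        calc (opN M + 24) * (C * q ^ p + B) ≤ (24 * q) * ((C + B + 1) * q ^ p) := by
              refine mul_le_mul (by rw [hqdef]; linarith [opN_nonneg M]) ?_ (by positivity)
                (by positivity)
              nlinarith
          _ = Q' := by rw [hQ']; ring
      · have : ξ a = orbitCurve F M u0 a := by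
          funext m l x; simp only [ξ, ha, if_false]
        rw [this]
        refine (h n M u0 hu a (by omega)).mono ?_
        rw [hQ']
        exact mul_le_mul (by linarith) hqp1 (by positivity) (by positivity)
    have hgood := IsGood.comp hξ (hF k) (by omega) hQ'1
    have heq : orbitCurve F M u0 (k + 1) = fun m l x => F k fun a => ξ a m l x := by
      funext m l x
      simp only [orbitCurve, orbit_succ, ξ]
    rw [heq]
    refine hgood.mono ?_
    calc 17 * K k * (((k + 1 : ℕ) : ℝ) * Q') ^ 4
        = (17 * K k * (((k + 1 : ℕ) : ℝ) * (24 * (C + B + 1))) ^ 4) * q ^ ((p + 1) * 4) := by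
          rw [hQ', pow_mul]; ring
      _ ≤ _ := by
        refine mul_le_mul_of_nonneg_right ?_ (by positivity)
        have : 0 ≤ (((k + 1 : ℕ) : ℝ) * (24 * (C + B + 1))) ^ 4 := by positivity
        nlinarith

/-! ### Derivatives of the empirical average -/

/-- The bounds for the derivatives in the coordinates of a function of the entries of a symmetric
matrix which are used in the comparison of two matrices. -/
structure EntryBounds {n : ℕ} (q : (Pair n → ℝ) → ℝ) (Ψ : (Pair n → ℝ) → ℝ) : Prop where
  smooth : ∀ x m, ContDiff ℝ ∞ (fun t => Ψ (Function.update x m t))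
  first : ∀ x m, |iteratedDeriv 1 (fun t => Ψ (Function.update x m t)) (x m)| ≤ q x * (n : ℝ)⁻¹
  second : ∀ x m, |iteratedDeriv 2 (fun t => Ψ (Function.update x m t)) (x m)| ≤
    q x * ((n : ℝ)⁻¹ * (√(n : ℝ))⁻¹)
  fourth : ∀ x m, |iteratedDeriv 4 (fun t => Ψ (Function.update x m t)) (x m)| ≤
    q x * ((n : ℝ)⁻¹ ^ 2 * (√(n : ℝ))⁻¹)
  grad : ∀ x, ∑ m, iteratedDeriv 1 (fun t => Ψ (Function.update x m t)) (x m) ^ 2 ≤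
    q x ^ 2 * (n : ℝ)⁻¹
  third : ∀ x (c : Pair n → ℝ), (∀ m, |c m| ≤ 1) →
    |∑ m, c m * iteratedDeriv 3 (fun t => Ψ (Function.update x m t)) (x m)| ≤
      q x * (√(n : ℝ))⁻¹

theorem hatMatrix_symM_update {n : ℕ} (x : Pair n → ℝ) (m : Pair n) (t : ℝ)
    (Z : Matrix (Fin n) (Fin n) ℝ) :
    hatMatrix (symM (Function.update x m t)) Z =
      hatMatrix (symM x) Z + (t - x m) • unitM m := by
  ext i j
  simp only [hatMatrix, symM, unitM, Matrix.add_apply, Matrix.smul_apply, smul_eq_mul,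
    Function.update_apply]
  split_ifs with h
  · rw [h]; ring
  · ring

/-- Cauchy–Schwarz against the constant vector: the average over the sites gains a factor `1 / √n`
over the Euclidean norm. -/
theorem IsGood.average_le {n : ℕ} {Q : ℝ} {ξ : Pair n → Fin n → ℝ → ℝ} (h : IsGood Q ξ) (j : ℕ)
    (c : Pair n → ℝ) {R : ℝ} (hR : l2 (fun l => ∑ m, c m * iteratedDeriv j (ξ m l) 0) ≤ R) :
    |∑ m, c m * iteratedDeriv j (fun t => (n : ℝ)⁻¹ * ∑ l, ξ m l t) 0| ≤ (√(n : ℝ))⁻¹ * R := by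
  have h1 : ∀ m, iteratedDeriv j (fun t => (n : ℝ)⁻¹ * ∑ l, ξ m l t) 0 =
      (n : ℝ)⁻¹ * ∑ l, iteratedDeriv j (ξ m l) 0 := fun m => by
    rw [iteratedDeriv_const_mul_field, iteratedDeriv_fun_sum]
    intro l _
    exact ((h.smooth m l).of_le (by exact_mod_cast le_top)).contDiffAt
  have h2 : ∑ m, c m * iteratedDeriv j (fun t => (n : ℝ)⁻¹ * ∑ l, ξ m l t) 0 =
      (n : ℝ)⁻¹ * ∑ l, ∑ m, c m * iteratedDeriv j (ξ m l) 0 := by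
    rw [Finset.sum_congr rfl fun m _ => congrArg (c m * ·) (h1 m), Finset.sum_comm,
      Finset.mul_sum]
    refine Finset.sum_congr rfl fun m _ => ?_
    rw [Finset.mul_sum, Finset.mul_sum, Finset.mul_sum]
    exact Finset.sum_congr rfl fun i _ => by ring
  rw [h2, abs_mul, abs_of_nonneg (by positivity)]
  calc _ ≤ (n : ℝ)⁻¹ * (√(n : ℝ) * R) := by
        refine mul_le_mul_of_nonneg_left ((abs_sum_le_l2 _).trans ?_) (by positivity)
        rw [Fintype.card_fin]
        exact mul_le_mul_of_nonneg_left hR (Real.sqrt_nonneg _)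
    _ = (√(n : ℝ))⁻¹ * R := by
        rcases Nat.eq_zero_or_pos n with rfl | hn
        · simp
        have : (0 : ℝ) < n := by exact_mod_cast hn
        rw [← mul_assoc]; congr 1
        rw [inv_mul_eq_iff_eq_mul₀ this.ne']
        nth_rewrite 2 [← Real.mul_self_sqrt this.le]
        rw [mul_assoc, mul_inv_cancel₀ (by positivity), mul_one]

theorem exists_entryBounds {F : (k : ℕ) → (Fin (k + 1) → ℝ) → ℝ} {B : ℝ} {K : ℕ → ℝ}
    (hF : ∀ k, SmoothBdd (F k) (K k)) (hFB : ∀ k x, |F k x| ≤ B) (k : ℕ)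
    {φ : (Fin (k + 1) → ℝ) → ℝ} {K' : ℝ} (hφ : SmoothBdd φ K') :
    ∃ C : ℝ, 0 ≤ C ∧ ∃ p : ℕ, ∀ (n : ℕ) (Z : Matrix (Fin n) (Fin n) ℝ) (u0 : Fin n → ℝ),
      (∀ l, |u0 l| ≤ B) →
        EntryBounds (fun x => C * (1 + opN (hatMatrix (symM x) Z)) ^ p)
          (fun x => empAverage F k φ u0 Z (symM x)) := by
  have hB : 0 ≤ B := (abs_nonneg _).trans (hFB 0 0)
  obtain ⟨C, hC, p, h⟩ := exists_isGood_orbitCurve hF hB k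
  have hK' := hφ.nonneg
  -- The factor 16 absorbs the powers `2 ^ j`, `j ≤ 4`, contained in `entryScale n ^ j`.
  refine ⟨16 * (17 * K' * (((k + 1 : ℕ) : ℝ) * C) ^ 4), by positivity, p * 4,
    fun n Z u0 hu0 => ?_⟩
  set Q : (Pair n → ℝ) → ℝ := fun x => 17 * K' * (((k + 1 : ℕ) : ℝ) *
    (C * (1 + opN (hatMatrix (symM x) Z)) ^ p)) ^ 4 with hQ
  let ξ : (Pair n → ℝ) → Pair n → Fin n → ℝ → ℝ := fun x m l t =>
    φ fun j => orbitCurve F (hatMatrix (symM x) Z) u0 j m l t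
  have hξ : ∀ x, IsGood (Q x) (ξ x) := fun x => by
    refine IsGood.comp (fun a => h n _ u0 (abs_orbit_le hFB _ hu0) a (by omega)) hφ
      (by omega) ?_
    exact one_le_mul_of_one_le_of_one_le hC
      (one_le_pow₀ (by linarith [opN_nonneg (hatMatrix (symM x) Z)]))
  have hΨ : ∀ x m, (fun t => empAverage F k φ u0 Z (symM (Function.update x m t))) =
      fun t => (n : ℝ)⁻¹ * ∑ l, ξ x m l (t - x m) := fun x m => by
    funext t
    simp only [empAverage, hatMatrix_symM_update, ξ, orbitCurve]
  have hder : ∀ x m j, iteratedDeriv j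
      (fun t => empAverage F k φ u0 Z (symM (Function.update x m t))) (x m) =
      iteratedDeriv j (fun t => (n : ℝ)⁻¹ * ∑ l, ξ x m l t) 0 := fun x m j => by
    rw [hΨ, iteratedDeriv_comp_sub_const j (fun t => (n : ℝ)⁻¹ * ∑ l, ξ x m l t) (x m)]
    simp
  have hq : ∀ x, 16 * (17 * K' * (((k + 1 : ℕ) : ℝ) * C) ^ 4) *
      (1 + opN (hatMatrix (symM x) Z)) ^ (p * 4) = 16 * Q x := fun x => by
    rw [hQ, pow_mul]; ring
  have hs0 : 0 ≤ (√(n : ℝ))⁻¹ := by positivity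
  have hs2 : (√(n : ℝ))⁻¹ ^ 2 = (n : ℝ)⁻¹ := by
    rw [inv_pow, Real.sq_sqrt (Nat.cast_nonneg _)]
  have hone : ∀ x m j, 1 ≤ j → j ≤ 4 → |iteratedDeriv j
      (fun t => (n : ℝ)⁻¹ * ∑ l, ξ x m l t) 0| ≤ (√(n : ℝ))⁻¹ * (Q x * entryScale n ^ j) :=
    fun x m j h1 h4 => by
    have := (hξ x).average_le j (Pi.single m 1) (R := Q x * entryScale n ^ j) (by
      simpa [Pi.single_apply] using (hξ x).deriv_le j h1 h4 m)
    simpa [Pi.single_apply] using this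
  have hQ0 : ∀ x, 0 ≤ Q x := fun x => (hξ x).nonneg
  refine ⟨fun x m => ?_, fun x m => ?_, fun x m => ?_, fun x m => ?_, fun x => ?_,
    fun x c hc => ?_⟩
  · rw [hΨ]
    exact contDiff_const.mul (ContDiff.sum fun l _ =>
      ((hξ x).smooth m l).comp (contDiff_id.sub contDiff_const))
  · rw [hder, hq]
    refine (hone x m 1 le_rfl (by norm_num)).trans ?_
    rw [← hs2, entryScale]
    nlinarith [mul_nonneg (hQ0 x) (sq_nonneg (√(n : ℝ))⁻¹)]
  · rw [hder, hq]
    refine (hone x m 2 (by norm_num) (by norm_num)).trans ?_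
    rw [← hs2, entryScale]
    nlinarith [mul_nonneg (hQ0 x) (pow_nonneg hs0 3)]
  · rw [hder, hq]
    refine (hone x m 4 (by norm_num) (by norm_num)).trans ?_
    rw [← hs2, entryScale]
    nlinarith [mul_nonneg (hQ0 x) (pow_nonneg hs0 5)]
  · simp only [hder, hq]
    set c : Pair n → ℝ := fun m => iteratedDeriv 1 (fun t => (n : ℝ)⁻¹ * ∑ l, ξ x m l t) 0
    -- Duality again: the weights are the gradient itself, which gives `l2 c ^ 2 ≤ (√n)⁻¹ * (Q x *
    -- l2 c)`.
    have h1 := (le_abs_self _).trans ((hξ x).average_le 1 c ((hξ x).grad_le c))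
    have h2 : ∑ m, c m * iteratedDeriv 1 (fun t => (n : ℝ)⁻¹ * ∑ l, ξ x m l t) 0 = l2 c ^ 2 := by
      rw [l2_sq]; exact Finset.sum_congr rfl fun m _ => by simp only [c]; ring
    rw [h2] at h1
    rw [show ∑ m, c m ^ 2 = l2 c ^ 2 from (l2_sq c).symm]
    have h3 : l2 c ≤ (√(n : ℝ))⁻¹ * Q x := by
      by_contra hcon
      push Not at hcon
      have : 0 ≤ (√(n : ℝ))⁻¹ * Q x := mul_nonneg hs0 (hQ0 x)
      nlinarith
    calc l2 c ^ 2 ≤ ((√(n : ℝ))⁻¹ * Q x) ^ 2 := pow_le_pow_left₀ (l2_nonneg _) h3 2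
      _ = Q x ^ 2 * (n : ℝ)⁻¹ := by rw [mul_pow, hs2]; ring
      _ ≤ _ := by
        refine mul_le_mul_of_nonneg_right ?_ (by positivity)
        nlinarith [sq_nonneg (Q x)]
  · simp only [hder, hq]
    refine ((hξ x).average_le 3 c ((hξ x).third_le c hc)).trans ?_
    nlinarith [mul_nonneg hs0 (hQ0 x)]

end GenAMP

namespace GenAMP

open scoped ContDiff

/-! ### Taylor expansion -/

theorem abs_sub_taylor_sum_le {h : ℝ → ℝ} (hh : ContDiff ℝ ∞ h) (N : ℕ) (a t : ℝ) {A : ℝ}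
    (hA : ∀ s ∈ Set.uIcc a t, |iteratedDeriv (N + 1) h s| ≤ A) :
    |h t - ∑ j ∈ Finset.range (N + 1), ((j.factorial : ℝ)⁻¹ * (t - a) ^ j) * iteratedDeriv j h a|
      ≤ A * |t - a| ^ (N + 1) := by
  have hA0 : 0 ≤ A := (abs_nonneg _).trans (hA a Set.left_mem_uIcc)
  rcases eq_or_ne a t with rfl | hat
  · simp [Finset.sum_range_succ']
  have hcd : ContDiff ℝ (N + 1 : ℕ) h := hh.of_le (by exact_mod_cast le_top)
  obtain ⟨s, hs, heq⟩ := taylor_mean_remainder_lagrange_iteratedDeriv hat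
    (n := N) (f := h) (by exact_mod_cast hcd.contDiffOn)
  have hsum : taylorWithinEval h N (Set.uIcc a t) a t =
      ∑ j ∈ Finset.range (N + 1), ((j.factorial : ℝ)⁻¹ * (t - a) ^ j) * iteratedDeriv j h a := by
    rw [taylor_within_apply]
    refine Finset.sum_congr rfl fun j _ => ?_
    rw [iteratedDerivWithin_eq_iteratedDeriv (s := Set.uIcc a t)
      (uniqueDiffOn_Icc (min_lt_max.2 hat))
      (hh.of_le (by exact_mod_cast le_top)).contDiffAt Set.left_mem_uIcc, smul_eq_mul]
  rw [← hsum, heq, abs_div, abs_mul, abs_pow]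
  have hfac : (1 : ℝ) ≤ |(((N + 1).factorial : ℕ) : ℝ)| := by
    rw [Nat.abs_cast]; exact_mod_cast Nat.succ_le_of_lt (Nat.factorial_pos _)
  refine (div_le_self (by positivity) hfac).trans ?_
  exact mul_le_mul_of_nonneg_right (hA s (Set.Ioo_subset_Icc_self hs)) (by positivity)

/-! ### Product measures -/

section pi
variable {ι : Type*} [DecidableEq ι]

instance isProbabilityMeasure_piecewise (S : Finset ι) (μ ν : ι → Measure ℝ)
    [∀ i, IsProbabilityMeasure (μ i)] [∀ i, IsProbabilityMeasure (ν i)] (i : ι) :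
    IsProbabilityMeasure (S.piecewise μ ν i) := by
  by_cases h : i ∈ S
  · rw [Finset.piecewise_eq_of_mem _ _ _ h]; infer_instance
  · rw [Finset.piecewise_eq_of_notMem _ _ _ h]; infer_instance

instance isProbabilityMeasure_update (μ : ι → Measure ℝ) (m : ι) (ρ : Measure ℝ)
    [∀ i, IsProbabilityMeasure (μ i)] [IsProbabilityMeasure ρ] (i : ι) :
    IsProbabilityMeasure (Function.update μ m ρ i) := by
  by_cases h : i = m
  · subst h; rw [Function.update_self]; infer_instance
  · rw [Function.update_of_ne h]; infer_instance

variable (μ ν : ι → Measure ℝ) [∀ i, IsProbabilityMeasure (μ i)]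
  [∀ i, IsProbabilityMeasure (ν i)]

theorem measurable_piecewise (S : Finset ι) :
    Measurable (fun p : (ι → ℝ) × (ι → ℝ) => S.piecewise p.1 p.2) :=
  measurable_pi_lambda _ fun i => by
    by_cases h : i ∈ S
    · simp only [Finset.piecewise_eq_of_mem _ _ _ h]; fun_prop
    · simp only [Finset.piecewise_eq_of_notMem _ _ _ h]; fun_prop

theorem measurable_update_pair (m : ι) :
    Measurable (fun p : (ι → ℝ) × ℝ => Function.update p.1 m p.2) :=
  measurable_pi_lambda _ fun i => by
    by_cases h : i = m
    · subst h; simp only [Function.update_self]; fun_prop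
    · simp only [Function.update_of_ne h]; fun_prop

variable [Fintype ι]

theorem measurePreserving_piecewise (S : Finset ι) :
    MeasurePreserving (fun p : (ι → ℝ) × (ι → ℝ) => S.piecewise p.1 p.2)
      ((Measure.pi ν).prod (Measure.pi μ)) (Measure.pi (S.piecewise ν μ)) := by
  refine ⟨measurable_piecewise S, (Measure.pi_eq fun s hs => ?_).symm⟩
  rw [Measure.map_apply (measurable_piecewise S) (MeasurableSet.univ_pi hs)]
  have : (fun p : (ι → ℝ) × (ι → ℝ) => S.piecewise p.1 p.2) ⁻¹' Set.univ.pi s =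
      (Set.univ.pi (S.piecewise s fun _ => Set.univ)) ×ˢ
        (Set.univ.pi (S.piecewise (fun _ => Set.univ) s)) := by
    ext p
    simp only [Set.mem_preimage, Set.mem_pi, Set.mem_univ, forall_true_left, Set.mem_prod]
    rw [← forall_and]
    refine forall_congr' fun i => ?_
    by_cases h : i ∈ S <;> simp [h]
  rw [this, Measure.prod_prod, Measure.pi_pi, Measure.pi_pi, ← Finset.prod_mul_distrib]
  refine Finset.prod_congr rfl fun i _ => ?_
  by_cases h : i ∈ S <;> simp [h]

theorem measurePreserving_update (m : ι) (ρ : Measure ℝ) [IsProbabilityMeasure ρ] :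
    MeasurePreserving (fun p : (ι → ℝ) × ℝ => Function.update p.1 m p.2)
      ((Measure.pi μ).prod ρ) (Measure.pi (Function.update μ m ρ)) := by
  refine ⟨measurable_update_pair m, (Measure.pi_eq fun s hs => ?_).symm⟩
  rw [Measure.map_apply (measurable_update_pair m) (MeasurableSet.univ_pi hs)]
  have : (fun p : (ι → ℝ) × ℝ => Function.update p.1 m p.2) ⁻¹' Set.univ.pi s =
      (Set.univ.pi (Function.update s m Set.univ)) ×ˢ s m := by
    ext p
    simp only [Set.mem_preimage, Set.mem_pi, Set.mem_univ, forall_true_left, Set.mem_prod]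
    constructor
    · intro h
      refine ⟨fun i => ?_, by simpa using h m⟩
      by_cases hi : i = m
      · subst hi; simp
      · simpa [hi] using h i
    · rintro ⟨h1, h2⟩ i
      by_cases hi : i = m
      · subst hi; simpa using h2
      · simpa [hi] using h1 i
  rw [this, Measure.prod_prod, Measure.pi_pi]
  rw [← Finset.mul_prod_erase Finset.univ _ (Finset.mem_univ m),
    ← Finset.mul_prod_erase Finset.univ (fun i => Function.update μ m ρ i (s i))
      (Finset.mem_univ m)]
  simp only [Function.update_self, measure_univ, one_mul]
  rw [mul_comm]
  congr 1
  refine Finset.prod_congr rfl fun i hi => ?_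
  have : i ≠ m := Finset.ne_of_mem_erase hi
  simp [this]

/-- Exchanging the coordinates in `S` of two independent copies preserves their joint law. -/
theorem measurePreserving_exchange (S : Finset ι) :
    MeasurePreserving
      (fun p : (ι → ℝ) × (ι → ℝ) => (S.piecewise p.2 p.1, S.piecewise p.1 p.2))
      ((Measure.pi μ).prod (Measure.pi μ)) ((Measure.pi μ).prod (Measure.pi μ)) := by
  have e := measurePreserving_arrowProdEquivProdArrow ℝ ℝ ι μ μ
  let T : ι → ℝ × ℝ → ℝ × ℝ := fun i => if i ∈ S then Prod.swap else id
  have hT : MeasurePreserving (fun (z : ι → ℝ × ℝ) i => T i (z i))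
      (Measure.pi fun i => (μ i).prod (μ i)) (Measure.pi fun i => (μ i).prod (μ i)) := by
    refine measurePreserving_pi _ _ fun i => ?_
    by_cases h : i ∈ S
    · simp only [T, h, if_true]; exact Measure.measurePreserving_swap
    · simp only [T, h, if_false]; exact MeasurePreserving.id _
  have hcomp := e.comp (hT.comp e.symm)
  have heq : (fun p : (ι → ℝ) × (ι → ℝ) => (S.piecewise p.2 p.1, S.piecewise p.1 p.2)) =
      MeasurableEquiv.arrowProdEquivProdArrow ℝ ℝ ι ∘ (fun (z : ι → ℝ × ℝ) i => T i (z i)) ∘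
        (MeasurableEquiv.arrowProdEquivProdArrow ℝ ℝ ι).symm := by
    funext p
    refine Prod.ext (funext fun i => ?_) (funext fun i => ?_)
    · change S.piecewise p.2 p.1 i = (T i (p.1 i, p.2 i)).1
      by_cases h : i ∈ S <;> simp [T, h]
    · change S.piecewise p.1 p.2 i = (T i (p.1 i, p.2 i)).2
      by_cases h : i ∈ S <;> simp [T, h]
  rw [heq]
  exact hcomp

/-- The **Efron–Stein inequality**, for a bounded function of independent real variables. -/
theorem variance_pi_le {f : (ι → ℝ) → ℝ} (hf : Measurable f) {B : ℝ} (hB : ∀ x, |f x| ≤ B) :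
    ∫ x, f x ^ 2 ∂(Measure.pi μ) - (∫ x, f x ∂(Measure.pi μ)) ^ 2 ≤
      (1 / 2) * ∑ m, ∫ p, (f p.1 - f (Function.update p.1 m p.2)) ^ 2
        ∂((Measure.pi μ).prod (μ m)) := by
  set π := Measure.pi μ
  have hfst : Measurable fun p : (ι → ℝ) × (ι → ℝ) => f p.1 := hf.comp measurable_fst
  have hpw : ∀ S : Finset ι, Measurable fun p : (ι → ℝ) × (ι → ℝ) => f (S.piecewise p.2 p.1) :=
    fun S => hf.comp ((measurable_piecewise S).comp measurable_swap)
  have hB0 : 0 ≤ B := (abs_nonneg _).trans (hB 0)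
  have hint : ∀ {g h : (ι → ℝ) × (ι → ℝ) → ℝ} {b c : ℝ}, Measurable g → Measurable h →
      (∀ p, |g p| ≤ b) → (∀ p, |h p| ≤ c) → Integrable (fun p => g p * h p) (π.prod π) :=
    fun {g h b c} hg hh hgb hhc => by
      refine Integrable.of_bound (hg.mul hh).aestronglyMeasurable (b * c) (ae_of_all _ fun p => ?_)
      rw [Real.norm_eq_abs, abs_mul]
      exact mul_le_mul (hgb p) (hhc p) (abs_nonneg _) ((abs_nonneg _).trans (hgb p))
  have hdiff : ∀ (u v : ι → ℝ), |f u - f v| ≤ 2 * B := fun u v => by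
    have h1 := abs_le.1 (hB u); have h2 := abs_le.1 (hB v)
    rw [abs_le]; constructor <;> linarith
  let D : ι → ℝ := fun m => ∫ p, (f p.1 - f (Function.update p.1 m (p.2 m))) ^ 2 ∂(π.prod π)
  have hup : ∀ m (x x' : ι → ℝ), Function.update x m (x' m) = ({m} : Finset ι).piecewise x' x :=
    fun m x x' => by rw [Finset.piecewise_singleton]
  -- Resampling the coordinates in `S` interpolates between the point itself and an independent
  -- copy, for which the integral of the product is the square of the mean.
  have key : ∀ S : Finset ι, ∫ p, f p.1 * f p.1 ∂(π.prod π) -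
      ∫ p, f p.1 * f (S.piecewise p.2 p.1) ∂(π.prod π) ≤ (1 / 2) * ∑ m ∈ S, D m := by
    intro S
    induction S using Finset.induction_on with
    | empty => simp
    | insert m S hm ih =>
      rw [Finset.sum_insert hm]
      let g : (ι → ℝ) × (ι → ℝ) → ℝ := fun p => f (S.piecewise p.2 p.1)
      let h : (ι → ℝ) × (ι → ℝ) → ℝ := fun p => f ((insert m S).piecewise p.2 p.1)
      let f' : (ι → ℝ) × (ι → ℝ) → ℝ := fun p => f (({m} : Finset ι).piecewise p.2 p.1)
      have hgm : Measurable g := hpw S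
      have hhm : Measurable h := hpw (insert m S)
      have hfm : Measurable f' := hpw {m}
      have hgh : ∀ p, |g p - h p| ≤ 2 * B := fun p => hdiff _ _
      have hI1 : Integrable (fun p => f p.1 * (g p - h p)) (π.prod π) :=
        hint hfst (hgm.sub hhm) (fun p => hB _) hgh
      have hI2 : Integrable (fun p => f' p * (g p - h p)) (π.prod π) :=
        hint hfm (hgm.sub hhm) (fun p => hB _) hgh
      have hI3 : Integrable (fun p => (f p.1 - f' p) ^ 2) (π.prod π) := by
        simp only [sq]
        exact hint (hfst.sub hfm) (hfst.sub hfm) (fun p => hdiff _ _) (fun p => hdiff _ _)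
      have hI4 : Integrable (fun p => (g p - h p) ^ 2) (π.prod π) := by
        simp only [sq]; exact hint (hgm.sub hhm) (hgm.sub hhm) hgh hgh
      have hstep : ∫ p, f p.1 * g p ∂(π.prod π) - ∫ p, f p.1 * h p ∂(π.prod π) =
          ∫ p, f p.1 * (g p - h p) ∂(π.prod π) := by
        rw [← integral_sub (hint hfst hgm (fun p => hB _) fun p => hB _)
          (hint hfst hhm (fun p => hB _) fun p => hB _)]
        exact integral_congr_ae (ae_of_all _ fun p => by simp only; ring)
      -- Exchanging coordinate `m` of the two copies turns `f` into `f'` and interchanges `g` and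
      -- `h`.
      have hswap : ∫ p, f p.1 * (g p - h p) ∂(π.prod π) =
          ∫ p, f' p * (h p - g p) ∂(π.prod π) := by
        rw [← (measurePreserving_exchange μ {m}).map_eq]
        rw [integral_map (measurePreserving_exchange μ {m}).measurable.aemeasurable
          (by rw [(measurePreserving_exchange μ {m}).map_eq]; exact hI1.aestronglyMeasurable)]
        rw [(measurePreserving_exchange μ {m}).map_eq]
        refine integral_congr_ae (ae_of_all _ fun p => ?_)
        have e1 : S.piecewise (({m} : Finset ι).piecewise p.1 p.2)
            (({m} : Finset ι).piecewise p.2 p.1) = (insert m S).piecewise p.2 p.1 := by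
          funext i
          by_cases hi : i = m
          · subst hi; simp [hm]
          · by_cases hS : i ∈ S <;> simp [hi, hS]
        have e2 : (insert m S).piecewise (({m} : Finset ι).piecewise p.1 p.2)
            (({m} : Finset ι).piecewise p.2 p.1) = S.piecewise p.2 p.1 := by
          funext i
          by_cases hi : i = m
          · subst hi; simp [hm]
          · by_cases hS : i ∈ S <;> simp [hi, hS]
        simp only [g, h, f', e1, e2]
      have hDm : ∫ p, (f p.1 - f' p) ^ 2 ∂(π.prod π) = D m := by
        simp only [D, f', hup]
      -- Exchanging the coordinates in `S` carries the pair `f`, `f'` to the pair `g`, `h`.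
      have hDm' : ∫ p, (g p - h p) ^ 2 ∂(π.prod π) = D m := by
        rw [← hDm, ← (measurePreserving_exchange μ S).map_eq]
        rw [integral_map (f := fun p => (f p.1 - f' p) ^ 2)
          (measurePreserving_exchange μ S).measurable.aemeasurable
          (by rw [(measurePreserving_exchange μ S).map_eq]; exact hI3.aestronglyMeasurable)]
        rw [(measurePreserving_exchange μ S).map_eq]
        refine integral_congr_ae (ae_of_all _ fun p => ?_)
        have e1 : ({m} : Finset ι).piecewise (S.piecewise p.1 p.2) (S.piecewise p.2 p.1) =
            (insert m S).piecewise p.2 p.1 := by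
          funext i
          by_cases hi : i = m
          · subst hi; simp [hm]
          · by_cases hS : i ∈ S <;> simp [hi, hS]
        simp only [g, h, f', e1]
      -- By the swap, twice the left side is the integral of `(f - f') * (g - h)`, and both factors
      -- have mean square `D m`.
      have hhalf : ∫ p, f p.1 * (g p - h p) ∂(π.prod π) ≤ (1 / 2) * D m := by
        have h1 : 2 * ∫ p, f p.1 * (g p - h p) ∂(π.prod π) =
            ∫ p, (f p.1 * (g p - h p) - f' p * (g p - h p)) ∂(π.prod π) := by
          rw [integral_sub hI1 hI2]
          have : ∫ p, f' p * (h p - g p) ∂(π.prod π) = -∫ p, f' p * (g p - h p) ∂(π.prod π) := by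
            rw [← integral_neg]
            exact integral_congr_ae (ae_of_all _ fun p => by simp only; ring)
          linarith
        have h2 : ∫ p, (f p.1 * (g p - h p) - f' p * (g p - h p)) ∂(π.prod π) ≤
            ∫ p, ((1 / 2) * (f p.1 - f' p) ^ 2 + (1 / 2) * (g p - h p) ^ 2) ∂(π.prod π) := by
          refine integral_mono (hI1.sub hI2) ((hI3.const_mul _).add (hI4.const_mul _)) fun p => ?_
          simp only
          nlinarith [sq_nonneg (f p.1 - f' p - (g p - h p))]
        rw [integral_add (hI3.const_mul _) (hI4.const_mul _), integral_const_mul,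
          integral_const_mul, hDm, hDm'] at h2
        linarith
      have : (∫ p, f p.1 * f p.1 ∂(π.prod π)) - ∫ p, f p.1 * h p ∂(π.prod π) ≤
          (1 / 2) * (D m + ∑ m ∈ S, D m) := by
        have ih' : (∫ p, f p.1 * f p.1 ∂(π.prod π)) - ∫ p, f p.1 * g p ∂(π.prod π) ≤
          (1 / 2) * ∑ m ∈ S, D m := ih
        linarith
      exact this
  have h1 := key Finset.univ
  have e1 : ∫ p, f p.1 * f p.1 ∂(π.prod π) = ∫ x, f x ^ 2 ∂π := by
    simp only [← sq]
    have := integral_fun_fst (μ := π) (ν := π) (fun x => f x ^ 2)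
    simpa using this
  have e2 : ∫ p, f p.1 * f (Finset.univ.piecewise p.2 p.1) ∂(π.prod π) = (∫ x, f x ∂π) ^ 2 := by
    simp only [Finset.piecewise_univ]
    rw [integral_prod_mul (μ := π) (ν := π) f f, sq]
  have e3 : ∀ m, D m = ∫ p, (f p.1 - f (Function.update p.1 m p.2)) ^ 2 ∂(π.prod (μ m)) :=
    fun m => by
    have hmp : MeasurePreserving (fun p : (ι → ℝ) × (ι → ℝ) => (p.1, p.2 m)) (π.prod π)
        (π.prod (μ m)) :=
      (MeasurePreserving.id π).prod (measurePreserving_eval μ m)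
    have hme : Measurable fun p : (ι → ℝ) × ℝ => (f p.1 - f (Function.update p.1 m p.2)) ^ 2 :=
      ((hf.comp measurable_fst).sub (hf.comp (measurable_update_pair m))).pow_const 2
    rw [← hmp.map_eq, integral_map hmp.measurable.aemeasurable hme.aestronglyMeasurable]
  rw [e1, e2] at h1
  simpa only [e3] using h1

end pi

/-! ### Exchanging variables one at a time -/

/-- If the total increment over all possible insertions into any set is at most `δ`, then there is
an order of insertion along which the function increases by at most `δ` times a harmonic number. -/
theorem le_add_mul_harmonic {ι : Type*} [Fintype ι] [DecidableEq ι] (φ : Finset ι → ℝ) {δ : ℝ}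
    (h : ∀ S, ∑ m ∈ Sᶜ, (φ (insert m S) - φ S) ≤ δ) (S : Finset ι) :
    φ Finset.univ ≤ φ S + δ * (harmonic Sᶜ.card : ℝ) := by
  induction hr : Sᶜ.card generalizing S with
  | zero =>
    have : S = Finset.univ := by
      rw [Finset.card_eq_zero] at hr; simpa using hr
    simp [this]
  | succ r ih =>
    have hne : Sᶜ.Nonempty := Finset.card_pos.1 (by omega)
    -- There are `r + 1` possible insertions, and one of them costs at most the average.
    obtain ⟨m, hm, hle⟩ : ∃ m ∈ Sᶜ, φ (insert m S) - φ S ≤ δ / (r + 1) := by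
      refine Finset.exists_le_of_sum_le hne ((h S).trans_eq ?_)
      rw [Finset.sum_const, hr, nsmul_eq_mul]; push_cast; field_simp
    have hcard : (insert m S)ᶜ.card = r := by
      rw [Finset.compl_insert, Finset.card_erase_of_mem hm, hr]; rfl
    have := ih (insert m S) hcard
    rw [harmonic_succ]
    push_cast
    rw [mul_add, ← div_eq_mul_inv]
    linarith

end GenAMP

namespace GenAMP

/-! ### Subgaussian laws -/

/-- A centered subgaussian law on the line with unit variance. -/
structure StdSubgaussian (s : ℝ≥0) (μ : Measure ℝ) : Prop where
  prob : IsProbabilityMeasure μ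
  mean : ∫ t, t ∂μ = 0
  second : ∫ t, t ^ 2 ∂μ = 1
  subgaussian : HasSubgaussianMGF id s μ

/-- A bound for the absolute moment of order `r` of a subgaussian law. -/
noncomputable def momentBound (s : ℝ≥0) (r : ℕ) : ℝ := 2 * r.factorial * Real.exp (s / 2)

theorem momentBound_nonneg (s : ℝ≥0) (r : ℕ) : 0 ≤ momentBound s r := by
  unfold momentBound; positivity

theorem abs_pow_le_factorial_mul (t : ℝ) (r : ℕ) :
    |t| ^ r ≤ r.factorial * (Real.exp t + Real.exp (-t)) := by
  have h1 := Real.pow_div_factorial_le_exp |t| (abs_nonneg t) r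
  have hf : (0 : ℝ) < r.factorial := by exact_mod_cast Nat.factorial_pos r
  rw [div_le_iff₀ hf] at h1
  refine h1.trans ?_
  rw [mul_comm]
  refine mul_le_mul_of_nonneg_left ?_ hf.le
  rcases abs_cases t with ⟨h, _⟩ | ⟨h, _⟩ <;> rw [h]
  · linarith [Real.exp_pos (-t)]
  · linarith [Real.exp_pos t]

section moments
variable {Ω : Type*} [MeasurableSpace Ω] {P : Measure Ω} {X : Ω → ℝ} {s : ℝ≥0}

theorem integrable_abs_pow_of_subgaussian (h : HasSubgaussianMGF X s P) (r : ℕ) :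
    Integrable (fun ω => |X ω| ^ r) P := by
  have h1 := h.integrable_exp_mul 1
  have h2 := h.integrable_exp_mul (-1)
  simp only [one_mul, neg_mul] at h1 h2
  refine ((h1.add h2).const_mul (r.factorial : ℝ)).mono'
    (h.aestronglyMeasurable.norm.pow r) (ae_of_all _ fun ω => ?_)
  rw [Real.norm_eq_abs, abs_of_nonneg (by positivity)]
  exact abs_pow_le_factorial_mul _ _

theorem integral_abs_pow_le_of_subgaussian (h : HasSubgaussianMGF X s P) (r : ℕ) :
    ∫ ω, |X ω| ^ r ∂P ≤ momentBound s r := by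
  have h1 := h.integrable_exp_mul 1
  have h2 := h.integrable_exp_mul (-1)
  have m1 := h.mgf_le 1
  have m2 := h.mgf_le (-1)
  unfold mgf at m1 m2
  simp only [one_mul, neg_mul] at h1 h2 m1 m2
  calc _ ≤ ∫ ω, r.factorial * (Real.exp (X ω) + Real.exp (-X ω)) ∂P :=
        integral_mono (integrable_abs_pow_of_subgaussian h r) ((h1.add h2).const_mul _)
          fun ω => abs_pow_le_factorial_mul _ _
    _ = r.factorial * (∫ ω, Real.exp (X ω) ∂P + ∫ ω, Real.exp (-X ω) ∂P) := by
        rw [integral_const_mul, integral_add h1 h2]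
    _ ≤ r.factorial * (Real.exp (s / 2) + Real.exp (s / 2)) := by
        refine mul_le_mul_of_nonneg_left ?_ (by positivity)
        norm_num at m1 m2
        exact add_le_add m1 m2
    _ = _ := by unfold momentBound; ring

end moments

theorem add_three_pow_le {a b c : ℝ} (ha : 0 ≤ a) (hb : 0 ≤ b) (hc : 0 ≤ c) (r : ℕ) :
    (a + b + c) ^ r ≤ 3 ^ r * (a ^ r + b ^ r + c ^ r) := by
  have key : ∀ {d : ℝ}, 0 ≤ d → a ≤ d → b ≤ d → c ≤ d → (a + b + c) ^ r ≤ 3 ^ r * d ^ r :=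
    fun {d} hd h1 h2 h3 => by
      rw [← mul_pow]; exact pow_le_pow_left₀ (by positivity) (by linarith) r
  have pa := pow_nonneg ha r
  have pb := pow_nonneg hb r
  have pc := pow_nonneg hc r
  have p3 : (0 : ℝ) ≤ 3 ^ r := by positivity
  rcases le_total a b with h1 | h1 <;> rcases le_total b c with h2 | h2
  · exact (key hc (h1.trans h2) h2 le_rfl).trans (mul_le_mul_of_nonneg_left (by linarith) p3)
  · exact (key hb h1 le_rfl h2).trans (mul_le_mul_of_nonneg_left (by linarith) p3)
  · rcases le_total a c with h3 | h3
    · exact (key hc h3 h2 le_rfl).trans (mul_le_mul_of_nonneg_left (by linarith) p3)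
    · exact (key ha le_rfl h1 h3).trans (mul_le_mul_of_nonneg_left (by linarith) p3)
  · exact (key ha le_rfl h1 (h2.trans h1)).trans (mul_le_mul_of_nonneg_left (by linarith) p3)

namespace StdSubgaussian
variable {s : ℝ≥0} {μ ν : Measure ℝ}

theorem integrable_abs_pow (h : StdSubgaussian s μ) (r : ℕ) :
    Integrable (fun t => |t| ^ r) μ := integrable_abs_pow_of_subgaussian h.subgaussian r

theorem integral_abs_pow_le (h : StdSubgaussian s μ) (r : ℕ) :
    ∫ t, |t| ^ r ∂μ ≤ momentBound s r := integral_abs_pow_le_of_subgaussian h.subgaussian r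

theorem integrable_pow (h : StdSubgaussian s μ) (r : ℕ) : Integrable (fun t => t ^ r) μ :=
  (h.integrable_abs_pow r).mono' (by fun_prop) (ae_of_all _ fun t => by simp)

theorem abs_integral_pow_le (h : StdSubgaussian s μ) (r : ℕ) :
    |∫ t, t ^ r ∂μ| ≤ momentBound s r :=
  (abs_integral_le_integral_abs.trans_eq (by simp [abs_pow])).trans (h.integral_abs_pow_le r)

theorem integrable_add_three_pow (h : StdSubgaussian s μ) {a b : ℝ} (ha : 0 ≤ a) (hb : 0 ≤ b)
    (r : ℕ) : Integrable (fun t => (a + |t| + b) ^ r) μ := by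
  have := h.prob
  refine ((((integrable_const (a ^ r)).add (h.integrable_abs_pow r)).add
    (integrable_const (b ^ r))).const_mul (3 ^ r)).mono' (by fun_prop) (ae_of_all _ fun t => ?_)
  rw [Real.norm_eq_abs, abs_of_nonneg (by positivity)]
  exact add_three_pow_le ha (abs_nonneg t) hb r

theorem integral_add_three_pow_le (h : StdSubgaussian s μ) {a b : ℝ} (ha : 0 ≤ a) (hb : 0 ≤ b)
    (r : ℕ) : ∫ t, (a + |t| + b) ^ r ∂μ ≤ 3 ^ r * (a ^ r + momentBound s r + b ^ r) := by
  have := h.prob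
  calc _ ≤ ∫ t, 3 ^ r * (a ^ r + |t| ^ r + b ^ r) ∂μ :=
        integral_mono (h.integrable_add_three_pow ha hb r)
          ((((integrable_const (a ^ r)).add (h.integrable_abs_pow r)).add
            (integrable_const (b ^ r))).const_mul (3 ^ r))
          fun t => add_three_pow_le ha (abs_nonneg t) hb r
    _ = 3 ^ r * (a ^ r + ∫ t, |t| ^ r ∂μ + b ^ r) := by
        rw [integral_const_mul, integral_add ((integrable_const _).fun_add (h.integrable_abs_pow r))
          (integrable_const _), integral_add (integrable_const _) (h.integrable_abs_pow r)]
        simp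
    _ ≤ _ := by
        have := h.integral_abs_pow_le r
        gcongr

end StdSubgaussian

open scoped ContDiff

/-! ### Exchange of one variable -/

section exchange
variable {h : ℝ → ℝ} (hh : ContDiff ℝ ∞ h) {A ℓ y : ℝ} (hA : 0 ≤ A) (hℓ : 1 ≤ ℓ) {p : ℕ}
  (h4 : ∀ u, |iteratedDeriv 4 h u| ≤ A * (ℓ + |u| + |y|) ^ p)
include hh hA hℓ h4

/-- A cubic Taylor polynomial at 0, except that the third derivative is taken at `y`. In the
application `y` is the current value of the coordinate, so that the third derivatives in all entries
are taken at one common point and can be summed. Moving the point from 0 to `y` costs one fourth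
derivative. -/
theorem abs_sub_cubic_le (t : ℝ) :
    |h t - (h 0 + iteratedDeriv 1 h 0 * t + iteratedDeriv 2 h 0 / 2 * t ^ 2 +
      iteratedDeriv 3 h y / 6 * t ^ 3)| ≤ 2 ^ (p + 1) * A * (ℓ + |t| + |y|) ^ (p + 4) := by
  set w := ℓ + |t| + |y|
  have hy := abs_nonneg y
  have ht := abs_nonneg t
  have hw : 1 ≤ w := by simp only [w]; linarith
  have e1 := abs_sub_taylor_sum_le hh 3 0 t (A := A * w ^ p) fun u hu => by
    refine (h4 u).trans (mul_le_mul_of_nonneg_left (pow_le_pow_left₀ (by positivity) ?_ p) hA)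
    have := Set.abs_sub_left_of_mem_uIcc hu
    simp only [sub_zero] at this
    simp only [w]; linarith
  have hcd : ContDiff ℝ ∞ (iteratedDeriv 3 h) := by
    rw [iteratedDeriv_eq_iterate]; exact hh.iterate_deriv 3
  have e2 := abs_sub_taylor_sum_le hcd 0 0 y (A := A * (2 * w) ^ p) fun u hu => by
    rw [zero_add, iteratedDeriv_one, ← iteratedDeriv_succ]
    refine (h4 u).trans (mul_le_mul_of_nonneg_left (pow_le_pow_left₀ (by positivity) ?_ p) hA)
    have := Set.abs_sub_left_of_mem_uIcc hu
    simp only [sub_zero] at this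
    simp only [w]; linarith
  simp only [Finset.sum_range_succ, Finset.sum_range_zero, sub_zero, Nat.factorial,
    iteratedDeriv_zero, zero_add, pow_zero, pow_one, Nat.cast_one, inv_one, one_mul] at e1 e2
  norm_num at e1 e2
  have e3 : |h t - (h 0 + iteratedDeriv 1 h 0 * t + iteratedDeriv 2 h 0 / 2 * t ^ 2 +
      iteratedDeriv 3 h y / 6 * t ^ 3)| ≤ A * w ^ p * |t| ^ 4 +
        (A * (2 * w) ^ p * |y|) * (|t| ^ 3 / 6) := by
    have : h t - (h 0 + iteratedDeriv 1 h 0 * t + iteratedDeriv 2 h 0 / 2 * t ^ 2 +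
      iteratedDeriv 3 h y / 6 * t ^ 3) = (h t - (h 0 + t * iteratedDeriv 1 h 0 +
        1 / 2 * t ^ 2 * iteratedDeriv 2 h 0 + 1 / 6 * t ^ 3 * iteratedDeriv 3 h 0)) -
        (iteratedDeriv 3 h y - iteratedDeriv 3 h 0) * (t ^ 3 / 6) := by ring
    rw [this]
    refine (abs_sub _ _).trans (add_le_add (by simpa using e1) ?_)
    rw [abs_mul, abs_div, abs_pow]
    norm_num
    exact mul_le_mul_of_nonneg_right e2 (by positivity)
  refine e3.trans ?_
  have hyw : |y| ≤ w := by simp only [w]; linarith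
  have htw : |t| ≤ w := by simp only [w]; linarith
  have t4 : |t| ^ 4 ≤ w ^ 4 := pow_le_pow_left₀ ht htw 4
  have t3 : |y| * (|t| ^ 3 / 6) ≤ w ^ 4 := by
    calc |y| * (|t| ^ 3 / 6) ≤ w * w ^ 3 := by
          refine mul_le_mul hyw ?_ (by positivity) (by linarith)
          have := pow_le_pow_left₀ ht htw 3
          have : 0 ≤ |t| ^ 3 := by positivity
          linarith
      _ = w ^ 4 := by ring
  have h2p : (1 : ℝ) ≤ 2 ^ p := one_le_pow₀ (by norm_num)
  calc A * w ^ p * |t| ^ 4 + (A * (2 * w) ^ p * |y|) * (|t| ^ 3 / 6)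
      = A * w ^ p * |t| ^ 4 + A * w ^ p * 2 ^ p * (|y| * (|t| ^ 3 / 6)) := by rw [mul_pow]; ring
    _ ≤ A * w ^ p * w ^ 4 + A * w ^ p * 2 ^ p * w ^ 4 := by gcongr
    _ ≤ A * w ^ p * 2 ^ p * w ^ 4 + A * w ^ p * 2 ^ p * w ^ 4 := by
        have : A * w ^ p * w ^ 4 ≤ A * w ^ p * 2 ^ p * w ^ 4 :=
          mul_le_mul_of_nonneg_right (le_mul_of_one_le_right (by positivity) h2p) (by positivity)
        linarith
    _ = _ := by ring

/-- The terms of order at most two have equal integrals under the two laws. The difference of the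
third moments is kept as an explicit weight and not estimated here. -/
theorem abs_integral_sub_integral_le {s : ℝ≥0} {μ ν : Measure ℝ} (hμ : StdSubgaussian s μ)
    (hν : StdSubgaussian s ν) (hiμ : Integrable h μ) (hiν : Integrable h ν) :
    |∫ t, h t ∂ν - ∫ t, h t ∂μ -
      (∫ t, t ^ 3 ∂ν - ∫ t, t ^ 3 ∂μ) / 6 * iteratedDeriv 3 h y| ≤
      2 * (2 ^ (p + 1) * A * (3 ^ (p + 4) * (ℓ ^ (p + 4) + momentBound s (p + 4) +
        |y| ^ (p + 4)))) := by
  have key : ∀ {ρ : Measure ℝ}, StdSubgaussian s ρ → Integrable h ρ →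
      |∫ t, h t ∂ρ - (h 0 + iteratedDeriv 2 h 0 / 2 + iteratedDeriv 3 h y / 6 * ∫ t, t ^ 3 ∂ρ)| ≤
      2 ^ (p + 1) * A * (3 ^ (p + 4) * (ℓ ^ (p + 4) + momentBound s (p + 4) +
        |y| ^ (p + 4))) := fun {ρ} hρ hi => by
    have := hρ.prob
    have i1 : Integrable (fun t : ℝ => t) ρ := by simpa using hρ.integrable_pow 1
    have i2 := hρ.integrable_pow 2
    have i3 := hρ.integrable_pow 3
    have iT : Integrable (fun t => h 0 + iteratedDeriv 1 h 0 * t +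
        iteratedDeriv 2 h 0 / 2 * t ^ 2 + iteratedDeriv 3 h y / 6 * t ^ 3) ρ :=
      (((integrable_const _).add (i1.const_mul _)).add (i2.const_mul _)).add (i3.const_mul _)
    have eT : ∫ t, (h 0 + iteratedDeriv 1 h 0 * t +
        iteratedDeriv 2 h 0 / 2 * t ^ 2 + iteratedDeriv 3 h y / 6 * t ^ 3) ∂ρ =
        h 0 + iteratedDeriv 2 h 0 / 2 + iteratedDeriv 3 h y / 6 * ∫ t, t ^ 3 ∂ρ := by
      rw [integral_add (((integrable_const _).fun_add (i1.const_mul _)).fun_add (i2.const_mul _))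
        (i3.const_mul _), integral_add ((integrable_const _).fun_add (i1.const_mul _))
        (i2.const_mul _), integral_add (integrable_const _) (i1.const_mul _),
        integral_const_mul, integral_const_mul, integral_const_mul, hρ.mean, hρ.second]
      simp
    rw [← eT, ← integral_sub hi iT]
    refine abs_integral_le_integral_abs.trans ?_
    calc _ ≤ ∫ t, 2 ^ (p + 1) * A * (ℓ + |t| + |y|) ^ (p + 4) ∂ρ :=
          integral_mono (hi.sub iT).abs
            ((hρ.integrable_add_three_pow (by linarith) (abs_nonneg y) _).const_mul _)
            fun t => abs_sub_cubic_le hh hA hℓ h4 t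
      _ ≤ _ := by
          rw [integral_const_mul]
          exact mul_le_mul_of_nonneg_left
            (hρ.integral_add_three_pow_le (by linarith) (abs_nonneg y) _) (by positivity)
  have k1 := abs_le.1 (key hμ hiμ)
  have k2 := abs_le.1 (key hν hiν)
  rw [abs_le]
  constructor <;> ring_nf at * <;> linarith

end exchange
end GenAMP

namespace GenAMP

/-! ### Comparison of expectations and bound for the variance -/

theorem StdSubgaussian.piecewise {ι : Type*} [DecidableEq ι] {s : ℝ≥0} {μ ν : ι → Measure ℝ}
    (hμ : ∀ i, StdSubgaussian s (μ i)) (hν : ∀ i, StdSubgaussian s (ν i)) (S : Finset ι) (i : ι) :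
    StdSubgaussian s (S.piecewise ν μ i) := by
  by_cases h : i ∈ S
  · rw [Finset.piecewise_eq_of_mem _ _ _ h]; exact hν i
  · rw [Finset.piecewise_eq_of_notMem _ _ _ h]; exact hμ i

section
variable {ι : Type*} [Fintype ι] {s : ℝ≥0} {μ : ι → Measure ℝ} [∀ i, IsProbabilityMeasure (μ i)]
  (hμ : ∀ i, StdSubgaussian s (μ i))
include hμ

theorem integrable_abs_eval_pow (m : ι) (r : ℕ) :
    Integrable (fun x => |x m| ^ r) (Measure.pi μ) :=
  (measurePreserving_eval μ m).integrable_comp_of_integrable ((hμ m).integrable_abs_pow r)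

theorem integral_abs_eval_pow_le (m : ι) (r : ℕ) :
    ∫ x, |x m| ^ r ∂(Measure.pi μ) ≤ momentBound s r := by
  have h := measurePreserving_eval μ m
  refine le_of_eq_of_le ?_ ((hμ m).integral_abs_pow_le r)
  rw [← h.map_eq, integral_map h.measurable.aemeasurable (by fun_prop)]

end

theorem integral_pi_update {ι : Type*} [Fintype ι] [DecidableEq ι] (μ : ι → Measure ℝ)
    [∀ i, IsProbabilityMeasure (μ i)] (m : ι) (ρ : Measure ℝ) [IsProbabilityMeasure ρ]
    {f : (ι → ℝ) → ℝ} (hf : Measurable f) {B : ℝ} (hB : ∀ x, |f x| ≤ B) :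
    ∫ x, f x ∂(Measure.pi (Function.update μ m ρ)) =
      ∫ x, ∫ t, f (Function.update x m t) ∂ρ ∂(Measure.pi μ) := by
  have h := measurePreserving_update μ m ρ
  rw [← h.map_eq, integral_map h.measurable.aemeasurable hf.aestronglyMeasurable]
  exact integral_prod _ (Integrable.of_bound (hf.comp h.measurable).aestronglyMeasurable B
    (ae_of_all _ fun p => hB _))

section
variable {n : ℕ} {Ψ ℓ : (Pair n → ℝ) → ℝ} {C : ℝ} {p : ℕ}
  (hΨ : EntryBounds (fun x => C * ℓ x ^ p) Ψ) (hC : 0 ≤ C) (hℓ1 : ∀ x, 1 ≤ ℓ x)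
  (hℓ : ∀ x m t, ℓ (Function.update x m t) ≤ ℓ x + |t| + |x m|)
include hΨ hC hℓ1 hℓ

/-- `EntryBounds` speaks of the derivative at the coordinate's own value. Applied at the updated
point it reaches any `u`, at the price of the growth of `ℓ` under the update. -/
theorem EntryBounds.abs_iteratedDeriv_four_le (x : Pair n → ℝ) (m : Pair n) (u : ℝ) :
    |iteratedDeriv 4 (fun t => Ψ (Function.update x m t)) u| ≤
      C * ((n : ℝ)⁻¹ ^ 2 * (√(n : ℝ))⁻¹) * (ℓ x + |u| + |x m|) ^ p := by
  have h := hΨ.fourth (Function.update x m u) m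
  simp only [Function.update_idem, Function.update_self] at h
  refine h.trans ?_
  have h1 : ℓ (Function.update x m u) ^ p ≤ (ℓ x + |u| + |x m|) ^ p :=
    pow_le_pow_left₀ (by linarith [hℓ1 (Function.update x m u)]) (hℓ x m u) p
  calc _ ≤ C * (ℓ x + |u| + |x m|) ^ p * ((n : ℝ)⁻¹ ^ 2 * (√(n : ℝ))⁻¹) := by gcongr
    _ = _ := by ring

theorem EntryBounds.abs_iteratedDeriv_two_le (x : Pair n → ℝ) (m : Pair n) (u : ℝ) :
    |iteratedDeriv 2 (fun t => Ψ (Function.update x m t)) u| ≤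
      C * ((n : ℝ)⁻¹ * (√(n : ℝ))⁻¹) * (ℓ x + |u| + |x m|) ^ p := by
  have h := hΨ.second (Function.update x m u) m
  simp only [Function.update_idem, Function.update_self] at h
  refine h.trans ?_
  have h1 : ℓ (Function.update x m u) ^ p ≤ (ℓ x + |u| + |x m|) ^ p :=
    pow_le_pow_left₀ (by linarith [hℓ1 (Function.update x m u)]) (hℓ x m u) p
  calc _ ≤ C * (ℓ x + |u| + |x m|) ^ p * ((n : ℝ)⁻¹ * (√(n : ℝ))⁻¹) := by gcongr
    _ = _ := by ring

/-- The change of the expectation, summed over all exchanges of a single variable. -/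
theorem EntryBounds.abs_sum_exchange_le (hn : 0 < n) {s : ℝ≥0} {μ ν : Pair n → Measure ℝ}
    [∀ i, IsProbabilityMeasure (μ i)] [∀ i, IsProbabilityMeasure (ν i)]
    (hμ : ∀ i, StdSubgaussian s (μ i)) (hν : ∀ i, StdSubgaussian s (ν i))
    (hΨm : Measurable Ψ) {B : ℝ} (hB : ∀ x, |Ψ x| ≤ B) (S : Finset (Pair n)) {M : ℝ}
    (hint : Integrable (fun x => ℓ x ^ (p + 4)) (Measure.pi (S.piecewise ν μ)))
    (hM : ∫ x, ℓ x ^ (p + 4) ∂(Measure.pi (S.piecewise ν μ)) ≤ M) :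
    |∑ m ∈ Sᶜ, (∫ x, Ψ x ∂(Measure.pi ((insert m S).piecewise ν μ)) -
        ∫ x, Ψ x ∂(Measure.pi (S.piecewise ν μ)))| ≤
      C * ((momentBound s 3 + 1) * M +
        2 ^ (p + 2) * 3 ^ (p + 4) * (M + 2 * momentBound s (p + 4))) * (√(n : ℝ))⁻¹ := by
  set ρ := S.piecewise ν μ with hρdef
  have hρ : ∀ i, StdSubgaussian s (ρ i) := StdSubgaussian.piecewise hμ hν S
  set π := Measure.pi ρ
  set r := p + 4 with hr
  set w := (n : ℝ)⁻¹ ^ 2 * (√(n : ℝ))⁻¹ with hw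
  have hw0 : 0 ≤ w := by positivity
  set c₀ := momentBound s 3 + 1 with hc₀
  have hc₀pos : 0 < c₀ := by have := momentBound_nonneg s 3; linarith
  have hmb := momentBound_nonneg s r
  have hintb : ∀ (x : Pair n → ℝ) (m : Pair n) (τ : Measure ℝ) [IsProbabilityMeasure τ],
      Integrable (fun t => Ψ (Function.update x m t)) τ := fun x m τ _ =>
    Integrable.of_bound (hΨm.comp (measurable_update x)).aestronglyMeasurable B
      (ae_of_all _ fun t => hB _)
  let a : Pair n → (Pair n → ℝ) → ℝ := fun m x =>
    ∫ t, Ψ (Function.update x m t) ∂(ν m) - ∫ t, Ψ (Function.update x m t) ∂(μ m)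
  have hinner : ∀ (m : Pair n) (τ : Measure ℝ) [IsProbabilityMeasure τ],
      Integrable (fun x => ∫ t, Ψ (Function.update x m t) ∂τ) π := fun m τ _ => by
    have hI : Integrable (fun q : (Pair n → ℝ) × ℝ => Ψ (Function.update q.1 m q.2)) (π.prod τ) :=
      Integrable.of_bound (hΨm.comp (measurable_update_pair m)).aestronglyMeasurable B
        (ae_of_all _ fun q => hB _)
    exact hI.integral_prod_left
  -- For `m` outside `S` the law of coordinate `m` under `π` is `μ m`, so resampling it from `μ m`
  -- changes nothing. Both expectations become integrals over the same `x`.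
  have hdiff : ∀ m ∈ Sᶜ, ∫ x, Ψ x ∂(Measure.pi ((insert m S).piecewise ν μ)) - ∫ x, Ψ x ∂π =
      ∫ x, a m x ∂π := fun m hm => by
    have h1 : ∫ x, Ψ x ∂(Measure.pi ((insert m S).piecewise ν μ)) =
        ∫ x, ∫ t, Ψ (Function.update x m t) ∂(ν m) ∂π := by
      rw [Finset.piecewise_insert]
      exact integral_pi_update ρ m (ν m) hΨm hB
    have h2 : ∫ x, Ψ x ∂π = ∫ x, ∫ t, Ψ (Function.update x m t) ∂(μ m) ∂π := by
      rw [← integral_pi_update ρ m (μ m) hΨm hB]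
      have : Function.update ρ m (μ m) = ρ := by
        rw [Function.update_eq_self_iff, hρdef,
          Finset.piecewise_eq_of_notMem _ _ _ (Finset.mem_compl.1 hm)]
      simp only [this]; rfl
    rw [h1, h2, ← integral_sub (hinner m _) (hinner m _)]
  have haint : ∀ m ∈ Sᶜ, Integrable (a m) π := fun m _ =>
    (hinner m (ν m)).sub (hinner m (μ m))
  rw [Finset.sum_congr rfl hdiff, ← integral_finsetSum _ haint]
  let H : (Pair n → ℝ) → ℝ := fun x => c₀ * (C * ℓ x ^ r * (√(n : ℝ))⁻¹) +
    ∑ m, 2 * (2 ^ (p + 1) * (C * w) * (3 ^ r * (ℓ x ^ r + momentBound s r + |x m| ^ r)))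
  have hpt : ∀ x, |∑ m ∈ Sᶜ, a m x| ≤ H x := fun x => by
    let κ : Pair n → ℝ := fun m => (∫ t, t ^ 3 ∂(ν m) - ∫ t, t ^ 3 ∂(μ m)) / 6
    have hκ : ∀ m, |κ m| ≤ c₀ := fun m => by
      have h1 := abs_le.1 ((hμ m).abs_integral_pow_le 3)
      have h2 := abs_le.1 ((hν m).abs_integral_pow_le 3)
      have := momentBound_nonneg s 3
      simp only [κ]; rw [abs_le]; constructor <;> linarith
    let D3 : Pair n → ℝ := fun m => iteratedDeriv 3 (fun t => Ψ (Function.update x m t)) (x m)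
    have h3 : |∑ m ∈ Sᶜ, κ m * D3 m| ≤ c₀ * (C * ℓ x ^ r * (√(n : ℝ))⁻¹) := by
      -- The weights are the differences of third moments, normalised to absolute value at most one
      -- and set to zero on the coordinates already exchanged.
      have h4 := hΨ.third x (fun m => if m ∈ Sᶜ then κ m / c₀ else 0) fun m => by
        split_ifs
        · rw [abs_div, abs_of_pos hc₀pos]; exact (div_le_one hc₀pos).2 (hκ m)
        · simp
      have h5 : ∑ m ∈ Sᶜ, κ m * D3 m =
          c₀ * ∑ m, (if m ∈ Sᶜ then κ m / c₀ else 0) * D3 m := by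
        simp only [ite_mul, zero_mul]
        rw [Finset.sum_ite_mem, Finset.univ_inter, Finset.mul_sum]
        exact Finset.sum_congr rfl fun m _ => by field_simp
      rw [h5, abs_mul, abs_of_pos hc₀pos]
      refine mul_le_mul_of_nonneg_left (h4.trans ?_) hc₀pos.le
      have : ℓ x ^ p ≤ ℓ x ^ r := pow_le_pow_right₀ (hℓ1 x) (by omega)
      gcongr
    have h6 : ∑ m ∈ Sᶜ, a m x = ∑ m ∈ Sᶜ, κ m * D3 m + ∑ m ∈ Sᶜ, (a m x - κ m * D3 m) := by
      rw [← Finset.sum_add_distrib]; exact Finset.sum_congr rfl fun m _ => by ring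
    rw [h6]
    refine (abs_add_le _ _).trans (add_le_add h3 ?_)
    refine (Finset.abs_sum_le_sum_abs _ _).trans ?_
    have hterm : ∀ m, |a m x - κ m * D3 m| ≤
        2 * (2 ^ (p + 1) * (C * w) * (3 ^ r * (ℓ x ^ r + momentBound s r + |x m| ^ r))) :=
      fun m => abs_integral_sub_integral_le (hΨ.smooth x m) (mul_nonneg hC hw0) (hℓ1 x)
        (hΨ.abs_iteratedDeriv_four_le hC hℓ1 hℓ x m) (hμ m) (hν m) (hintb x m _) (hintb x m _)
    refine (Finset.sum_le_sum fun m _ => hterm m).trans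
      (Finset.sum_le_sum_of_subset_of_nonneg (Finset.subset_univ _) fun m _ _ => ?_)
    exact (abs_nonneg _).trans (hterm m)
  have hHterm : ∀ m, Integrable (fun x => 2 * (2 ^ (p + 1) * (C * w) *
      (3 ^ r * (ℓ x ^ r + momentBound s r + |x m| ^ r)))) π := fun m =>
    ((((hint.add (integrable_const _)).add (integrable_abs_eval_pow hρ m r)).const_mul
      (3 ^ r)).const_mul (2 ^ (p + 1) * (C * w))).const_mul 2
  have hH1 : Integrable (fun x => c₀ * (C * ℓ x ^ r * (√(n : ℝ))⁻¹)) π :=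
    ((hint.const_mul C).mul_const _).const_mul c₀
  have hHint : Integrable H π := hH1.add (integrable_finsetSum _ fun m _ => hHterm m)
  have hmain : |∫ x, ∑ m ∈ Sᶜ, a m x ∂π| ≤ ∫ x, H x ∂π :=
    norm_integral_le_of_norm_le (f := fun x => ∑ m ∈ Sᶜ, a m x) hHint (ae_of_all _ hpt)
  refine hmain.trans ?_
  have hHle : ∀ m, ∫ x, 2 * (2 ^ (p + 1) * (C * w) *
      (3 ^ r * (ℓ x ^ r + momentBound s r + |x m| ^ r))) ∂π ≤
      2 * (2 ^ (p + 1) * (C * w) * (3 ^ r * (M + 2 * momentBound s r))) := fun m => by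
    rw [integral_const_mul, integral_const_mul, integral_const_mul,
      integral_add (hint.fun_add (integrable_const _)) (integrable_abs_eval_pow hρ m r),
      integral_add hint (integrable_const _)]
    have h1 := integral_abs_eval_pow_le hρ m r
    simp only [integral_const, probReal_univ, one_smul]
    have h2 : ∫ x, ℓ x ^ r ∂π + momentBound s r + ∫ x, |x m| ^ r ∂π ≤
      M + 2 * momentBound s r := by linarith
    gcongr
  have hM0 : 0 ≤ M + 2 * momentBound s r := by
    have : 0 ≤ ∫ x, ℓ x ^ r ∂π := integral_nonneg fun x => pow_nonneg (by linarith [hℓ1 x]) _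
    linarith
  -- There are at most `n ^ 2` positions, each with a fourth-order error of order `n ^ (-5/2)`.
  have hnw : (n : ℝ) ^ 2 * w = (√(n : ℝ))⁻¹ := by
    have : (0 : ℝ) < n := by exact_mod_cast hn
    rw [hw]; field_simp
  calc ∫ x, H x ∂π = ∫ x, c₀ * (C * ℓ x ^ r * (√(n : ℝ))⁻¹) ∂π + ∑ m, ∫ x,
        2 * (2 ^ (p + 1) * (C * w) * (3 ^ r * (ℓ x ^ r + momentBound s r + |x m| ^ r))) ∂π := by
        rw [← integral_finsetSum _ fun m _ => hHterm m]
        exact integral_add hH1 (integrable_finsetSum _ fun m _ => hHterm m)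
    _ ≤ c₀ * (C * M * (√(n : ℝ))⁻¹) + ∑ m : Pair n,
        2 * (2 ^ (p + 1) * (C * w) * (3 ^ r * (M + 2 * momentBound s r))) := by
        refine add_le_add ?_ (Finset.sum_le_sum fun m _ => hHle m)
        rw [integral_const_mul, integral_mul_const, integral_const_mul]
        gcongr
    _ = c₀ * (C * M * (√(n : ℝ))⁻¹) + Fintype.card (Pair n) *
        (2 * (2 ^ (p + 1) * (C * w) * (3 ^ r * (M + 2 * momentBound s r)))) := by
        rw [Finset.sum_const, nsmul_eq_mul, Finset.card_univ]
    _ ≤ c₀ * (C * M * (√(n : ℝ))⁻¹) + (n : ℝ) ^ 2 *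
        (2 * (2 ^ (p + 1) * (C * w) * (3 ^ r * (M + 2 * momentBound s r)))) := by
        gcongr; exact card_pair_le
    _ = C * c₀ * M * (√(n : ℝ))⁻¹ + 2 ^ (p + 2) * C * 3 ^ r * (M + 2 * momentBound s r) *
        ((n : ℝ) ^ 2 * w) := by ring
    _ = _ := by rw [hnw]; ring

/-- Comparison of the expectations under two product laws with the same first two moments. -/
theorem EntryBounds.abs_integral_pi_sub_le (hn : 0 < n) {s : ℝ≥0} {μ ν : Pair n → Measure ℝ}
    [∀ i, IsProbabilityMeasure (μ i)] [∀ i, IsProbabilityMeasure (ν i)]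
    (hμ : ∀ i, StdSubgaussian s (μ i)) (hν : ∀ i, StdSubgaussian s (ν i))
    (hΨm : Measurable Ψ) {B : ℝ} (hB : ∀ x, |Ψ x| ≤ B) {M : ℝ}
    (hint : ∀ S : Finset (Pair n),
      Integrable (fun x => ℓ x ^ (p + 4)) (Measure.pi (S.piecewise ν μ)))
    (hM : ∀ S : Finset (Pair n),
      ∫ x, ℓ x ^ (p + 4) ∂(Measure.pi (S.piecewise ν μ)) ≤ M) :
    |∫ x, Ψ x ∂(Measure.pi ν) - ∫ x, Ψ x ∂(Measure.pi μ)| ≤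
      C * ((momentBound s 3 + 1) * M +
        2 ^ (p + 2) * 3 ^ (p + 4) * (M + 2 * momentBound s (p + 4))) *
          ((√(n : ℝ))⁻¹ * (1 + Real.log ((n : ℝ) ^ 2))) := by
  set δ := C * ((momentBound s 3 + 1) * M +
    2 ^ (p + 2) * 3 ^ (p + 4) * (M + 2 * momentBound s (p + 4))) * (√(n : ℝ))⁻¹ with hδ
  have key := fun S => hΨ.abs_sum_exchange_le hC hℓ1 hℓ hn hμ hν hΨm hB S (hint S) (hM S)
  have hδ0 : 0 ≤ δ := (abs_nonneg _).trans (key ∅)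
  let φ : Finset (Pair n) → ℝ := fun S => ∫ x, Ψ x ∂(Measure.pi (S.piecewise ν μ))
  have h1 := le_add_mul_harmonic φ (δ := δ) (fun S => (abs_le.1 (key S)).2) ∅
  -- An order that is good for the upper bound need not be good for the lower bound, so a separate
  -- order is chosen for `-φ`.
  have h2 := le_add_mul_harmonic (fun S => -φ S) (δ := δ) (fun S => by
    have := (abs_le.1 (key S)).1
    have e : ∑ m ∈ Sᶜ, (-φ (insert m S) - -φ S) = -∑ m ∈ Sᶜ, (φ (insert m S) - φ S) := by
      rw [← Finset.sum_neg_distrib]; exact Finset.sum_congr rfl fun m _ => by ring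
    rw [e]; simp only [φ]; linarith) ∅
  have e1 : φ Finset.univ = ∫ x, Ψ x ∂(Measure.pi ν) := by simp only [φ, Finset.piecewise_univ]
  have e2 : φ ∅ = ∫ x, Ψ x ∂(Measure.pi μ) := by simp only [φ, Finset.piecewise_empty]
  have hcard : ((∅ : Finset (Pair n))ᶜ.card : ℝ) ≤ (n : ℝ) ^ 2 := by
    rw [Finset.compl_empty, Finset.card_univ]; exact card_pair_le
  have hpos : 0 < (∅ : Finset (Pair n))ᶜ.card := by
    rw [Finset.compl_empty, Finset.card_univ]
    exact Fintype.card_pos_iff.2 ⟨⟨(⟨0, hn⟩, ⟨0, hn⟩), le_rfl⟩⟩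
  have hharm : (harmonic (∅ : Finset (Pair n))ᶜ.card : ℝ) ≤ 1 + Real.log ((n : ℝ) ^ 2) := by
    refine (harmonic_le_one_add_log _).trans ?_
    have := Real.log_le_log (by exact_mod_cast hpos) hcard
    linarith
  have h3 := mul_le_mul_of_nonneg_left hharm hδ0
  rw [← mul_assoc, ← hδ, ← e1, ← e2, abs_le]
  constructor <;> linarith

/-- Bound for the squared increment in one variable. -/
theorem EntryBounds.sq_sub_update_le (hn : 0 < n) (x : Pair n → ℝ) (m : Pair n) (t : ℝ) :
    (Ψ x - Ψ (Function.update x m t)) ^ 2 ≤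
      2 * √(n : ℝ) * iteratedDeriv 1 (fun t => Ψ (Function.update x m t)) (x m) ^ 2 +
        4 ^ (p + 1) * C ^ 2 * ((n : ℝ)⁻¹ ^ 2 * (√(n : ℝ))⁻¹) *
          (ℓ x + |t| + |x m|) ^ (2 * p + 4) := by
  have hn1 : (1 : ℝ) ≤ n := by exact_mod_cast hn
  set b := √(n : ℝ) with hb
  have hb1 : 1 ≤ b := Real.one_le_sqrt.2 hn1
  have hb0 : 0 < b := by linarith
  let D1 : Pair n → (Pair n → ℝ) → ℝ := fun m x =>
    iteratedDeriv 1 (fun t => Ψ (Function.update x m t)) (x m)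
  change _ ≤ 2 * b * D1 m x ^ 2 + _
  set r := 2 * p + 4
  set w := ℓ x + |t| + |x m| with hw
  have hxm := abs_nonneg (x m)
  have ht := abs_nonneg t
  have hw1 : 1 ≤ w := by linarith [hℓ1 x]
  have hw0 : 0 ≤ w := by linarith
  have hy : |t - x m| ≤ w := (abs_sub _ _).trans (by linarith [hℓ1 x])
  have e1 := abs_sub_taylor_sum_le (hΨ.smooth x m) 1 (x m) t
    (A := C * ((n : ℝ)⁻¹ * b⁻¹) * (2 * w) ^ p) fun u hu => by
    refine (hΨ.abs_iteratedDeriv_two_le hC hℓ1 hℓ x m u).trans ?_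
    refine mul_le_mul_of_nonneg_left (pow_le_pow_left₀ ?_ ?_ p) (by positivity)
    · linarith [hℓ1 x, abs_nonneg u]
    · have h1 : |u| ≤ |t| + |x m| := by
        rcases Set.mem_uIcc.1 hu with ⟨h1, h2⟩ | ⟨h1, h2⟩
        · exact (abs_le_max_abs_abs h1 h2).trans (max_le (by linarith) (by linarith))
        · exact (abs_le_max_abs_abs h1 h2).trans (max_le (by linarith) (by linarith))
      linarith [hℓ1 x]
  simp only [Finset.sum_range_succ, Finset.sum_range_zero, Nat.factorial, iteratedDeriv_zero,
    zero_add, pow_zero, pow_one, Nat.cast_one, inv_one, one_mul, Function.update_eq_self,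
    mul_one] at e1
  set y := t - x m
  have e1' : |Ψ (Function.update x m t) - (Ψ x + y * D1 m x)| ≤
      C * ((n : ℝ)⁻¹ * b⁻¹) * (2 * w) ^ p * |y| ^ 2 := e1
  have e2 : |Ψ (Function.update x m t) - (Ψ x + y * D1 m x)| ≤
      C * ((n : ℝ)⁻¹ * b⁻¹) * 2 ^ p * w ^ (p + 2) := by
    refine e1'.trans ?_
    calc _ ≤ C * ((n : ℝ)⁻¹ * b⁻¹) * (2 * w) ^ p * w ^ 2 := by gcongr
      _ = _ := by rw [mul_pow]; ring
  have e3 : (Ψ (Function.update x m t) - (Ψ x + y * D1 m x)) ^ 2 ≤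
      (C * ((n : ℝ)⁻¹ * b⁻¹) * 2 ^ p * w ^ (p + 2)) ^ 2 := by
    rw [← sq_abs]; exact pow_le_pow_left₀ (abs_nonneg _) e2 2
  have e4 : (C * ((n : ℝ)⁻¹ * b⁻¹) * 2 ^ p * w ^ (p + 2)) ^ 2 ≤
      4 ^ p * C ^ 2 * ((n : ℝ)⁻¹ ^ 2 * b⁻¹) * w ^ r := by
    have : (C * ((n : ℝ)⁻¹ * b⁻¹) * 2 ^ p * w ^ (p + 2)) ^ 2 =
        (4 ^ p * C ^ 2 * ((n : ℝ)⁻¹ ^ 2 * b⁻¹) * w ^ r) * b⁻¹ := by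
      rw [show (4 : ℝ) ^ p = (2 ^ p) ^ 2 by rw [← pow_mul, mul_comm, pow_mul]; norm_num]
      ring
    rw [this]
    exact mul_le_of_le_one_right (by positivity) (inv_le_one_of_one_le₀ hb1)
  have e5 : D1 m x ^ 2 ≤ C ^ 2 * w ^ (2 * p) * (n : ℝ)⁻¹ ^ 2 := by
    have h1 : |D1 m x| ≤ C * w ^ p * (n : ℝ)⁻¹ := by
      refine (hΨ.first x m).trans ?_
      have : ℓ x ^ p ≤ w ^ p := pow_le_pow_left₀ (by linarith [hℓ1 x]) (by linarith) p
      gcongr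
    rw [← sq_abs]
    refine (pow_le_pow_left₀ (abs_nonneg _) h1 2).trans_eq (by ring)
  -- The increment `y` depends on `x`, as does the gradient, so they are separated with the weight
  -- `b = √n`. The part `b` loses only `√n` in the gradient bound; in the other part the pointwise
  -- bound on `D1` suffices, because of the factor `b⁻¹`.
  have e6 : y ^ 2 ≤ b + w ^ 4 * b⁻¹ := by
    have h1 : y ^ 2 ≤ b + y ^ 4 * b⁻¹ := by
      have : y ^ 2 * b ≤ (b + y ^ 4 * b⁻¹) * b := by
        rw [add_mul, mul_assoc, inv_mul_cancel₀ hb0.ne', mul_one]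
        nlinarith [sq_nonneg (b - y ^ 2), sq_nonneg (b + y ^ 2)]
      exact le_of_mul_le_mul_right this hb0
    have h2 : y ^ 4 ≤ w ^ 4 := by
      rw [← Even.pow_abs (by decide : Even 4) y]; exact pow_le_pow_left₀ (abs_nonneg _) hy 4
    have : y ^ 4 * b⁻¹ ≤ w ^ 4 * b⁻¹ := by gcongr
    linarith
  have e7 : D1 m x ^ 2 * y ^ 2 ≤ b * D1 m x ^ 2 +
      4 ^ p * C ^ 2 * ((n : ℝ)⁻¹ ^ 2 * b⁻¹) * w ^ r := by
    calc D1 m x ^ 2 * y ^ 2 ≤ D1 m x ^ 2 * (b + w ^ 4 * b⁻¹) := by gcongr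
      _ = b * D1 m x ^ 2 + D1 m x ^ 2 * (w ^ 4 * b⁻¹) := by ring
      _ ≤ b * D1 m x ^ 2 + (C ^ 2 * w ^ (2 * p) * (n : ℝ)⁻¹ ^ 2) * (w ^ 4 * b⁻¹) := by gcongr
      _ = b * D1 m x ^ 2 + 1 * (C ^ 2 * ((n : ℝ)⁻¹ ^ 2 * b⁻¹) * w ^ r) := by ring
      _ ≤ b * D1 m x ^ 2 + 4 ^ p * (C ^ 2 * ((n : ℝ)⁻¹ ^ 2 * b⁻¹) * w ^ r) := by
          gcongr; exact one_le_pow₀ (by norm_num)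
      _ = _ := by ring
  have e8 : (Ψ x - Ψ (Function.update x m t)) ^ 2 ≤ 2 * (D1 m x ^ 2 * y ^ 2) +
      2 * (Ψ (Function.update x m t) - (Ψ x + y * D1 m x)) ^ 2 := by
    nlinarith [sq_nonneg ((Ψ (Function.update x m t) - (Ψ x + y * D1 m x)) - D1 m x * y)]
  rw [show (4 : ℝ) ^ (p + 1) * C ^ 2 * ((n : ℝ)⁻¹ ^ 2 * b⁻¹) =
    4 * (4 ^ p * C ^ 2 * ((n : ℝ)⁻¹ ^ 2 * b⁻¹)) by ring]
  linarith

/-- Bound for the variance under a product law. -/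
theorem EntryBounds.variance_le (hn : 0 < n) {s : ℝ≥0} {μ : Pair n → Measure ℝ}
    [∀ i, IsProbabilityMeasure (μ i)] (hμ : ∀ i, StdSubgaussian s (μ i))
    (hΨm : Measurable Ψ) {B : ℝ} (hB : ∀ x, |Ψ x| ≤ B) {M : ℝ}
    (hint : Integrable (fun x => ℓ x ^ (2 * p + 4)) (Measure.pi μ))
    (hM : ∫ x, ℓ x ^ (2 * p + 4) ∂(Measure.pi μ) ≤ M) :
    ∫ x, Ψ x ^ 2 ∂(Measure.pi μ) - (∫ x, Ψ x ∂(Measure.pi μ)) ^ 2 ≤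
      C ^ 2 * (2 * M + 4 ^ (p + 1) * (3 ^ (2 * p + 4) *
        (M + 2 * momentBound s (2 * p + 4)))) * (√(n : ℝ))⁻¹ := by
  set π := Measure.pi μ
  set r := 2 * p + 4 with hr
  have hn1 : (1 : ℝ) ≤ n := by exact_mod_cast hn
  have hn0 : (0 : ℝ) < n := by linarith
  set b := √(n : ℝ) with hb
  have hb1 : 1 ≤ b := Real.one_le_sqrt.2 hn1
  have hb0 : 0 < b := by linarith
  have hbn : (n : ℝ) = b ^ 2 := (Real.sq_sqrt hn0.le).symm
  have hmb := momentBound_nonneg s r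
  set A := 4 ^ (p + 1) * C ^ 2 * ((n : ℝ)⁻¹ ^ 2 * b⁻¹) with hA
  have hA0 : 0 ≤ A := by positivity
  let D1 : Pair n → (Pair n → ℝ) → ℝ := fun m x =>
    iteratedDeriv 1 (fun t => Ψ (Function.update x m t)) (x m)
  have hpt : ∀ x m t, (Ψ x - Ψ (Function.update x m t)) ^ 2 ≤
      2 * b * D1 m x ^ 2 + A * (ℓ x + |t| + |x m|) ^ r := fun x m t =>
    hΨ.sq_sub_update_le hC hℓ1 hℓ hn x m t
  have hdm : ∀ m, Measurable fun q : (Pair n → ℝ) × ℝ =>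
      (Ψ q.1 - Ψ (Function.update q.1 m q.2)) ^ 2 := fun m =>
    ((hΨm.comp measurable_fst).sub (hΨm.comp (measurable_update_pair m))).pow_const 2
  have hbd : ∀ m (q : (Pair n → ℝ) × ℝ),
      |(Ψ q.1 - Ψ (Function.update q.1 m q.2)) ^ 2| ≤ (2 * B) ^ 2 := fun m q => by
    rw [abs_pow]
    refine pow_le_pow_left₀ (abs_nonneg _) ?_ 2
    have h1 := abs_le.1 (hB q.1); have h2 := abs_le.1 (hB (Function.update q.1 m q.2))
    rw [abs_le]; constructor <;> linarith
  have hI : ∀ m, Integrable (fun q : (Pair n → ℝ) × ℝ =>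
      (Ψ q.1 - Ψ (Function.update q.1 m q.2)) ^ 2) (π.prod (μ m)) := fun m =>
    Integrable.of_bound (hdm m).aestronglyMeasurable ((2 * B) ^ 2) (ae_of_all _ fun q => hbd m q)
  let G : Pair n → (Pair n → ℝ) → ℝ := fun m x =>
    ∫ t, (Ψ x - Ψ (Function.update x m t)) ^ 2 ∂(μ m)
  have hGint : ∀ m ∈ Finset.univ, Integrable (G m) π := fun m _ => (hI m).integral_prod_left
  have hES := variance_pi_le μ hΨm hB
  have hsum : ∑ m, ∫ q, (Ψ q.1 - Ψ (Function.update q.1 m q.2)) ^ 2 ∂(π.prod (μ m)) =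
      ∫ x, ∑ m, G m x ∂π := by
    rw [integral_finsetSum _ hGint]
    exact Finset.sum_congr rfl fun m _ => integral_prod _ (hI m)
  let H : (Pair n → ℝ) → ℝ := fun x => 2 * C ^ 2 * b⁻¹ * ℓ x ^ r +
    ∑ m, A * (3 ^ r * (ℓ x ^ r + momentBound s r + |x m| ^ r))
  -- The first-order terms sum to `√n` times the gradient bound, of order `n ^ (-1/2)`; the others
  -- are at most `n ^ 2` terms of order `n ^ (-5/2)`.
  have hGH : ∀ x, ∑ m, G m x ≤ H x := fun x => by
    have h1 : ∀ m, G m x ≤ 2 * b * D1 m x ^ 2 +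
        A * (3 ^ r * (ℓ x ^ r + momentBound s r + |x m| ^ r)) := fun m => by
      have hi := (hμ m).integrable_add_three_pow (a := ℓ x) (by linarith [hℓ1 x])
        (abs_nonneg (x m)) r
      have hmeas : Measurable fun t => (Ψ x - Ψ (Function.update x m t)) ^ 2 :=
        (hdm m).comp measurable_prodMk_left
      calc G m x ≤ ∫ t, (2 * b * D1 m x ^ 2 + A * (ℓ x + |t| + |x m|) ^ r) ∂(μ m) := by
            refine integral_mono (Integrable.of_bound hmeas.aestronglyMeasurable ((2 * B) ^ 2)
              (ae_of_all _ fun t => hbd m (x, t)))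
              ((integrable_const _).add (hi.const_mul A)) fun t => hpt x m t
        _ = 2 * b * D1 m x ^ 2 + A * ∫ t, (ℓ x + |t| + |x m|) ^ r ∂(μ m) := by
            rw [integral_add (integrable_const _) (hi.const_mul A), integral_const, integral_const_mul]
            simp
        _ ≤ _ := by
            have := (hμ m).integral_add_three_pow_le (a := ℓ x) (by linarith [hℓ1 x])
              (abs_nonneg (x m)) r
            gcongr
    refine (Finset.sum_le_sum fun m _ => h1 m).trans ?_
    rw [Finset.sum_add_distrib, ← Finset.mul_sum]
    refine add_le_add ?_ le_rfl
    calc 2 * b * ∑ m, D1 m x ^ 2 ≤ 2 * b * ((C * ℓ x ^ p) ^ 2 * (n : ℝ)⁻¹) := by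
          gcongr; exact hΨ.grad x
      _ = 2 * C ^ 2 * b⁻¹ * ℓ x ^ (2 * p) := by rw [hbn]; field_simp; ring
      _ ≤ _ := by
          have : ℓ x ^ (2 * p) ≤ ℓ x ^ r := pow_le_pow_right₀ (hℓ1 x) (by omega)
          gcongr
  have hHterm : ∀ m ∈ Finset.univ, Integrable (fun x => A *
      (3 ^ r * (ℓ x ^ r + momentBound s r + |x m| ^ r))) π := fun m _ =>
    (((hint.add (integrable_const _)).add (integrable_abs_eval_pow hμ m r)).const_mul
      (3 ^ r)).const_mul A
  have hH1 : Integrable (fun x => 2 * C ^ 2 * b⁻¹ * ℓ x ^ r) π := hint.const_mul _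
  have hHint : Integrable H π := hH1.add (integrable_finsetSum _ hHterm)
  have hHle : ∀ m, ∫ x, A * (3 ^ r * (ℓ x ^ r + momentBound s r + |x m| ^ r)) ∂π ≤
      A * (3 ^ r * (M + 2 * momentBound s r)) := fun m => by
    rw [integral_const_mul, integral_const_mul,
      integral_add (hint.fun_add (integrable_const _)) (integrable_abs_eval_pow hμ m r),
      integral_add hint (integrable_const _)]
    have h1 := integral_abs_eval_pow_le hμ m r
    simp only [integral_const, probReal_univ, one_smul]
    have h2 : ∫ x, ℓ x ^ r ∂π + momentBound s r + ∫ x, |x m| ^ r ∂π ≤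
      M + 2 * momentBound s r := by linarith
    gcongr
  have hM0 : 0 ≤ M + 2 * momentBound s r := by
    have : 0 ≤ ∫ x, ℓ x ^ r ∂π := integral_nonneg fun x => pow_nonneg (by linarith [hℓ1 x]) _
    linarith
  have hnA : (n : ℝ) ^ 2 * A = 4 ^ (p + 1) * C ^ 2 * b⁻¹ := by rw [hA]; field_simp
  have hfin : ∫ x, ∑ m, G m x ∂π ≤ C ^ 2 * (2 * M + 4 ^ (p + 1) * (3 ^ r *
        (M + 2 * momentBound s r))) * b⁻¹ := by
    calc ∫ x, ∑ m, G m x ∂π ≤ ∫ x, H x ∂π :=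
          integral_mono (integrable_finsetSum _ hGint) hHint hGH
      _ = ∫ x, 2 * C ^ 2 * b⁻¹ * ℓ x ^ r ∂π + ∑ m, ∫ x,
          A * (3 ^ r * (ℓ x ^ r + momentBound s r + |x m| ^ r)) ∂π := by
          rw [← integral_finsetSum _ hHterm]
          exact integral_add hH1 (integrable_finsetSum _ hHterm)
      _ ≤ 2 * C ^ 2 * b⁻¹ * M + ∑ m : Pair n, A * (3 ^ r * (M + 2 * momentBound s r)) := by
          refine add_le_add ?_ (Finset.sum_le_sum fun m _ => hHle m)
          rw [integral_const_mul]
          gcongr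
      _ = 2 * C ^ 2 * b⁻¹ * M + Fintype.card (Pair n) *
          (A * (3 ^ r * (M + 2 * momentBound s r))) := by
          rw [Finset.sum_const, nsmul_eq_mul, Finset.card_univ]
      _ ≤ 2 * C ^ 2 * b⁻¹ * M + (n : ℝ) ^ 2 *
          (A * (3 ^ r * (M + 2 * momentBound s r))) := by
          gcongr; exact card_pair_le
      _ = 2 * C ^ 2 * b⁻¹ * M + ((n : ℝ) ^ 2 * A) * (3 ^ r * (M + 2 * momentBound s r)) := by ring
      _ = _ := by rw [hnA]; ring
  rw [hsum] at hES
  have hG0 : 0 ≤ ∫ x, ∑ m, G m x ∂π := integral_nonneg fun x =>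
    Finset.sum_nonneg fun m _ => integral_nonneg fun t => sq_nonneg _
  linarith

end
end GenAMP

namespace GenAMP

/-! ### Linear forms in independent subgaussian variables -/

section linear
variable {ι : Type*} [Fintype ι] {s : ℝ≥0} {μ : ι → Measure ℝ} [∀ i, IsProbabilityMeasure (μ i)]

theorem hasSubgaussianMGF_mono {Ω : Type*} [MeasurableSpace Ω] {P : Measure Ω} {X : Ω → ℝ}
    {c d : ℝ≥0} (h : HasSubgaussianMGF X c P) (hcd : c ≤ d) : HasSubgaussianMGF X d P where
  integrable_exp_mul := h.integrable_exp_mul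
  mgf_le t := (h.mgf_le t).trans (by
    have : (c : ℝ) ≤ d := hcd
    gcongr)

theorem hasSubgaussianMGF_linear (hμ : ∀ i, StdSubgaussian s (μ i)) (b : ι → ℝ) {K : ℝ≥0}
    (hK : ∑ i, b i ^ 2 ≤ K) :
    HasSubgaussianMGF (fun x : ι → ℝ => ∑ i, b i * x i) (s * K) (Measure.pi μ) := by
  have h1 : iIndepFun (fun i (x : ι → ℝ) => b i * x i) (Measure.pi μ) :=
    iIndepFun_pi (X := fun i t => b i * t) fun i => by fun_prop
  have h2 : ∀ i, HasSubgaussianMGF (fun x : ι → ℝ => b i * x i)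
      (.mk (b i ^ 2) (sq_nonneg _) * s) (Measure.pi μ) := fun i => by
    refine HasSubgaussianMGF.const_mul (X := fun x : ι → ℝ => x i) ?_ (b i)
    have h3 : (Measure.pi μ).map (fun f : ι → ℝ => f i) = μ i := (measurePreserving_eval μ i).map_eq
    have h4 := (hμ i).subgaussian
    rw [← h3] at h4
    exact HasSubgaussianMGF.of_map (Y := fun f : ι → ℝ => f i)
      (measurable_pi_apply i).aemeasurable h4
  refine hasSubgaussianMGF_mono (HasSubgaussianMGF.sum_of_iIndepFun h1 fun i _ => h2 i) ?_
  rw [← Finset.sum_mul, mul_comm]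
  refine mul_le_mul_right ?_ s
  rw [← NNReal.coe_le_coe]
  push_cast
  exact hK

end linear

section quadratic
variable {n : ℕ}

/-- The coefficients of the bilinear form of `symM x` as a linear form in `x`. -/
noncomputable def bilinCoeff (u v : Fin n → ℝ) (m : Pair n) : ℝ :=
  ∑ p : Fin n × Fin n with pairOf p.1 p.2 = m, u p.1 * v p.2

theorem sum_mul_symM_mulVec (x : Pair n → ℝ) (u v : Fin n → ℝ) :
    ∑ i, u i * (symM x *ᵥ v) i = ∑ m, bilinCoeff u v m * x m := by
  simp only [Matrix.mulVec, dotProduct, Finset.mul_sum]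
  rw [← Fintype.sum_prod_type', ← Finset.sum_fiberwise (s := Finset.univ)
    (g := fun p : Fin n × Fin n => pairOf p.1 p.2)]
  refine Finset.sum_congr rfl fun m _ => ?_
  rw [bilinCoeff, Finset.sum_mul]
  refine Finset.sum_congr rfl fun p hp => ?_
  rw [Finset.mem_filter] at hp
  simp only [symM, hp.2]; ring

theorem sum_bilinCoeff_sq_le (u v : Fin n → ℝ) :
    ∑ m, bilinCoeff u v m ^ 2 ≤ 2 * (l2 u ^ 2 * l2 v ^ 2) := by
  have h : ∑ i, ∑ j, (u i * v j) ^ 2 = l2 u ^ 2 * l2 v ^ 2 := by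
    rw [l2_sq, l2_sq, Finset.sum_mul_sum]
    simp only [mul_pow]
  rw [← h, ← Fintype.sum_prod_type', ← Finset.sum_fiberwise (s := Finset.univ)
    (g := fun p : Fin n × Fin n => pairOf p.1 p.2), Finset.mul_sum]
  refine Finset.sum_le_sum fun m _ => ?_
  refine (sq_sum_le_card_mul_sum_sq).trans ?_
  refine mul_le_mul_of_nonneg_right ?_ (Finset.sum_nonneg fun _ _ => sq_nonneg _)
  exact_mod_cast card_fiber_pairOf_le m

theorem lintegral_exp_bilin_le {s : ℝ≥0} {μ : Pair n → Measure ℝ}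
    [∀ i, IsProbabilityMeasure (μ i)] (hμ : ∀ i, StdSubgaussian s (μ i)) (t : ℝ)
    {u v : Fin n → ℝ} (hu : l2 u ≤ 2) (hv : l2 v ≤ 2) :
    ∫⁻ x, ENNReal.ofReal (Real.exp (t * ∑ i, u i * (symM x *ᵥ v) i)) ∂(Measure.pi μ) ≤
      ENNReal.ofReal (Real.exp (16 * s * t ^ 2)) := by
  -- The number 32 is `2 * 2 ^ 2 * 2 ^ 2`; half of it appears in the exponent of the conclusion.
  have hK : ∑ m, bilinCoeff u v m ^ 2 ≤ ((32 : ℝ≥0) : ℝ) := by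
    refine (sum_bilinCoeff_sq_le u v).trans ?_
    have h1 := pow_le_pow_left₀ (l2_nonneg u) hu 2
    have h2 := pow_le_pow_left₀ (l2_nonneg v) hv 2
    have := mul_le_mul h1 h2 (by positivity) (by positivity)
    push_cast
    linarith
  have h := hasSubgaussianMGF_linear hμ (bilinCoeff u v) hK
  simp only [sum_mul_symM_mulVec]
  rw [← ofReal_integral_eq_lintegral_ofReal (h.integrable_exp_mul t)
    (ae_of_all _ fun x => (Real.exp_pos _).le)]
  refine ENNReal.ofReal_le_ofReal ((h.mgf_le t).trans_eq ?_)
  push_cast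
  ring_nf

end quadratic

/-! ### Exponential moments of the operator norm -/

section ball
variable {E : Type*} [NormedAddCommGroup E] [InnerProductSpace ℝ E]

/-- Take `v₀` in the unit ball with `‖T v₀‖` above three quarters of the norm, and `u₀` the
direction of `T v₀`. Moving both by at most 1/8 loses at most `1/8 + 9/64` of the norm, and more
than a quarter of it remains. -/
theorem exists_half_norm_le_inner (T : E →L[ℝ] E) :
    ∃ u₀ v₀ : E, ‖u₀‖ ≤ 1 ∧ ‖v₀‖ ≤ 1 ∧ ∀ u ∈ Metric.ball u₀ (1 / 8), ∀ v ∈ Metric.ball v₀ (1 / 8),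
      ‖T‖ / 4 ≤ inner ℝ u (T v) := by
  rcases (norm_nonneg T).eq_or_lt with h0 | h0
  · refine ⟨0, 0, by simp, by simp, fun u _ v _ => ?_⟩
    rw [← h0, norm_eq_zero.1 h0.symm]; simp
  obtain ⟨v₀, hv₀, hT⟩ := T.exists_lt_apply_of_lt_opNorm (show 3 / 4 * ‖T‖ < ‖T‖ by linarith)
  have hp : 0 < ‖T v₀‖ := lt_of_le_of_lt (by positivity) hT
  refine ⟨‖T v₀‖⁻¹ • T v₀, v₀, ?_, hv₀.le, fun u hu v hv => ?_⟩
  · rw [norm_smul, norm_inv, norm_norm, inv_mul_cancel₀ hp.ne']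
  set u₀ := ‖T v₀‖⁻¹ • T v₀ with hu₀
  have hn : ‖u₀‖ = 1 := by rw [norm_smul, norm_inv, norm_norm, inv_mul_cancel₀ hp.ne']
  have h1 : inner ℝ u₀ (T v₀) = ‖T v₀‖ := by
    rw [hu₀, real_inner_smul_left, real_inner_self_eq_norm_sq, sq, inv_mul_cancel_left₀ hp.ne']
  rw [mem_ball_iff_norm] at hu hv
  have hv1 : ‖v‖ ≤ 9 / 8 := by
    have := norm_le_norm_add_norm_sub' v v₀
    linarith
  have e : inner ℝ u (T v) = inner ℝ u₀ (T v₀) + inner ℝ u₀ (T (v - v₀)) + inner ℝ (u - u₀) (T v) := by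
    rw [map_sub, inner_sub_right, inner_sub_left]; ring
  have h2 : |inner ℝ u₀ (T (v - v₀))| ≤ ‖T‖ * (1 / 8) := by
    refine (abs_real_inner_le_norm _ _).trans ?_
    rw [hn, one_mul]
    exact (T.le_opNorm _).trans (by gcongr)
  have h3 : |inner ℝ (u - u₀) (T v)| ≤ 1 / 8 * (‖T‖ * (9 / 8)) := by
    refine (abs_real_inner_le_norm _ _).trans ?_
    exact mul_le_mul hu.le ((T.le_opNorm _).trans (by gcongr)) (norm_nonneg _) (by norm_num)
  rw [e, h1]
  have := abs_le.1 h2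
  have := abs_le.1 h3
  linarith [this.1]

variable [FiniteDimensional ℝ E] [MeasurableSpace E] [BorelSpace E]

/-- A substitute for a net argument. The good pairs fill a product of two balls of radius 1/8 inside
the fixed domain of integration, and each ball of radius 2 is `16 ^ d` times larger in dimension
`d`. The domain does not depend on `T`, so the integral can be exchanged with the expectation over a
random `T`. -/
theorem exp_norm_mul_volume_le [Nontrivial E] (T : E →L[ℝ] E) {t : ℝ} (ht : 0 ≤ t)
    (ρ : Measure E) [ρ.IsAddHaarMeasure] :
    ENNReal.ofReal (Real.exp (t * (‖T‖ / 4))) *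
      (ρ (Metric.ball 0 2) * ρ (Metric.ball 0 2)) ≤
      ENNReal.ofReal (256 ^ Module.finrank ℝ E) *
        ∫⁻ p, ENNReal.ofReal (Real.exp (t * inner ℝ p.1 (T p.2)))
          ∂((ρ.restrict (Metric.ball 0 2)).prod (ρ.restrict (Metric.ball 0 2))) := by
  obtain ⟨u₀, v₀, hu₀, hv₀, h⟩ := exists_half_norm_le_inner T
  have hvol : ∀ x : E, ρ (Metric.ball 0 2) =
      ENNReal.ofReal (16 ^ Module.finrank ℝ E) * ρ (Metric.ball x (1 / 8)) := fun x => by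
    rw [ρ.addHaar_ball x (by norm_num), ρ.addHaar_ball 0 (by norm_num), ← mul_assoc,
      ← ENNReal.ofReal_mul (by positivity), ← mul_pow]
    norm_num
  have hsub : ∀ x : E, ‖x‖ ≤ 1 → Metric.ball x (1 / 8) ⊆ Metric.ball 0 2 := fun x hx =>
    Metric.ball_subset_ball' (by rw [dist_zero_right]; linarith)
  set S := Metric.ball u₀ (1 / 8) ×ˢ Metric.ball v₀ (1 / 8) with hS
  have hSm : MeasurableSet S := measurableSet_ball.prod measurableSet_ball
  have hprod : (ρ.restrict (Metric.ball 0 2)).prod (ρ.restrict (Metric.ball 0 2)) S =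
      ρ (Metric.ball u₀ (1 / 8)) * ρ (Metric.ball v₀ (1 / 8)) := by
    rw [hS, Measure.prod_prod, Measure.restrict_apply measurableSet_ball,
      Measure.restrict_apply measurableSet_ball, Set.inter_eq_left.2 (hsub _ hu₀),
      Set.inter_eq_left.2 (hsub _ hv₀)]
  calc _ = ENNReal.ofReal (256 ^ Module.finrank ℝ E) *
        (ENNReal.ofReal (Real.exp (t * (‖T‖ / 4))) *
          (ρ.restrict (Metric.ball 0 2)).prod (ρ.restrict (Metric.ball 0 2)) S) := by
        rw [hprod]
        nth_rw 1 [hvol u₀]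
        rw [hvol v₀, show (256 : ℝ) = 16 * 16 by norm_num, mul_pow,
          ENNReal.ofReal_mul (by positivity)]
        ring
    _ ≤ _ := by
        refine mul_le_mul_right ?_ _
        rw [← setLIntegral_const]
        refine (setLIntegral_mono' hSm fun p hp => ?_).trans (setLIntegral_le_lintegral S _)
        rw [hS, Set.mem_prod] at hp
        exact ENNReal.ofReal_le_ofReal (Real.exp_le_exp.2
          (mul_le_mul_of_nonneg_left (h _ hp.1 _ hp.2) ht))

end ball

section opNorm
variable {n : ℕ} {s : ℝ≥0} {μ : Pair n → Measure ℝ} [∀ i, IsProbabilityMeasure (μ i)]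

theorem measurable_opN_symM : Measurable fun x : Pair n → ℝ => opN (symM x) :=
  (continuous_opN.comp (by unfold symM; fun_prop)).measurable

theorem lintegral_exp_opN_symM_le (hn : 0 < n) (hμ : ∀ i, StdSubgaussian s (μ i)) {t : ℝ}
    (ht : 0 ≤ t) :
    ∫⁻ x, ENNReal.ofReal (Real.exp (t * (opN (symM x) / 4))) ∂(Measure.pi μ) ≤
      ENNReal.ofReal (256 ^ n * Real.exp (16 * s * t ^ 2)) := by
  have : Nonempty (Fin n) := ⟨⟨0, hn⟩⟩
  have : Nontrivial (EuclideanSpace ℝ (Fin n)) := inferInstance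
  set ρ : Measure (EuclideanSpace ℝ (Fin n)) := volume with hρ
  set V := ρ (Metric.ball 0 2) * ρ (Metric.ball 0 2) with hV
  have hb0 : ρ (Metric.ball 0 2) ≠ 0 := (Metric.measure_ball_pos ρ 0 (by norm_num)).ne'
  have hbt : ρ (Metric.ball 0 2) ≠ ⊤ := measure_ball_lt_top.ne
  have hV0 : V ≠ 0 := mul_ne_zero hb0 hb0
  have hVt : V ≠ ⊤ := ENNReal.mul_ne_top hbt hbt
  set τ := (ρ.restrict (Metric.ball 0 2)).prod (ρ.restrict (Metric.ball 0 2)) with hτ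
  have : IsFiniteMeasure (ρ.restrict (Metric.ball 0 2)) := ⟨by simpa using hbt.lt_top⟩
  have hτu : τ Set.univ = V := by
    rw [hτ, ← Set.univ_prod_univ, Measure.prod_prod]; simp [hV]
  have hinner : ∀ (x : Pair n → ℝ) (p : EuclideanSpace ℝ (Fin n) × EuclideanSpace ℝ (Fin n)),
      inner ℝ p.1 (Matrix.toEuclideanCLM (n := Fin n) (𝕜 := ℝ) (symM x) p.2) =
        ∑ i, p.1 i * (symM x *ᵥ p.2.ofLp) i := fun x p => by
    simp [PiLp.inner_apply, mul_comm, Matrix.ofLp_toEuclideanCLM]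
  rw [← ENNReal.mul_le_mul_iff_left hV0 hVt, ← lintegral_mul_const' _ _ hVt]
  have hm : Measurable (fun q : (Pair n → ℝ) × (EuclideanSpace ℝ (Fin n) × EuclideanSpace ℝ (Fin n)) =>
      ENNReal.ofReal (Real.exp (t * ∑ i, q.2.1 i * (symM q.1 *ᵥ q.2.2.ofLp) i))) := by
    simp only [Matrix.mulVec, dotProduct, symM]
    fun_prop
  calc _ ≤ ∫⁻ x, ENNReal.ofReal (256 ^ n) * ∫⁻ p, ENNReal.ofReal
          (Real.exp (t * ∑ i, p.1 i * (symM x *ᵥ p.2.ofLp) i)) ∂τ ∂(Measure.pi μ) := by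
        refine lintegral_mono fun x => ?_
        have := exp_norm_mul_volume_le (Matrix.toEuclideanCLM (n := Fin n) (𝕜 := ℝ) (symM x)) ht ρ
        simp only [hinner, finrank_euclideanSpace, Fintype.card_fin] at this
        exact this
    _ = ENNReal.ofReal (256 ^ n) * ∫⁻ p, ∫⁻ x, ENNReal.ofReal
          (Real.exp (t * ∑ i, p.1 i * (symM x *ᵥ p.2.ofLp) i)) ∂(Measure.pi μ) ∂τ := by
        rw [lintegral_const_mul' _ _ ENNReal.ofReal_ne_top, lintegral_lintegral_swap]
        exact hm.aemeasurable
    _ ≤ ENNReal.ofReal (256 ^ n) * ∫⁻ _, ENNReal.ofReal (Real.exp (16 * s * t ^ 2)) ∂τ := by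
        refine mul_le_mul_right ?_ _
        refine lintegral_mono_ae ?_
        have hmem : ∀ᵐ p ∂τ, p ∈ Metric.ball (0 : EuclideanSpace ℝ (Fin n)) 2 ×ˢ
            Metric.ball (0 : EuclideanSpace ℝ (Fin n)) 2 := by
          rw [hτ, Measure.prod_restrict]
          exact ae_restrict_mem (measurableSet_ball.prod measurableSet_ball)
        filter_upwards [hmem] with p hp
        rw [Set.mem_prod, mem_ball_zero_iff, mem_ball_zero_iff] at hp
        exact lintegral_exp_bilin_le hμ t hp.1.le hp.2.le
    _ = _ := by
        rw [lintegral_const, hτu, ← mul_assoc, ← ENNReal.ofReal_mul (by positivity)]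

/-- A bound for an exponential moment of the rescaled operator norm. -/
noncomputable def expOpBound (s : ℝ≥0) : ℝ := 2 * Real.exp (Real.log 256 + 16 * s)

/-- Let `y` be the rescaled norm divided by 4. The previous bound at `t = √n` says that `exp (n *
y)` has mean at most `exp (n * c)`. The passage to `exp y` is pointwise: if `y ≥ c` then `y ≤ c + n
* (y - c)`. -/
theorem lintegral_exp_opN_div_le (hn : 0 < n) (hμ : ∀ i, StdSubgaussian s (μ i)) :
    ∫⁻ x, ENNReal.ofReal (Real.exp ((√(n : ℝ))⁻¹ * opN (symM x) / 4)) ∂(Measure.pi μ) ≤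
      ENNReal.ofReal (expOpBound s) := by
  set c := Real.log 256 + 16 * s with hc
  have hn' : (0 : ℝ) < n := by exact_mod_cast hn
  have hpt : ∀ x : Pair n → ℝ, ENNReal.ofReal (Real.exp ((√(n : ℝ))⁻¹ * opN (symM x) / 4)) ≤
      ENNReal.ofReal (Real.exp c) + ENNReal.ofReal (Real.exp (c - n * c)) *
        ENNReal.ofReal (Real.exp (√(n : ℝ) * (opN (symM x) / 4))) := fun x => by
    rw [← ENNReal.ofReal_mul (Real.exp_pos _).le, ← ENNReal.ofReal_add (Real.exp_pos _).le
      (by positivity), ← Real.exp_add]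
    refine ENNReal.ofReal_le_ofReal ?_
    set y := (√(n : ℝ))⁻¹ * opN (symM x) / 4 with hy
    have hyn : √(n : ℝ) * (opN (symM x) / 4) = n * y := by
      rw [hy]
      have hs : (0 : ℝ) < √n := Real.sqrt_pos.2 hn'
      have := Real.mul_self_sqrt hn'.le
      field_simp
      linear_combination (opN (symM x)) * this
    rw [hyn]
    rcases le_total y c with h | h
    · exact (Real.exp_le_exp.2 h).trans (le_add_of_nonneg_right (Real.exp_pos _).le)
    · refine (Real.exp_le_exp.2 ?_).trans (le_add_of_nonneg_left (Real.exp_pos _).le)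
      have h1 : (1 : ℝ) ≤ n := by exact_mod_cast hn
      nlinarith
  refine (lintegral_mono hpt).trans ?_
  rw [lintegral_add_left measurable_const, lintegral_const_mul' _ _ ENNReal.ofReal_ne_top,
    lintegral_const, measure_univ, mul_one]
  refine (add_le_add_right (mul_le_mul_right
    (lintegral_exp_opN_symM_le hn hμ (Real.sqrt_nonneg _)) _) _).trans ?_
  rw [← ENNReal.ofReal_mul (Real.exp_pos _).le, ← ENNReal.ofReal_add (Real.exp_pos _).le
    (by positivity)]
  refine ENNReal.ofReal_le_ofReal (le_of_eq ?_)
  have h256 : (256 : ℝ) ^ n = Real.exp (n * Real.log 256) := by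
    rw [Real.exp_nat_mul, Real.exp_log (by norm_num)]
  rw [h256, ← Real.exp_add, ← Real.exp_add, Real.sq_sqrt hn'.le, expOpBound, ← hc,
    show c - n * c + (n * Real.log 256 + 16 * s * n) = c by rw [hc]; ring]
  ring

theorem integrable_exp_opN_div (hn : 0 < n) (hμ : ∀ i, StdSubgaussian s (μ i)) :
    Integrable (fun x => Real.exp ((√(n : ℝ))⁻¹ * opN (symM x) / 4)) (Measure.pi μ) := by
  refine ⟨((measurable_opN_symM.const_mul _).div_const _).exp.aestronglyMeasurable, ?_⟩
  rw [hasFiniteIntegral_iff_ofReal (ae_of_all _ fun x => (Real.exp_pos _).le)]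
  exact (lintegral_exp_opN_div_le hn hμ).trans_lt ENNReal.ofReal_lt_top

theorem integral_exp_opN_div_le (hn : 0 < n) (hμ : ∀ i, StdSubgaussian s (μ i)) :
    ∫ x, Real.exp ((√(n : ℝ))⁻¹ * opN (symM x) / 4) ∂(Measure.pi μ) ≤ expOpBound s := by
  have hb : 0 ≤ expOpBound s := by unfold expOpBound; positivity
  rw [← ENNReal.ofReal_le_ofReal_iff hb, ofReal_integral_eq_lintegral_ofReal
    (integrable_exp_opN_div hn hμ) (ae_of_all _ fun x => (Real.exp_pos _).le)]
  exact lintegral_exp_opN_div_le hn hμ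

/-- A bound for the moments of `1 + opN (hatMatrix (symM x) Z)`, when `opN Z ≤ K * n`. -/
noncomputable def opMoment (s : ℝ≥0) (K : ℝ) (r : ℕ) : ℝ :=
  4 ^ r * r.factorial * Real.exp ((1 + K) / 4) * expOpBound s

variable {Z : Matrix (Fin n) (Fin n) ℝ} {K : ℝ}

theorem opMoment_nonneg (s : ℝ≥0) (K : ℝ) (r : ℕ) : 0 ≤ opMoment s K r := by
  unfold opMoment expOpBound; positivity

theorem opN_hatMatrix_symM_le (hZ : (n : ℝ)⁻¹ * opN Z ≤ K) (x : Pair n → ℝ) :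
    opN (hatMatrix (symM x) Z) ≤ (√(n : ℝ))⁻¹ * opN (symM x) + K := by
  refine (opN_add _ _).trans ?_
  rw [opN_smul, opN_smul, abs_of_nonneg (by positivity), abs_of_nonneg (by positivity)]
  linarith

theorem measurable_opN_hatMatrix_symM :
    Measurable fun x : Pair n → ℝ => opN (hatMatrix (symM x) Z) :=
  (continuous_opN.comp (by unfold hatMatrix symM; fun_prop)).measurable

theorem one_add_opN_pow_le (hZ : (n : ℝ)⁻¹ * opN Z ≤ K) (r : ℕ) (x : Pair n → ℝ) :
    (1 + opN (hatMatrix (symM x) Z)) ^ r ≤ 4 ^ r * r.factorial * Real.exp ((1 + K) / 4) *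
      Real.exp ((√(n : ℝ))⁻¹ * opN (symM x) / 4) := by
  have h := opN_hatMatrix_symM_le hZ x
  have h0 := opN_nonneg (hatMatrix (symM x) Z)
  set q := 1 + opN (hatMatrix (symM x) Z) with hq
  have h1 := Real.pow_div_factorial_le_exp (q / 4) (by positivity) r
  have hf : (0 : ℝ) < r.factorial := by exact_mod_cast Nat.factorial_pos r
  rw [div_le_iff₀ hf, div_pow, div_le_iff₀ (by positivity)] at h1
  refine h1.trans ?_
  rw [mul_assoc (_ * _), ← Real.exp_add]
  have h2 : Real.exp (q / 4) ≤ Real.exp ((1 + K) / 4 + (√(n : ℝ))⁻¹ * opN (symM x) / 4) :=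
    Real.exp_le_exp.2 (by linarith)
  calc Real.exp (q / 4) * r.factorial * 4 ^ r = 4 ^ r * r.factorial * Real.exp (q / 4) := by ring
    _ ≤ _ := mul_le_mul_of_nonneg_left h2 (by positivity)

theorem integrable_one_add_opN_pow (hn : 0 < n) (hμ : ∀ i, StdSubgaussian s (μ i))
    (hZ : (n : ℝ)⁻¹ * opN Z ≤ K) (r : ℕ) :
    Integrable (fun x => (1 + opN (hatMatrix (symM x) Z)) ^ r) (Measure.pi μ) := by
  refine ((integrable_exp_opN_div hn hμ).const_mul
    (4 ^ r * r.factorial * Real.exp ((1 + K) / 4))).mono'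
    ((measurable_opN_hatMatrix_symM.const_add 1).pow_const r).aestronglyMeasurable
    (ae_of_all _ fun x => ?_)
  have h0 := opN_nonneg (hatMatrix (symM x) Z)
  rw [Real.norm_eq_abs, abs_of_nonneg (by positivity)]
  exact one_add_opN_pow_le hZ r x

theorem integral_one_add_opN_pow_le (hn : 0 < n) (hμ : ∀ i, StdSubgaussian s (μ i))
    (hZ : (n : ℝ)⁻¹ * opN Z ≤ K) (r : ℕ) :
    ∫ x, (1 + opN (hatMatrix (symM x) Z)) ^ r ∂(Measure.pi μ) ≤ opMoment s K r := by
  refine (integral_mono (integrable_one_add_opN_pow hn hμ hZ r)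
    ((integrable_exp_opN_div hn hμ).const_mul
      (4 ^ r * r.factorial * Real.exp ((1 + K) / 4))) fun x => one_add_opN_pow_le hZ r x).trans ?_
  rw [integral_const_mul]
  exact mul_le_mul_of_nonneg_left (integral_exp_opN_div_le hn hμ) (by positivity)

/-- This is the growth condition on `ℓ` required by the comparison and variance bounds. -/
theorem one_add_opN_update_le (x : Pair n → ℝ) (m : Pair n) (t : ℝ) :
    1 + opN (hatMatrix (symM (Function.update x m t)) Z) ≤
      1 + opN (hatMatrix (symM x) Z) + |t| + |x m| := by
  have hn : (1 : ℝ) ≤ n := by exact_mod_cast m.1.1.pos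
  have h1 : opN (unitM m) ≤ 1 := (opN_unitM_le m).trans
    (inv_le_one_of_one_le₀ (Real.one_le_sqrt.2 hn))
  have h2 : |t - x m| * opN (unitM m) ≤ |t| + |x m| :=
    (mul_le_of_le_one_right (abs_nonneg _) h1).trans (abs_sub _ _)
  rw [hatMatrix_symM_update]
  have h3 := opN_add (hatMatrix (symM x) Z) ((t - x m) • unitM m)
  rw [opN_smul] at h3
  linarith

theorem measureReal_lt_opN_le (hn : 0 < n) (hμ : ∀ i, StdSubgaussian s (μ i))
    (hZ : (n : ℝ)⁻¹ * opN Z ≤ K) {a : ℝ} (ha : 0 < a) :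
    (Measure.pi μ).real {x | a < opN (hatMatrix (symM x) Z)} ≤ opMoment s K 1 / a := by
  have h := mul_meas_ge_le_integral_of_nonneg (μ := Measure.pi μ)
    (f := fun x => (1 + opN (hatMatrix (symM x) Z)) ^ 1)
    (ae_of_all _ fun x => by have := opN_nonneg (hatMatrix (symM x) Z); positivity)
    (integrable_one_add_opN_pow hn hμ hZ 1) a
  rw [le_div_iff₀ ha, mul_comm]
  refine (mul_le_mul_of_nonneg_left (measureReal_mono fun x hx => ?_) ha.le).trans
    (h.trans (integral_one_add_opN_pow_le hn hμ hZ 1))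
  have : a < opN (hatMatrix (symM x) Z) := hx
  simp only [Set.mem_ofPred_eq, pow_one]
  linarith

end opNorm

end GenAMP

namespace GenAMP

/-! ### Growth and stability of orbits of Lipschitz functions -/

/-- The argument `(a, f (k-1), …, f 0)` of the `k`-th function of an orbit. -/
def orbitArg (k : ℕ) (a : ℝ) (f : ℕ → ℝ) : Fin (k + 1) → ℝ := fun j => if (j : ℕ) = k then a else f j

theorem orbit_succ' {n : ℕ} (F : (k : ℕ) → (Fin (k + 1) → ℝ) → ℝ)
    (M : Matrix (Fin n) (Fin n) ℝ) (u0 : Fin n → ℝ) (k : ℕ) (i : Fin n) :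
    orbit F M u0 (k + 1) i =
      F k (orbitArg k ((M *ᵥ orbit F M u0 k) i) fun j => orbit F M u0 j i) :=
  orbit_succ F M u0 k i

theorem norm_orbitArg_sub_le (k : ℕ) (a b : ℝ) (f h : ℕ → ℝ) :
    ‖orbitArg k a f - orbitArg k b h‖ ≤ |a - b| + ∑ j ∈ Finset.range k, |f j - h j| := by
  refine (norm_pi_le_sum _).trans_eq ?_
  rw [Fin.sum_univ_castSucc, add_comm, Finset.sum_range]
  simp only [orbitArg, Pi.sub_apply, Fin.val_last, if_true, Fin.val_castSucc]
  congr 1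
  refine Finset.sum_congr rfl fun j _ => ?_
  rw [if_neg j.2.ne, if_neg j.2.ne]

theorem norm_orbitArg_le (k : ℕ) (a : ℝ) (f : ℕ → ℝ) :
    ‖orbitArg k a f‖ ≤ |a| + ∑ j ∈ Finset.range k, |f j| := by
  have h := norm_orbitArg_sub_le k a 0 f 0
  have h0 : orbitArg k 0 0 = 0 := by funext j; simp [orbitArg]
  simpa [h0] using h

section lipschitz
variable {k n : ℕ} {g : (Fin (k + 1) → ℝ) → ℝ} {L : ℝ≥0}

theorem abs_lipschitz_sub_le (hg : LipschitzWith L g) (a b : ℝ) (f h : ℕ → ℝ) :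
    |g (orbitArg k a f) - g (orbitArg k b h)| ≤
      L * (|a - b| + ∑ j ∈ Finset.range k, |f j - h j|) :=
  (hg.norm_sub_le _ _).trans (mul_le_mul_of_nonneg_left (norm_orbitArg_sub_le k a b f h) L.2)

theorem abs_lipschitz_le (hg : LipschitzWith L g) (a : ℝ) (f : ℕ → ℝ) :
    |g (orbitArg k a f)| ≤ |g 0| + L * (|a| + ∑ j ∈ Finset.range k, |f j|) := by
  have h := (hg.norm_sub_le (orbitArg k a f) 0).trans (mul_le_mul_of_nonneg_left
    (by simpa using norm_orbitArg_le k a f) L.2)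
  have h2 := abs_sub_abs_le_abs_sub (g (orbitArg k a f)) (g 0)
  rw [Real.norm_eq_abs] at h
  exact (sub_le_iff_le_add'.1 (h2.trans h))

theorem l2_lipschitz_sub_le (hg : LipschitzWith L g) (a b : Fin n → ℝ) (f h : ℕ → Fin n → ℝ) :
    l2 (fun i => g (orbitArg k (a i) fun j => f j i) - g (orbitArg k (b i) fun j => h j i)) ≤
      L * (l2 (fun i => a i - b i) + ∑ j ∈ Finset.range k, l2 (fun i => f j i - h j i)) := by
  calc _ ≤ l2 (fun i => (L : ℝ) * (|a i - b i| + ∑ j ∈ Finset.range k, |f j i - h j i|)) :=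
        l2_mono_of_le fun i => abs_lipschitz_sub_le hg _ _ _ _
    _ = L * l2 (fun i => |a i - b i| + ∑ j ∈ Finset.range k, |f j i - h j i|) := by
        rw [l2_smul, NNReal.abs_eq]
    _ ≤ _ := by
        refine mul_le_mul_of_nonneg_left ((l2_add _ _).trans (add_le_add ?_ ?_)) L.2
        · rw [l2_abs]
        · refine (l2_sum _ _).trans (Finset.sum_le_sum fun j _ => ?_)
          rw [l2_abs]

theorem l2_lipschitz_le (hg : LipschitzWith L g) (a : Fin n → ℝ) (f : ℕ → Fin n → ℝ) :
    l2 (fun i => g (orbitArg k (a i) fun j => f j i)) ≤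
      √n * |g 0| + L * (l2 a + ∑ j ∈ Finset.range k, l2 (f j)) := by
  have h := l2_lipschitz_sub_le hg a 0 f 0
  have h0 : orbitArg k 0 (fun _ => 0) = 0 := by funext j; simp [orbitArg]
  simp only [Pi.zero_apply, h0, sub_zero] at h
  calc _ = l2 (fun i => g 0 + (g (orbitArg k (a i) fun j => f j i) - g 0)) := by simp
    _ ≤ _ := (l2_add _ _).trans (add_le_add (by simp [l2_const]) h)

end lipschitz

section orbit
variable {F : (k : ℕ) → (Fin (k + 1) → ℝ) → ℝ} {L : ℕ → ℝ≥0}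

theorem exists_l2_orbit_le (hF : ∀ k, LipschitzWith (L k) (F k)) {K a : ℝ} (hK : 0 ≤ K)
    (ha : 0 ≤ a) (k : ℕ) :
    ∃ C, 0 ≤ C ∧ ∀ (n : ℕ) (M : Matrix (Fin n) (Fin n) ℝ) (u0 : Fin n → ℝ), opN M ≤ K →
      l2 u0 ≤ a * √n → ∀ j ≤ k, l2 (orbit F M u0 j) ≤ C * √n := by
  induction k with
  | zero =>
    refine ⟨a, ha, fun n M u0 _ h j hj => ?_⟩
    rw [Nat.le_zero.1 hj, orbit_zero]; exact h
  | succ k ih =>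
    obtain ⟨C, hC, h⟩ := ih
    refine ⟨C + (|F k 0| + L k * (K * C + k * C)), by positivity, fun n M u0 hM hu j hj => ?_⟩
    have hL : (0 : ℝ) ≤ L k := (L k).2
    have hs : 0 ≤ √(n : ℝ) := Real.sqrt_nonneg _
    rcases Nat.of_le_succ hj with hj | rfl
    · refine (h n M u0 hM hu j hj).trans ?_
      gcongr
      exact le_add_of_nonneg_right (by positivity)
    · have e : orbit F M u0 (k + 1) = fun i =>
          F k (orbitArg k ((M *ᵥ orbit F M u0 k) i) fun j => orbit F M u0 j i) :=
        funext fun i => orbit_succ' F M u0 k i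
      rw [e]
      refine (l2_lipschitz_le (hF k) _ _).trans ?_
      have h1 : l2 (M *ᵥ orbit F M u0 k) ≤ K * (C * √n) :=
        (l2_mulVec_le M _).trans (mul_le_mul hM (h n M u0 hM hu k le_rfl) (l2_nonneg _) hK)
      have h2 : ∑ j ∈ Finset.range k, l2 (orbit F M u0 j) ≤ k * (C * √n) := by
        refine (Finset.sum_le_card_nsmul _ _ _ fun j hj =>
          h n M u0 hM hu j (Finset.mem_range.1 hj).le).trans_eq ?_
        simp
      have h3 : L k * (l2 (M *ᵥ orbit F M u0 k) + ∑ j ∈ Finset.range k, l2 (orbit F M u0 j)) ≤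
          L k * (K * (C * √n) + k * (C * √n)) := by gcongr
      have h4 : 0 ≤ C * √n := by positivity
      change √n * |F k 0| + L k * (l2 (M *ᵥ orbit F M u0 k) +
        ∑ j ∈ Finset.range k, l2 (orbit F M u0 j)) ≤ _
      linarith

end orbit

/-! ### Removing a row and a column -/

/-- The matrix `M` with the `i`-th row and column replaced by zero. -/
def cavity {n : ℕ} (i : Fin n) (M : Matrix (Fin n) (Fin n) ℝ) : Matrix (Fin n) (Fin n) ℝ :=
  fun a b => if a = i ∨ b = i then 0 else M a b

section cavity
variable {n : ℕ} (i : Fin n) (M : Matrix (Fin n) (Fin n) ℝ)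

theorem cavity_mulVec_self (v : Fin n → ℝ) : (cavity i M *ᵥ v) i = 0 := by
  simp [cavity, Matrix.mulVec, dotProduct]

theorem cavity_mulVec_of_ne (v : Fin n → ℝ) {l : Fin n} (hl : l ≠ i) :
    (cavity i M *ᵥ v) l = (M *ᵥ Function.update v i 0) l := by
  simp only [Matrix.mulVec, dotProduct, cavity]
  refine Finset.sum_congr rfl fun j _ => ?_
  by_cases hj : j = i
  · subst hj; simp
  · simp [hl, hj]

theorem l2_update_zero_le (v : Fin n → ℝ) : l2 (Function.update v i 0) ≤ l2 v :=
  l2_mono fun j => by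
    by_cases hj : j = i
    · subst hj; simp
    · simp [hj]

theorem l2_single (a : ℝ) : l2 (Pi.single i a) = |a| := by
  rw [l2_eq_sqrt, Finset.sum_eq_single i]
  · simp [Real.sqrt_sq_eq_abs]
  · intro j _ hj; simp [hj]
  · simp

theorem opN_cavity_le : opN (cavity i M) ≤ opN M := by
  refine opN_le _ (opN_nonneg _) fun v => ?_
  calc l2 (cavity i M *ᵥ v) ≤ l2 (M *ᵥ Function.update v i 0) := l2_mono fun l => by
        by_cases hl : l = i
        · subst hl; rw [cavity_mulVec_self, abs_zero]; exact abs_nonneg _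
        · rw [cavity_mulVec_of_ne i M v hl]
    _ ≤ opN M * l2 v := (l2_mulVec_le M _).trans
        (mul_le_mul_of_nonneg_left (l2_update_zero_le i v) (opN_nonneg M))

/-- At the site `i` the whole field is lost; at the other sites only the contribution of `v i`
through the `i`-th column is. -/
theorem l2_mulVec_sub_cavity_le (v : Fin n → ℝ) :
    l2 (fun l => (M *ᵥ v) l - (cavity i M *ᵥ v) l) ≤ |(M *ᵥ v) i| + opN M * |v i| := by
  have e : v = Function.update v i 0 + Pi.single i (v i) := by
    funext j
    by_cases hj : j = i
    · subst hj; simp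
    · simp [hj]
  calc _ ≤ l2 (fun l => |(Pi.single i ((M *ᵥ v) i) : Fin n → ℝ) l| + |(M *ᵥ Pi.single i (v i)) l|) :=
        l2_mono_of_le fun l => by
          by_cases hl : l = i
          · subst hl; rw [cavity_mulVec_self]; simp; positivity
          · rw [cavity_mulVec_of_ne i M v hl]
            have : (M *ᵥ v) l = (M *ᵥ Function.update v i 0) l + (M *ᵥ Pi.single i (v i)) l := by
              nth_rw 1 [e]; rw [Matrix.mulVec_add]; rfl
            rw [this, add_sub_cancel_left]
            exact le_add_of_nonneg_left (abs_nonneg _)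
    _ ≤ _ := (l2_add _ _).trans (add_le_add (by rw [l2_abs, l2_single])
        (by rw [l2_abs, ← l2_single i (v i)]; exact l2_mulVec_le M _))

variable {F : (k : ℕ) → (Fin (k + 1) → ℝ) → ℝ} {L : ℕ → ℝ≥0}

/-- With its row erased, the site `i` evolves from its own past alone. Therefore the constant does
not involve the matrix. -/
theorem exists_abs_cavity_orbit_le (hF : ∀ k, LipschitzWith (L k) (F k)) (k : ℕ) :
    ∃ C, 0 ≤ C ∧ ∀ (n : ℕ) (i : Fin n) (M : Matrix (Fin n) (Fin n) ℝ) (u0 : Fin n → ℝ),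
      ∀ j ≤ k, |orbit F (cavity i M) u0 j i| ≤ C * (1 + |u0 i|) := by
  induction k with
  | zero =>
    refine ⟨1, zero_le_one, fun n i M u0 j hj => ?_⟩
    rw [Nat.le_zero.1 hj, orbit_zero]; linarith
  | succ k ih =>
    obtain ⟨C, hC, h⟩ := ih
    have hL : (0 : ℝ) ≤ L k := (L k).2
    refine ⟨C + (|F k 0| + L k * (k * C)), by positivity, fun n i M u0 j hj => ?_⟩
    have h0 := abs_nonneg (u0 i)
    rcases Nat.of_le_succ hj with hj | rfl
    · refine (h n i M u0 j hj).trans ?_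
      gcongr
      exact le_add_of_nonneg_right (by positivity)
    · rw [orbit_succ', cavity_mulVec_self]
      refine (abs_lipschitz_le (hF k) _ _).trans ?_
      have h2 : ∑ j ∈ Finset.range k, |orbit F (cavity i M) u0 j i| ≤ k * (C * (1 + |u0 i|)) := by
        refine (Finset.sum_le_card_nsmul _ _ _ fun j hj =>
          h n i M u0 j (Finset.mem_range.1 hj).le).trans_eq ?_
        simp
      have h3 : L k * (|(0 : ℝ)| + ∑ j ∈ Finset.range k, |orbit F (cavity i M) u0 j i|) ≤
          L k * (k * (C * (1 + |u0 i|))) := by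
        rw [abs_zero, zero_add]; gcongr
      have h4 : 0 ≤ |F k 0| * |u0 i| := by positivity
      have h5 : 0 ≤ C * (1 + |u0 i|) := by positivity
      linarith

/-- The field created at the site `i` by the orbits of the matrix without the site `i`. -/
noncomputable def cavityField (F : (k : ℕ) → (Fin (k + 1) → ℝ) → ℝ) (u0 : Fin n → ℝ) (j : ℕ) : ℝ :=
  (M *ᵥ orbit F (cavity i M) u0 j) i

/-- Removing a site perturbs the next field by the cavity field at `i` and by the cavity orbit at
`i`; earlier perturbations are carried on by Lipschitz functions and a bounded operator. So the
effect on the whole orbit is controlled by quantities at the site `i`. -/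
theorem exists_l2_orbit_sub_cavity_le (hF : ∀ k, LipschitzWith (L k) (F k)) {K : ℝ} (hK : 0 ≤ K)
    (k : ℕ) :
    ∃ C, 0 ≤ C ∧ ∀ (n : ℕ) (i : Fin n) (M : Matrix (Fin n) (Fin n) ℝ) (u0 : Fin n → ℝ),
      opN M ≤ K → ∀ j ≤ k, l2 (fun l => orbit F M u0 j l - orbit F (cavity i M) u0 j l) ≤
        C * (1 + |u0 i| + ∑ a ∈ Finset.range k, |cavityField i M F u0 a|) := by
  induction k with
  | zero =>
    refine ⟨0, le_rfl, fun n i M u0 hM j hj => ?_⟩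
    rw [Nat.le_zero.1 hj, orbit_zero, orbit_zero]
    simp [l2_zero]
  | succ k ih =>
    obtain ⟨C, hC, h⟩ := ih
    obtain ⟨C₁, hC₁, h₁⟩ := exists_abs_cavity_orbit_le hF k
    have hL : (0 : ℝ) ≤ L k := (L k).2
    refine ⟨C + L k * (K * C + 1 + K * C₁ + k * C), by positivity, fun n i M u0 hM j hj => ?_⟩
    have h0 := abs_nonneg (u0 i)
    rw [Finset.sum_range_succ]
    set S := ∑ a ∈ Finset.range k, |cavityField i M F u0 a| with hS
    have hS0 : 0 ≤ S := Finset.sum_nonneg fun _ _ => abs_nonneg _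
    have hf0 := abs_nonneg (cavityField i M F u0 k)
    set X := 1 + |u0 i| + (S + |cavityField i M F u0 k|) with hX
    have hXC : C * (1 + |u0 i| + S) ≤ C * X := by gcongr; linarith
    rcases Nat.of_le_succ hj with hj | rfl
    · refine ((h n i M u0 hM j hj).trans hXC).trans ?_
      gcongr
      exact le_add_of_nonneg_right (by positivity)
    · simp only [orbit_succ']
      refine (l2_lipschitz_sub_le (hF k) _ _ _ _).trans ?_
      set u := orbit F M u0
      set v := orbit F (cavity i M) u0
      have hD : ∀ j ≤ k, l2 (fun l => u j l - v j l) ≤ C * X := fun j hj =>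
        (h n i M u0 hM j hj).trans hXC
      have h2 : ∑ j ∈ Finset.range k, l2 (fun l => u j l - v j l) ≤ k * (C * X) := by
        refine (Finset.sum_le_card_nsmul _ _ _ fun j hj =>
          hD j (Finset.mem_range.1 hj).le).trans_eq ?_
        simp
      have h3 : l2 (fun l => (M *ᵥ u k) l - (cavity i M *ᵥ v k) l) ≤
          K * (C * X) + (X + K * (C₁ * X)) := by
        calc _ = l2 (fun l => (M *ᵥ (fun l => u k l - v k l)) l +
              ((M *ᵥ v k) l - (cavity i M *ᵥ v k) l)) := by
              congr 1; funext l
              have : (M *ᵥ (fun l => u k l - v k l)) = M *ᵥ u k - M *ᵥ v k := by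
                rw [← Matrix.mulVec_sub]; rfl
              rw [this]; simp
          _ ≤ _ := by
              refine (l2_add _ _).trans (add_le_add ?_ ?_)
              · exact (l2_mulVec_le M _).trans (mul_le_mul hM (hD k le_rfl) (l2_nonneg _) hK)
              · refine (l2_mulVec_sub_cavity_le i M (v k)).trans (add_le_add ?_ ?_)
                · change |cavityField i M F u0 k| ≤ _
                  linarith
                · refine mul_le_mul hM ((h₁ n i M u0 k le_rfl).trans ?_) (abs_nonneg _) hK
                  gcongr; linarith
      calc _ ≤ L k * (K * (C * X) + (X + K * (C₁ * X)) + k * (C * X)) := by gcongr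
        _ ≤ _ := by
          have : 0 ≤ C * X := by positivity
          linarith

/-- A coordinate of a vector is at most its Euclidean norm, so the comparison of the two orbits
transfers to the site `i`. For the field, `M u` differs from the cavity field by `M` applied to the
difference of the orbits. -/
theorem exists_abs_orbit_le_cavityField (hF : ∀ k, LipschitzWith (L k) (F k)) {K : ℝ} (hK : 0 ≤ K)
    (k : ℕ) :
    ∃ C, 0 ≤ C ∧ ∀ (n : ℕ) (i : Fin n) (M : Matrix (Fin n) (Fin n) ℝ) (u0 : Fin n → ℝ),
      opN M ≤ K → |orbit F M u0 k i| ≤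
          C * (1 + |u0 i| + ∑ a ∈ Finset.range (k + 1), |cavityField i M F u0 a|) ∧
        |(M *ᵥ orbit F M u0 k) i| ≤
          C * (1 + |u0 i| + ∑ a ∈ Finset.range (k + 1), |cavityField i M F u0 a|) := by
  obtain ⟨C, hC, h⟩ := exists_l2_orbit_sub_cavity_le hF hK k
  obtain ⟨C₁, hC₁, h₁⟩ := exists_abs_cavity_orbit_le hF k
  refine ⟨C + C₁ + K * C + 1, by positivity, fun n i M u0 hM => ?_⟩
  have h0 := abs_nonneg (u0 i)
  rw [Finset.sum_range_succ]
  have hh := h n i M u0 hM k le_rfl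
  have hh₁ := h₁ n i M u0 k le_rfl
  set S := ∑ a ∈ Finset.range k, |cavityField i M F u0 a| with hS
  have hS0 : 0 ≤ S := Finset.sum_nonneg fun _ _ => abs_nonneg _
  have hf0 := abs_nonneg (cavityField i M F u0 k)
  set X := 1 + |u0 i| + (S + |cavityField i M F u0 k|) with hX
  have hXC : C * (1 + |u0 i| + S) ≤ C * X := by gcongr; linarith
  have hXC₁ : C₁ * (1 + |u0 i|) ≤ C₁ * X := by gcongr; linarith
  have hX0 : 0 ≤ X := by positivity
  have hKX : 0 ≤ K * (C * X) := by positivity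
  set u := orbit F M u0 k
  set v := orbit F (cavity i M) u0 k
  constructor
  · have h1 := abs_le_l2 (fun l => u l - v l) i
    have h2 := abs_sub_abs_le_abs_sub (u i) (v i)
    nlinarith
  · have h1 := abs_le_l2 (M *ᵥ (fun l => u l - v l)) i
    have h2 := (l2_mulVec_le M (fun l => u l - v l)).trans
      (mul_le_mul hM (hh.trans hXC) (l2_nonneg _) hK)
    have h3 : (M *ᵥ (fun l => u l - v l)) i = (M *ᵥ u) i - cavityField i M F u0 k := by
      have : (M *ᵥ (fun l => u l - v l)) = M *ᵥ u - M *ᵥ v := by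
        rw [← Matrix.mulVec_sub]; rfl
      rw [this]; rfl
    rw [h3] at h1
    have h4 := abs_sub_abs_le_abs_sub ((M *ᵥ u) i) (cavityField i M F u0 k)
    have h5 : |cavityField i M F u0 k| ≤ X := by linarith
    have h6 : 0 ≤ C * X := by positivity
    have h7 : 0 ≤ C₁ * X := by positivity
    linarith

end cavity

end GenAMP

namespace GenAMP

/-! ### Fourth moments along orbits of Lipschitz functions -/

theorem continuous_orbit {n : ℕ} {F : (k : ℕ) → (Fin (k + 1) → ℝ) → ℝ} (hF : ∀ k, Continuous (F k))
    (k : ℕ) :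
    Continuous fun p : Matrix (Fin n) (Fin n) ℝ × (Fin n → ℝ) => orbit F p.1 p.2 k := by
  induction k using Nat.strong_induction_on with
  | _ k ih =>
    cases k with
    | zero => simp only [orbit_zero]; exact continuous_snd
    | succ k =>
      refine continuous_pi fun i => ?_
      simp only [orbit_succ']
      refine (hF k).comp (continuous_pi fun j => ?_)
      simp only [orbitArg]
      split_ifs with hj
      · have := continuous_fst.matrix_mulVec (ih k k.lt_succ_self)
        exact (continuous_apply i).comp this
      · exact (continuous_apply i).comp (ih j (by omega))

/-- The initial vector and the signal have bounded empirical fourth moments. -/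
structure GoodData {n : ℕ} (κ : ℝ) (u0 : Fin n → ℝ) (Z : Matrix (Fin n) (Fin n) ℝ) : Prop where
  init : ∑ i, u0 i ^ 4 ≤ κ * n
  signal : ∑ i, ∑ j, Z i j ^ 4 ≤ κ * n ^ 2

section goodData
variable {n : ℕ} {κ : ℝ} {u0 : Fin n → ℝ} {Z : Matrix (Fin n) (Fin n) ℝ}

theorem sq_le_one_add_pow_four (t : ℝ) : t ^ 2 ≤ 1 + t ^ 4 := by
  nlinarith [sq_nonneg (t ^ 2 - 1), sq_nonneg t]

theorem GoodData.l2_init_le (h : GoodData κ u0 Z) (hκ : 0 ≤ κ) : l2 u0 ≤ (1 + κ) * √n := by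
  refine l2_le_of_sum_sq_le (by positivity) ?_
  rw [mul_pow, Real.sq_sqrt (Nat.cast_nonneg n)]
  have h1 : ∑ i, u0 i ^ 2 ≤ n + κ * n := by
    refine (Finset.sum_le_sum fun i _ => sq_le_one_add_pow_four (u0 i)).trans ?_
    rw [Finset.sum_add_distrib]
    simpa using h.init
  have : (0 : ℝ) ≤ n := Nat.cast_nonneg n
  nlinarith [mul_nonneg hκ this, mul_nonneg (mul_nonneg hκ hκ) this]

theorem GoodData.opN_signal_le (h : GoodData κ u0 Z) (hκ : 0 ≤ κ) :
    (n : ℝ)⁻¹ * opN Z ≤ 1 + κ := by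
  rcases Nat.eq_zero_or_pos n with rfl | hn
  · simp; linarith
  have hn' : (0 : ℝ) < n := by exact_mod_cast hn
  rw [inv_mul_le_iff₀ hn']
  refine (opN_le_frobenius Z).trans (Real.sqrt_le_iff.2 ⟨by positivity, ?_⟩)
  have h1 : ∑ i, ∑ j, Z i j ^ 2 ≤ (n : ℝ) ^ 2 + κ * n ^ 2 := by
    refine (Finset.sum_le_sum fun i _ => Finset.sum_le_sum fun j _ =>
      sq_le_one_add_pow_four (Z i j)).trans ?_
    simp only [Finset.sum_add_distrib]
    have := h.signal
    simp only [Finset.sum_const, Finset.card_univ, Fintype.card_fin, nsmul_eq_mul, mul_one]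
    nlinarith
  have := sq_nonneg (n : ℝ)
  nlinarith [mul_nonneg hκ this, mul_nonneg (mul_nonneg hκ hκ) this]

end goodData

section cavityMoment
variable {n : ℕ}

/-- The positions in the `i`-th row or column. -/
def sitePairs (i : Fin n) : Finset (Pair n) := {m | m.1.1 = i ∨ m.1.2 = i}

theorem pairOf_mem_sitePairs (i a b : Fin n) : pairOf a b ∈ sitePairs i ↔ a = i ∨ b = i := by
  have h := (pairOf_eq_iff a b (pairOf a b)).1 rfl
  simp only [sitePairs, Finset.mem_filter, Finset.mem_univ, true_and]
  rcases h with ⟨h1, h2⟩ | ⟨h1, h2⟩ <;> rw [← h1, ← h2]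
  exact or_comm

/-- The entries in row and column `i` can be resampled while the cavity orbit stays fixed. -/
theorem cavity_piecewise (i : Fin n) (x y : Pair n → ℝ) (Z : Matrix (Fin n) (Fin n) ℝ) :
    cavity i (hatMatrix (symM ((sitePairs i).piecewise y x)) Z) =
      cavity i (hatMatrix (symM x) Z) := by
  funext a b
  by_cases h : a = i ∨ b = i
  · simp [cavity, h]
  · have : pairOf a b ∉ sitePairs i := fun h' => h ((pairOf_mem_sitePairs i a b).1 h')
    simp [cavity, h, hatMatrix, symM, this]

theorem symM_piecewise_mulVec (i : Fin n) (x y : Pair n → ℝ) (v : Fin n → ℝ) :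
    (symM ((sitePairs i).piecewise y x) *ᵥ v) i = (symM y *ᵥ v) i := by
  simp only [Matrix.mulVec, dotProduct, symM]
  refine Finset.sum_congr rfl fun j _ => ?_
  rw [Finset.piecewise_eq_of_mem _ _ _ ((pairOf_mem_sitePairs i i j).2 (Or.inl rfl))]

variable {s : ℝ≥0} {μ : Pair n → Measure ℝ} [∀ i, IsProbabilityMeasure (μ i)]

theorem lintegral_symM_mulVec_pow_le (hμ : ∀ i, StdSubgaussian s (μ i)) (i : Fin n)
    {w : Fin n → ℝ} {C : ℝ≥0} (hw : l2 w ≤ C) :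
    ∫⁻ x, ENNReal.ofReal ((symM x *ᵥ w) i ^ 4) ∂(Measure.pi μ) ≤
      ENNReal.ofReal (momentBound (s * (2 * C ^ 2)) 4) := by
  have hK : ∑ m, bilinCoeff (Pi.single i 1) w m ^ 2 ≤ ((2 * C ^ 2 : ℝ≥0) : ℝ) := by
    refine (sum_bilinCoeff_sq_le _ w).trans ?_
    have h2 := pow_le_pow_left₀ (l2_nonneg w) hw 2
    rw [l2_single]
    push_cast
    simpa using h2
  have h := hasSubgaussianMGF_linear hμ (bilinCoeff (Pi.single i 1) w) hK
  have e : ∀ x : Pair n → ℝ, (symM x *ᵥ w) i ^ 4 =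
      |∑ m, bilinCoeff (Pi.single i 1) w m * x m| ^ 4 := fun x => by
    rw [← sum_mul_symM_mulVec, Even.pow_abs (by decide)]
    simp [Pi.single_apply]
  simp only [e]
  rw [← ofReal_integral_eq_lintegral_ofReal (integrable_abs_pow_of_subgaussian h 4)
    (ae_of_all _ fun x => by positivity)]
  exact ENNReal.ofReal_le_ofReal (integral_abs_pow_le_of_subgaussian h 4)

/-- Conditioning: the entries of row and column `i` are integrated first, with the others fixed, and
a bound uniform in the others suffices. -/
theorem lintegral_piecewise_le (i : Fin n) {g : (Pair n → ℝ) → ℝ≥0∞} (hg : Measurable g) {c : ℝ≥0∞}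
    (h : ∀ x, ∫⁻ y, g ((sitePairs i).piecewise y x) ∂(Measure.pi μ) ≤ c) :
    ∫⁻ x, g x ∂(Measure.pi μ) ≤ c := by
  have h1 := measurePreserving_piecewise (ν := μ) (μ := μ) (sitePairs i)
  have e : (sitePairs i).piecewise μ μ = μ := by
    funext m; by_cases hm : m ∈ sitePairs i <;> simp [hm]
  rw [show Measure.pi ((sitePairs i).piecewise μ μ) = Measure.pi μ by rw [e]] at h1
  rw [← h1.lintegral_comp hg, lintegral_prod_symm'
    (fun p : (Pair n → ℝ) × (Pair n → ℝ) => g ((sitePairs i).piecewise p.1 p.2))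
    (hg.comp h1.measurable)]
  refine (lintegral_mono h).trans ?_
  simp

end cavityMoment

theorem add_pow_four_le (a b : ℝ) : (a + b) ^ 4 ≤ 8 * (a ^ 4 + b ^ 4) := by
  have h1 : (a + b) ^ 2 ≤ 2 * (a ^ 2 + b ^ 2) := by nlinarith [sq_nonneg (a - b)]
  have h2 : (a ^ 2 + b ^ 2) ^ 2 ≤ 2 * (a ^ 4 + b ^ 4) := by nlinarith [sq_nonneg (a ^ 2 - b ^ 2)]
  have h3 := pow_le_pow_left₀ (sq_nonneg (a + b)) h1 2
  nlinarith

section cavityMoment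
variable {F : (k : ℕ) → (Fin (k + 1) → ℝ) → ℝ} {L : ℕ → ℝ≥0}

open Classical in
/-- The fourth power of the cavity field, cut off at large norms of the cavity matrix. -/
noncomputable def cutField {n : ℕ} (F : (k : ℕ) → (Fin (k + 1) → ℝ) → ℝ) (K : ℝ) (u0 : Fin n → ℝ)
    (Z : Matrix (Fin n) (Fin n) ℝ) (i : Fin n) (a : ℕ) (x : Pair n → ℝ) : ℝ :=
  if opN (cavity i (hatMatrix (symM x) Z)) ≤ K then
    cavityField i (hatMatrix (symM x) Z) F u0 a ^ 4 else 0

theorem cutField_nonneg {n : ℕ} (K : ℝ) (u0 : Fin n → ℝ) (Z : Matrix (Fin n) (Fin n) ℝ)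
    (i : Fin n) (a : ℕ) (x : Pair n → ℝ) : 0 ≤ cutField F K u0 Z i a x := by
  unfold cutField; split_ifs <;> positivity

theorem continuous_hatMatrix_symM {n : ℕ} (Z : Matrix (Fin n) (Fin n) ℝ) :
    Continuous fun x : Pair n → ℝ => hatMatrix (symM x) Z := by
  unfold hatMatrix symM; fun_prop

theorem continuous_cavity {n : ℕ} (i : Fin n) : Continuous (cavity i) := by
  refine continuous_matrix fun a b => ?_
  unfold cavity
  split_ifs
  · exact continuous_const
  · fun_prop

theorem measurable_cutField {n : ℕ} (hF : ∀ k, Continuous (F k)) (K : ℝ) (u0 : Fin n → ℝ)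
    (Z : Matrix (Fin n) (Fin n) ℝ) (i : Fin n) (a : ℕ) : Measurable (cutField F K u0 Z i a) := by
  have h1 : Continuous fun x : Pair n → ℝ => cavity i (hatMatrix (symM x) Z) :=
    (continuous_cavity i).comp (continuous_hatMatrix_symM Z)
  unfold cutField
  refine Measurable.ite (measurableSet_le (continuous_opN.comp h1).measurable measurable_const)
    ?_ measurable_const
  unfold cavityField
  have h2 : Continuous fun x : Pair n → ℝ => orbit F (cavity i (hatMatrix (symM x) Z)) u0 a :=
    (continuous_orbit hF a).comp (h1.prodMk continuous_const)
  have h3 := (continuous_hatMatrix_symM Z).matrix_mulVec h2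
  exact (((continuous_apply i).comp h3).pow 4).measurable

theorem mulVec_pow_four_le {n : ℕ} (Z : Matrix (Fin n) (Fin n) ℝ) (i : Fin n) {v : Fin n → ℝ}
    {C : ℝ} (hv : l2 v ≤ C * √n) :
    ((n : ℝ)⁻¹ * (Z *ᵥ v) i) ^ 4 ≤ C ^ 4 * ((n : ℝ)⁻¹ * ∑ j, Z i j ^ 4) := by
  have hn' : (0 : ℝ) < n := by exact_mod_cast i.pos
  have h1 : |(Z *ᵥ v) i| ≤ l2 (Z i) * l2 v := abs_sum_mul_le_l2 (Z i) v
  have h2 : (Z *ᵥ v) i ^ 2 ≤ (l2 (Z i) * l2 v) ^ 2 := by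
    rw [← sq_abs]; exact pow_le_pow_left₀ (abs_nonneg _) h1 2
  have h3 : l2 v ^ 2 ≤ C ^ 2 * n := by
    have := pow_le_pow_left₀ (l2_nonneg v) hv 2
    rwa [mul_pow, Real.sq_sqrt hn'.le] at this
  have h4 : (l2 (Z i) ^ 2) ^ 2 ≤ n * ∑ j, Z i j ^ 4 := by
    rw [l2_sq]
    refine (sq_sum_le_card_mul_sum_sq).trans_eq ?_
    simp [← pow_mul]
  have h5 : (Z *ᵥ v) i ^ 4 ≤ (n * ∑ j, Z i j ^ 4) * (C ^ 2 * n) ^ 2 := by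
    calc (Z *ᵥ v) i ^ 4 = ((Z *ᵥ v) i ^ 2) ^ 2 := by ring
      _ ≤ ((l2 (Z i) * l2 v) ^ 2) ^ 2 := pow_le_pow_left₀ (sq_nonneg _) h2 2
      _ = (l2 (Z i) ^ 2) ^ 2 * (l2 v ^ 2) ^ 2 := by ring
      _ ≤ _ := mul_le_mul h4 (pow_le_pow_left₀ (sq_nonneg _) h3 2) (by positivity)
        ((sq_nonneg _).trans h4)
  calc ((n : ℝ)⁻¹ * (Z *ᵥ v) i) ^ 4 = (n : ℝ)⁻¹ ^ 4 * (Z *ᵥ v) i ^ 4 := by ring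
    _ ≤ (n : ℝ)⁻¹ ^ 4 * ((n * ∑ j, Z i j ^ 4) * (C ^ 2 * n) ^ 2) := by gcongr
    _ = _ := by field_simp

/-- The cutoff involves the cavity matrix only, so it is unaffected by resampling row `i`. On it the
cavity orbit `v` has norm at most `C * √n`. The noise part of the field is then a subgaussian linear
form with coefficient vector `v / √n`, and the signal part is deterministic and bounded by
`mulVec_pow_four_le`. -/
theorem exists_integral_cutField_le (hF : ∀ k, LipschitzWith (L k) (F k)) (s : ℝ≥0) {K κ : ℝ}
    (hK : 0 ≤ K) (hκ : 0 ≤ κ) (a : ℕ) :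
    ∃ C, 0 ≤ C ∧ ∀ (n : ℕ) (μ : Pair n → Measure ℝ) [∀ m, IsProbabilityMeasure (μ m)],
      (∀ m, StdSubgaussian s (μ m)) → ∀ u0 Z, GoodData κ u0 Z → ∀ i : Fin n,
        Integrable (cutField F K u0 Z i a) (Measure.pi μ) ∧
        ∫ x, cutField F K u0 Z i a x ∂(Measure.pi μ) ≤ C * (1 + (n : ℝ)⁻¹ * ∑ j, Z i j ^ 4) := by
  obtain ⟨C, hC, h⟩ := exists_l2_orbit_le hF hK (show 0 ≤ 1 + κ by linarith) a
  set m₄ := momentBound (s * (2 * ⟨C, hC⟩ ^ 2)) 4 with hm₄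
  have hm₄0 : 0 ≤ m₄ := momentBound_nonneg _ _
  refine ⟨8 * (m₄ + C ^ 4), by positivity, fun n μ _ hμ u0 Z hd i => ?_⟩
  have hn' : (0 : ℝ) < n := by exact_mod_cast i.pos
  have hs' : (0 : ℝ) < √n := Real.sqrt_pos.2 hn'
  set ζ := (n : ℝ)⁻¹ * ∑ j, Z i j ^ 4 with hζ
  have hζ0 : 0 ≤ ζ := mul_nonneg (by positivity) (Finset.sum_nonneg fun j _ => by positivity)
  have hFc : ∀ k, Continuous (F k) := fun k => (hF k).continuous
  have hm := measurable_cutField hFc K u0 Z i a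
  have hb : 0 ≤ 8 * (m₄ + C ^ 4) * (1 + ζ) := by positivity
  have key : ∫⁻ x, ENNReal.ofReal (cutField F K u0 Z i a x) ∂(Measure.pi μ) ≤
      ENNReal.ofReal (8 * (m₄ + C ^ 4) * (1 + ζ)) := by
    refine lintegral_piecewise_le i hm.ennreal_ofReal fun x => ?_
    simp only [cutField, cavity_piecewise]
    split_ifs with hx
    swap
    · simp
    set v := orbit F (cavity i (hatMatrix (symM x) Z)) u0 a with hv
    have hvl : l2 v ≤ C * √n := h n _ u0 hx (hd.l2_init_le hκ) a le_rfl
    set w : Fin n → ℝ := (√(n : ℝ))⁻¹ • v with hw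
    have hwl : l2 w ≤ ((⟨C, hC⟩ : ℝ≥0) : ℝ) := by
      have : l2 w = (√(n : ℝ))⁻¹ * l2 v := by
        have := l2_smul (√(n : ℝ))⁻¹ v
        rw [abs_of_pos (inv_pos.2 hs')] at this
        exact this
      rw [this, inv_mul_le_iff₀ hs', mul_comm]
      exact hvl
    have hpt : ∀ y : Pair n → ℝ, cavityField i
        (hatMatrix (symM ((sitePairs i).piecewise y x)) Z) F u0 a ^ 4 ≤
        8 * ((symM y *ᵥ w) i ^ 4) + 8 * (C ^ 4 * ζ) := fun y => by
      have e : cavityField i (hatMatrix (symM ((sitePairs i).piecewise y x)) Z) F u0 a =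
          (symM y *ᵥ w) i + (n : ℝ)⁻¹ * (Z *ᵥ v) i := by
        rw [cavityField, cavity_piecewise, ← hv, hatMatrix, Matrix.add_mulVec, Matrix.smul_mulVec,
          Matrix.smul_mulVec, Pi.add_apply, Pi.smul_apply, Pi.smul_apply, symM_piecewise_mulVec,
          hw, Matrix.mulVec_smul]
        rfl
      rw [e]
      refine (add_pow_four_le _ _).trans ?_
      have := mulVec_pow_four_le Z i hvl
      linarith
    calc _ ≤ ∫⁻ y, (8 * ENNReal.ofReal ((symM y *ᵥ w) i ^ 4) +
          ENNReal.ofReal (8 * (C ^ 4 * ζ))) ∂(Measure.pi μ) := by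
          refine lintegral_mono fun y => ?_
          have h8 : (8 : ℝ≥0∞) = ENNReal.ofReal 8 := by simp
          rw [h8, ← ENNReal.ofReal_mul (by norm_num), ← ENNReal.ofReal_add (by positivity)
            (by positivity)]
          exact ENNReal.ofReal_le_ofReal (hpt y)
      _ = 8 * ∫⁻ y, ENNReal.ofReal ((symM y *ᵥ w) i ^ 4) ∂(Measure.pi μ) +
          ENNReal.ofReal (8 * (C ^ 4 * ζ)) := by
          rw [lintegral_add_right _ measurable_const, lintegral_const_mul' _ _ (by simp)]
          simp
      _ ≤ 8 * ENNReal.ofReal m₄ + ENNReal.ofReal (8 * (C ^ 4 * ζ)) := by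
          gcongr
          exact lintegral_symM_mulVec_pow_le hμ i hwl
      _ ≤ _ := by
          have h8 : (8 : ℝ≥0∞) = ENNReal.ofReal 8 := by simp
          rw [h8, ← ENNReal.ofReal_mul (by norm_num), ← ENNReal.ofReal_add (by positivity)
            (by positivity)]
          refine ENNReal.ofReal_le_ofReal ?_
          have := mul_nonneg hm₄0 hζ0
          have : 0 ≤ C ^ 4 := by positivity
          nlinarith
  have hnn : 0 ≤ᵐ[Measure.pi μ] cutField F K u0 Z i a :=
    ae_of_all _ fun x => cutField_nonneg K u0 Z i a x
  have hint : Integrable (cutField F K u0 Z i a) (Measure.pi μ) := by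
    refine ⟨hm.aestronglyMeasurable, ?_⟩
    rw [hasFiniteIntegral_iff_ofReal hnn]
    exact key.trans_lt ENNReal.ofReal_lt_top
  refine ⟨hint, ?_⟩
  rw [← ENNReal.ofReal_le_ofReal_iff hb, ofReal_integral_eq_lintegral_ofReal hint hnn]
  exact key

end cavityMoment

end GenAMP

namespace GenAMP

/-! ### Tightness of the empirical fourth moments -/

section orbitMoment
variable {F : (k : ℕ) → (Fin (k + 1) → ℝ) → ℝ} {L : ℕ → ℝ≥0}

/-- The empirical fourth moment of an orbit and of the fields along the orbit. -/
noncomputable def orbitMoment {n : ℕ} (F : (k : ℕ) → (Fin (k + 1) → ℝ) → ℝ) (k : ℕ)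
    (u0 : Fin n → ℝ) (M : Matrix (Fin n) (Fin n) ℝ) : ℝ :=
  (n : ℝ)⁻¹ * ∑ i, ∑ j ∈ Finset.range (k + 1),
    (orbit F M u0 j i ^ 4 + (M *ᵥ orbit F M u0 j) i ^ 4)

theorem one_add_add_sum_pow_four_le (b : ℝ) (f : ℕ → ℝ) {j k : ℕ} (hj : j ≤ k) :
    (1 + |b| + ∑ a ∈ Finset.range (j + 1), |f a|) ^ 4 ≤
      81 * (k + 1) ^ 3 * (1 + b ^ 4 + ∑ a ∈ Finset.range (k + 1), f a ^ 4) := by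
  have hS0 : 0 ≤ ∑ a ∈ Finset.range (j + 1), |f a| := Finset.sum_nonneg fun _ _ => abs_nonneg _
  have h1 := add_three_pow_le zero_le_one (abs_nonneg b) hS0 4
  have h2 : (∑ a ∈ Finset.range (j + 1), |f a|) ^ 4 ≤
      (k + 1) ^ 3 * ∑ a ∈ Finset.range (k + 1), f a ^ 4 := by
    calc _ ≤ (∑ a ∈ Finset.range (k + 1), |f a|) ^ 4 := by
          refine pow_le_pow_left₀ hS0 (Finset.sum_le_sum_of_subset_of_nonneg ?_
            fun _ _ _ => abs_nonneg _) 4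
          exact Finset.range_mono (by omega)
      _ ≤ _ := by
          have h := pow_sum_le_card_mul_sum_pow (s := Finset.range (k + 1)) (f := fun a => |f a|)
            (fun _ _ => abs_nonneg _) 3
          simpa [Even.pow_abs (show Even 4 by decide)] using h
  have hk : (1 : ℝ) ≤ (k + 1) ^ 3 := one_le_pow₀ (by linarith [Nat.cast_nonneg (α := ℝ) k])
  rw [Even.pow_abs (by decide)] at h1
  have hb : 0 ≤ b ^ 4 := by positivity
  nlinarith [mul_le_mul_of_nonneg_right hk (show 0 ≤ 1 + b ^ 4 by positivity)]

/-- Erasing a row and a column does not increase the norm, so no cutoff is active when the full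
matrix has norm at most `K`. -/
theorem exists_orbitMoment_le (hF : ∀ k, LipschitzWith (L k) (F k)) {K : ℝ} (hK : 0 ≤ K) (k : ℕ) :
    ∃ C, 0 ≤ C ∧ ∀ (n : ℕ) (u0 : Fin n → ℝ) (Z : Matrix (Fin n) (Fin n) ℝ) (x : Pair n → ℝ),
      opN (hatMatrix (symM x) Z) ≤ K → orbitMoment F k u0 (hatMatrix (symM x) Z) ≤
        C * ((n : ℝ)⁻¹ * ∑ i, (1 + u0 i ^ 4 +
          ∑ a ∈ Finset.range (k + 1), cutField F K u0 Z i a x)) := by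
  choose C hC h using fun j => exists_abs_orbit_le_cavityField hF hK j
  refine ⟨∑ j ∈ Finset.range (k + 1), 2 * C j ^ 4 * (81 * (k + 1) ^ 3),
    Finset.sum_nonneg fun j _ => by positivity, fun n u0 Z x hx => ?_⟩
  rw [orbitMoment, mul_left_comm]
  refine mul_le_mul_of_nonneg_left ?_ (by positivity)
  rw [Finset.mul_sum]
  refine (Finset.sum_le_sum fun i _ => ?_)
  have hcut : ∀ a, cutField F K u0 Z i a x =
      cavityField i (hatMatrix (symM x) Z) F u0 a ^ 4 := fun a => by
    rw [cutField, if_pos ((opN_cavity_le i _).trans hx)]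
  simp only [hcut]
  rw [Finset.sum_mul]
  refine Finset.sum_le_sum fun j hj => ?_
  have hj' : j ≤ k := Nat.lt_succ_iff.1 (Finset.mem_range.1 hj)
  obtain ⟨h1, h2⟩ := h j n i _ u0 hx
  have h3 := one_add_add_sum_pow_four_le (u0 i)
    (fun a => cavityField i (hatMatrix (symM x) Z) F u0 a) hj'
  have h4 := pow_le_pow_left₀ (abs_nonneg _) h1 4
  have h5 := pow_le_pow_left₀ (abs_nonneg _) h2 4
  rw [Even.pow_abs (by decide), mul_pow] at h4 h5
  have h6 := mul_le_mul_of_nonneg_left h3 (show 0 ≤ C j ^ 4 by have := hC j; positivity)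
  linarith

theorem exists_tight (hF : ∀ k, LipschitzWith (L k) (F k)) (s : ℝ≥0) {κ δ : ℝ} (hκ : 0 ≤ κ)
    (hδ : 0 < δ) (k : ℕ) :
    ∃ K T, 0 ≤ K ∧ 0 ≤ T ∧ ∀ (n : ℕ) (μ : Pair n → Measure ℝ) [∀ m, IsProbabilityMeasure (μ m)],
      0 < n → (∀ m, StdSubgaussian s (μ m)) → ∀ u0 Z, GoodData κ u0 Z →
        (Measure.pi μ).real {x | ¬(opN (hatMatrix (symM x) Z) ≤ K ∧
          orbitMoment F k u0 (hatMatrix (symM x) Z) ≤ T)} ≤ δ := by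
  have hO := opMoment_nonneg s (1 + κ) 1
  -- Both `K` and, below, `T` are chosen so that Markov's inequality gives an exceptional
  -- probability of at most `δ / 2`. The cutoff level `K` comes first, as the moment bound behind
  -- `T` depends on it.
  set K := 2 * (opMoment s (1 + κ) 1 + 1) / δ with hK
  have hK0 : 0 < K := by positivity
  obtain ⟨C, hC, h⟩ := exists_orbitMoment_le hF hK0.le k
  choose c hc hcut using fun a => exists_integral_cutField_le hF s hK0.le hκ a
  have hc0 : 0 ≤ ∑ a ∈ Finset.range (k + 1), c a := Finset.sum_nonneg fun a _ => hc a
  set C₂ := C * (1 + κ + (∑ a ∈ Finset.range (k + 1), c a) * (1 + κ)) with hC₂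
  have hC₂0 : 0 ≤ C₂ := by positivity
  set T := 2 * (C₂ + 1) / δ with hT
  have hT0 : 0 < T := by positivity
  refine ⟨K, T, hK0.le, hT0.le, fun n μ _ hn hμ u0 Z hd => ?_⟩
  have hn' : (0 : ℝ) < n := by exact_mod_cast hn
  set B : (Pair n → ℝ) → ℝ := fun x => C * ((n : ℝ)⁻¹ * ∑ i, (1 + u0 i ^ 4 +
    ∑ a ∈ Finset.range (k + 1), cutField F K u0 Z i a x)) with hB
  have hint : ∀ i, Integrable (fun x => 1 + u0 i ^ 4 +
      ∑ a ∈ Finset.range (k + 1), cutField F K u0 Z i a x) (Measure.pi μ) := fun i =>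
    (integrable_const _).fun_add (integrable_finsetSum _ fun a _ => (hcut a n μ hμ u0 Z hd i).1)
  have hBint : Integrable B (Measure.pi μ) :=
    ((integrable_finsetSum _ fun i _ => hint i).const_mul _).const_mul _
  have hB0 : ∀ x, 0 ≤ B x := fun x =>
    mul_nonneg hC (mul_nonneg (by positivity) (Finset.sum_nonneg fun i _ => add_nonneg
      (by positivity) (Finset.sum_nonneg fun a _ => cutField_nonneg K u0 Z i a x)))
  have hBle : ∫ x, B x ∂(Measure.pi μ) ≤ C₂ := by
    rw [hB, integral_const_mul, integral_const_mul, integral_finsetSum _ fun i _ => hint i, hC₂]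
    refine mul_le_mul_of_nonneg_left ?_ hC
    rw [inv_mul_le_iff₀ hn']
    have h1 : ∀ i, ∫ x, (1 + u0 i ^ 4 + ∑ a ∈ Finset.range (k + 1), cutField F K u0 Z i a x)
        ∂(Measure.pi μ) ≤ 1 + u0 i ^ 4 + (∑ a ∈ Finset.range (k + 1), c a) *
          (1 + (n : ℝ)⁻¹ * ∑ j, Z i j ^ 4) := fun i => by
      rw [integral_add (integrable_const _)
        (integrable_finsetSum _ fun a _ => (hcut a n μ hμ u0 Z hd i).1),
        integral_finsetSum _ fun a _ => (hcut a n μ hμ u0 Z hd i).1, Finset.sum_mul]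
      refine add_le_add (by simp) (Finset.sum_le_sum fun a _ => (hcut a n μ hμ u0 Z hd i).2)
    refine (Finset.sum_le_sum fun i _ => h1 i).trans ?_
    rw [Finset.sum_add_distrib, Finset.sum_add_distrib, ← Finset.mul_sum, Finset.sum_add_distrib,
      ← Finset.mul_sum]
    have h2 := hd.init
    have h3 : (n : ℝ)⁻¹ * ∑ i, ∑ j, Z i j ^ 4 ≤ κ * n := by
      rw [inv_mul_le_iff₀ hn']
      exact hd.signal.trans_eq (by ring)
    simp only [Finset.sum_const, Finset.card_univ, Fintype.card_fin, nsmul_eq_mul, mul_one]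
    have h4 := mul_le_mul_of_nonneg_left h3 hc0
    nlinarith
  have hM := mul_meas_ge_le_integral_of_nonneg (ae_of_all _ hB0) hBint T
  have hO' := measureReal_lt_opN_le hn hμ (hd.opN_signal_le hκ) hK0
  have h1 : opMoment s (1 + κ) 1 / K ≤ δ / 2 := by
    rw [hK, div_le_iff₀ (by positivity)]
    field_simp
    linarith
  have h2 : (Measure.pi μ).real {x | T ≤ B x} ≤ δ / 2 := by
    have h3 : T * (Measure.pi μ).real {x | T ≤ B x} ≤ C₂ := hM.trans hBle
    rw [mul_comm, ← le_div_iff₀ hT0] at h3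
    refine h3.trans ?_
    rw [hT, div_le_iff₀ (by positivity)]
    field_simp
    linarith
  have hsub : {x | ¬(opN (hatMatrix (symM x) Z) ≤ K ∧
      orbitMoment F k u0 (hatMatrix (symM x) Z) ≤ T)} ⊆
      {x | K < opN (hatMatrix (symM x) Z)} ∪ {x | T ≤ B x} := fun x hx => by
    by_cases hx1 : opN (hatMatrix (symM x) Z) ≤ K
    · refine Or.inr ?_
      have hx2 : ¬ orbitMoment F k u0 (hatMatrix (symM x) Z) ≤ T := fun h' => hx ⟨hx1, h'⟩
      exact (not_le.1 hx2).le.trans (h n u0 Z x hx1)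
    · exact Or.inl (not_le.1 hx1)
  refine (measureReal_mono hsub).trans ((measureReal_union_le _ _).trans ?_)
  linarith

end orbitMoment

end GenAMP

namespace GenAMP

open scoped ContDiff

/-! ### Smooth truncation of Lipschitz functions -/

section truncation
variable {E : Type*} [NormedAddCommGroup E]

/-- A function clipped to `[-(R - ‖x‖)⁺, (R - ‖x‖)⁺]`. -/
noncomputable def clip (R : ℝ) (g : E → ℝ) (x : E) : ℝ :=
  max (-max 0 (R - ‖x‖)) (min (g x) (max 0 (R - ‖x‖)))

variable {g : E → ℝ} {L : ℝ≥0} {R : ℝ}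

/-- The constant does not depend on `R`. This allows the stability constants of the orbit to be
fixed before the level of truncation. -/
theorem lipschitzWith_clip (hg : LipschitzWith L g) (R : ℝ) :
    LipschitzWith (max L 1) (clip R g) := by
  have h1 : LipschitzWith 1 (fun x : E => max 0 (R - ‖x‖)) := by
    have := (LipschitzWith.const (α := E) R).sub (lipschitzWith_one_norm (E := E))
    rw [zero_add] at this
    exact this.const_max 0
  have h := (h1.neg).max (hg.min h1)
  refine h.weaken ?_
  simp

theorem clip_eq_zero {x : E} (hx : R ≤ ‖x‖) : clip R g x = 0 := by
  have : max 0 (R - ‖x‖) = 0 := max_eq_left (by linarith)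
  rw [clip, this]
  simp

theorem hasCompactSupport_clip [ProperSpace E] (R : ℝ) (g : E → ℝ) : HasCompactSupport (clip R g) :=
  HasCompactSupport.intro (isCompact_closedBall (0 : E) R) fun x hx => by
    rw [mem_closedBall_zero_iff, not_le] at hx
    exact clip_eq_zero hx.le

/-- Clipping acts only where `|g x| + ‖x‖` is at least `R`, and it changes the value by at most `|g
x|`. -/
theorem abs_sub_clip_le (hR : 0 < R) (x : E) :
    |g x - clip R g x| ≤ (|g x| + ‖x‖) ^ 2 / R := by
  set ρ := max 0 (R - ‖x‖) with hρ
  have hρ0 : 0 ≤ ρ := le_max_left _ _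
  rcases le_or_gt |g x| ρ with h | h
  · have : clip R g x = g x := by
      rw [clip, ← hρ, min_eq_left (abs_le.1 h).2, max_eq_right (abs_le.1 h).1]
    rw [this, sub_self, abs_zero]
    positivity
  · have h1 : |g x - clip R g x| ≤ |g x| := by
      rw [clip, ← hρ]
      rcases abs_cases (g x) with ⟨h2, h3⟩ | ⟨h2, h3⟩
      · rw [h2] at h ⊢
        rw [min_eq_right h.le, max_eq_right (by linarith), abs_of_nonneg (by linarith)]
        linarith
      · rw [h2] at h ⊢
        rw [min_eq_left (by linarith), max_eq_left (by linarith), abs_of_nonpos (by linarith)]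
        linarith
    have h2 : R ≤ |g x| + ‖x‖ := by
      have := le_max_right 0 (R - ‖x‖)
      rw [← hρ] at this
      linarith
    rw [le_div_iff₀ hR]
    have h3 : |g x| ≤ |g x| + ‖x‖ := le_add_of_nonneg_right (norm_nonneg _)
    have h4 := abs_nonneg (g x)
    calc |g x - clip R g x| * R ≤ (|g x| + ‖x‖) * (|g x| + ‖x‖) :=
          mul_le_mul (h1.trans h3) h2 hR.le (by positivity)
      _ = _ := by ring

variable [NormedSpace ℝ E]

set_option maxSynthPendingDepth 6 in
theorem exists_smoothBdd_of_hasCompactSupport {h : E → ℝ} (hs : ContDiff ℝ ∞ h)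
    (hc : HasCompactSupport h) : ∃ K, SmoothBdd h K := by
  have s1 : ContDiff ℝ ∞ (fderiv ℝ h) := hs.fderiv_right le_rfl
  have s2 : ContDiff ℝ ∞ (fderiv ℝ (fderiv ℝ h)) := s1.fderiv_right le_rfl
  have s3 : ContDiff ℝ ∞ (fderiv ℝ (fderiv ℝ (fderiv ℝ h))) := s2.fderiv_right le_rfl
  have s4 : ContDiff ℝ ∞ (fderiv ℝ (fderiv ℝ (fderiv ℝ (fderiv ℝ h)))) := s3.fderiv_right le_rfl
  have c1 := hc.fderiv ℝ
  have c2 := c1.fderiv ℝ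
  have c3 := c2.fderiv ℝ
  have c4 := c3.fderiv ℝ
  obtain ⟨K1, h1⟩ := s1.continuous.bounded_above_of_compact_support c1
  obtain ⟨K2, h2⟩ := s2.continuous.bounded_above_of_compact_support c2
  obtain ⟨K3, h3⟩ := s3.continuous.bounded_above_of_compact_support c3
  obtain ⟨K4, h4⟩ := s4.continuous.bounded_above_of_compact_support c4
  refine ⟨max (max K1 K2) (max K3 K4), hs, fun x => ?_, fun x => ?_, fun x => ?_, fun x => ?_⟩
  · exact (h1 x).trans ((le_max_left _ _).trans (le_max_left _ _))
  · exact (h2 x).trans ((le_max_right _ _).trans (le_max_left _ _))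
  · exact (h3 x).trans ((le_max_left _ _).trans (le_max_right _ _))
  · exact (h4 x).trans ((le_max_right _ _).trans (le_max_right _ _))

variable [FiniteDimensional ℝ E]

/-- Convolution with a normalised bump of radius `ε / (L + 1)`; averaging translates preserves the
Lipschitz constant. The `+ 1` covers `L = 0`. -/
theorem exists_smooth_dist_le {f : E → ℝ} (hf : LipschitzWith L f) (hc : HasCompactSupport f)
    {ε : ℝ} (hε : 0 < ε) :
    ∃ h : E → ℝ, ContDiff ℝ ∞ h ∧ HasCompactSupport h ∧ LipschitzWith L h ∧
      ∀ x, |f x - h x| ≤ ε := by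
  borelize E
  set ρ : Measure E := Measure.addHaar
  have hr : 0 < ε / (L + 1) := by positivity
  let φ : ContDiffBump (0 : E) := ⟨ε / (L + 1) / 2, ε / (L + 1), half_pos hr, half_lt_self hr⟩
  have hfi : LocallyIntegrable f ρ := hf.continuous.locallyIntegrable
  refine ⟨MeasureTheory.convolution (φ.normed ρ) f (ContinuousLinearMap.lsmul ℝ ℝ) ρ,
    φ.hasCompactSupport_normed.contDiff_convolution_left _ φ.contDiff_normed hfi,
    φ.hasCompactSupport_normed.convolution _ hc, ?_, fun x => ?_⟩
  · have hex := (φ.hasCompactSupport_normed (μ := ρ)).convolutionExists_left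
      (ContinuousLinearMap.lsmul ℝ ℝ) φ.continuous_normed hfi
    refine LipschitzWith.of_dist_le_mul fun x y => ?_
    rw [Real.dist_eq, convolution, convolution, ← integral_sub (hex x) (hex y)]
    have hb := norm_integral_le_of_norm_le (μ := ρ)
      (f := fun t => (ContinuousLinearMap.lsmul ℝ ℝ) (φ.normed ρ t) (f (x - t)) -
        (ContinuousLinearMap.lsmul ℝ ℝ) (φ.normed ρ t) (f (y - t)))
      (g := fun t => φ.normed ρ t * (L * dist x y)) (φ.integrable_normed.mul_const _)
      (ae_of_all _ fun t => by
        have h1 := hf.dist_le_mul (x - t) (y - t)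
        rw [dist_sub_right, Real.dist_eq] at h1
        simp only [ContinuousLinearMap.lsmul_apply, smul_eq_mul]
        rw [← mul_sub, norm_mul, Real.norm_eq_abs, Real.norm_eq_abs,
          abs_of_nonneg (φ.nonneg_normed t)]
        exact mul_le_mul_of_nonneg_left h1 (φ.nonneg_normed t))
    rw [integral_mul_const, φ.integral_normed, one_mul] at hb
    exact hb
  · rw [abs_sub_comm, ← Real.dist_eq]
    refine φ.dist_normed_convolution_le hf.continuous.aestronglyMeasurable fun y hy => ?_
    refine (hf.dist_le_mul y x).trans ?_
    have h1 : dist y x ≤ ε / (L + 1) := (Metric.mem_ball.1 hy).le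
    calc L * dist y x ≤ (L + 1) * (ε / (L + 1)) := by gcongr; simp
      _ = ε := by field_simp

theorem exists_truncation (hg : LipschitzWith L g) {ε : ℝ} (hε : 0 < ε) (hR : 0 < R) :
    ∃ (h : E → ℝ) (K B : ℝ), SmoothBdd h K ∧ LipschitzWith (max L 1) h ∧ (∀ x, |h x| ≤ B) ∧
      ∀ x, |g x - h x| ≤ ε + (|g x| + ‖x‖) ^ 2 / R := by
  obtain ⟨h, hs, hc, hl, hd⟩ :=
    exists_smooth_dist_le (lipschitzWith_clip hg R) (hasCompactSupport_clip R g) hε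
  obtain ⟨K, hK⟩ := exists_smoothBdd_of_hasCompactSupport hs hc
  obtain ⟨B, hB⟩ := hs.continuous.bounded_above_of_compact_support hc
  refine ⟨h, K, B, hK, hl, hB, fun x => ?_⟩
  have h1 := abs_sub_clip_le (g := g) hR x
  have h2 := abs_sub_le (g x) (clip R g x) (h x)
  have h3 := hd x
  linarith

end truncation

end GenAMP

namespace GenAMP

/-! ### Stability of orbits under truncation -/

section stability
variable {n : ℕ} {F G : (k : ℕ) → (Fin (k + 1) → ℝ) → ℝ} {L : ℕ → ℝ≥0}
  {M : Matrix (Fin n) (Fin n) ℝ} {u0 : Fin n → ℝ} {k : ℕ}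

/-- The sum of the sizes of the orbit and of the fields at a site. -/
noncomputable def siteSize {n : ℕ} (F : (k : ℕ) → (Fin (k + 1) → ℝ) → ℝ) (k : ℕ)
    (u0 : Fin n → ℝ) (M : Matrix (Fin n) (Fin n) ℝ) (i : Fin n) : ℝ :=
  ∑ j ∈ Finset.range (k + 1), (|orbit F M u0 j i| + |(M *ᵥ orbit F M u0 j) i|)

theorem sum_abs_orbit_le_siteSize (i : Fin n) :
    ∑ j ∈ Finset.range (k + 1), |orbit F M u0 j i| ≤ siteSize F k u0 M i :=
  Finset.sum_le_sum fun _ _ => le_add_of_nonneg_right (abs_nonneg _)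

theorem abs_init_le_siteSize (i : Fin n) : |u0 i| ≤ siteSize F k u0 M i := by
  refine le_trans ?_ (sum_abs_orbit_le_siteSize i)
  have := Finset.single_le_sum (f := fun j => |orbit F M u0 j i|) (fun _ _ => abs_nonneg _)
    (Finset.mem_range.2 k.succ_pos)
  simpa [orbit_zero] using this

theorem abs_orbit_add_norm_orbitArg_le {j : ℕ} (hj : j < k) (i : Fin n) :
    |orbit F M u0 (j + 1) i| +
      ‖orbitArg j ((M *ᵥ orbit F M u0 j) i) fun a => orbit F M u0 a i‖ ≤ siteSize F k u0 M i := by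
  have h1 := norm_orbitArg_le j ((M *ᵥ orbit F M u0 j) i) fun a => orbit F M u0 a i
  have h2 : ∑ a ∈ Finset.range (j + 2), |orbit F M u0 a i| ≤
      ∑ a ∈ Finset.range (k + 1), |orbit F M u0 a i| :=
    Finset.sum_le_sum_of_subset_of_nonneg (Finset.range_mono (by omega)) fun _ _ _ => abs_nonneg _
  have h3 : |(M *ᵥ orbit F M u0 j) i| ≤
      ∑ a ∈ Finset.range (k + 1), |(M *ᵥ orbit F M u0 a) i| :=
    Finset.single_le_sum (f := fun a => |(M *ᵥ orbit F M u0 a) i|) (fun _ _ => abs_nonneg _)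
      (Finset.mem_range.2 (by omega))
  rw [Finset.sum_range_succ, Finset.sum_range_succ] at h2
  rw [siteSize, Finset.sum_add_distrib]
  linarith [abs_nonneg (orbit F M u0 j i)]

theorem norm_orbit_le_siteSize (i : Fin n) :
    ‖fun j : Fin (k + 1) => orbit F M u0 j i‖ ≤ siteSize F k u0 M i := by
  refine (norm_pi_le_sum _).trans (le_trans (le_of_eq ?_) (sum_abs_orbit_le_siteSize i))
  rw [Finset.sum_range]

/-- Truncation errors are quadratic in the site size, so their Euclidean norm is a fourth-moment
quantity. -/
theorem l2_siteSize_sq_le {T : ℝ} (hT : 0 ≤ T) (h : orbitMoment F k u0 M ≤ T) :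
    l2 (fun i => siteSize F k u0 M i ^ 2) ≤ √(8 * (k + 1) ^ 3 * T) * √n := by
  refine l2_le_of_sum_sq_le (by positivity) ?_
  rw [mul_pow, Real.sq_sqrt (by positivity), Real.sq_sqrt (Nat.cast_nonneg n)]
  rcases Nat.eq_zero_or_pos n with rfl | hn
  · simp
  have hn' : (0 : ℝ) < n := by exact_mod_cast hn
  rw [orbitMoment, inv_mul_le_iff₀ hn'] at h
  have h1 : ∀ i, (siteSize F k u0 M i ^ 2) ^ 2 ≤ 8 * (k + 1) ^ 3 *
      ∑ j ∈ Finset.range (k + 1), (orbit F M u0 j i ^ 4 + (M *ᵥ orbit F M u0 j) i ^ 4) := fun i => by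
    rw [← pow_mul, siteSize]
    have h2 := pow_sum_le_card_mul_sum_pow (s := Finset.range (k + 1))
      (f := fun j => |orbit F M u0 j i| + |(M *ᵥ orbit F M u0 j) i|)
      (fun _ _ => by positivity) 3
    refine h2.trans ?_
    simp only [Finset.card_range]
    push_cast
    rw [mul_comm (8 : ℝ), mul_assoc]
    refine mul_le_mul_of_nonneg_left ?_ (by positivity)
    rw [Finset.mul_sum]
    refine Finset.sum_le_sum fun j _ => (add_pow_four_le _ _).trans_eq ?_
    rw [Even.pow_abs (by decide), Even.pow_abs (by decide)]
  calc _ ≤ ∑ i, 8 * ((k : ℝ) + 1) ^ 3 *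
      ∑ j ∈ Finset.range (k + 1), (orbit F M u0 j i ^ 4 + (M *ᵥ orbit F M u0 j) i ^ 4) :=
        Finset.sum_le_sum fun i _ => h1 i
    _ ≤ _ := by
        rw [← Finset.mul_sum, mul_assoc _ T, mul_comm T]
        exact mul_le_mul_of_nonneg_left h (by positivity)

/-- The one-step error `F - G` is evaluated along the orbit of `F`, where fourth moments are
controlled, and it is propagated by the Lipschitz constants of `G`. The constant is uniform in `F`,
`G` and `ε`, so `ε` can be chosen after it. -/
theorem exists_l2_orbit_sub_le (L : ℕ → ℝ≥0) {K T : ℝ} (hK : 0 ≤ K) (hT : 0 ≤ T) (k : ℕ) :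
    ∃ c, 0 ≤ c ∧ ∀ (n : ℕ) (F G : (k : ℕ) → (Fin (k + 1) → ℝ) → ℝ) (ε : ℝ)
      (M : Matrix (Fin n) (Fin n) ℝ) (u0 v0 : Fin n → ℝ), 0 ≤ ε →
      (∀ j < k, LipschitzWith (L j) (G j)) →
      (∀ j < k, ∀ x, |F j x - G j x| ≤ ε * (1 + (|F j x| + ‖x‖) ^ 2)) →
      (∀ i, |u0 i - v0 i| ≤ ε * u0 i ^ 2) → opN M ≤ K → orbitMoment F k u0 M ≤ T →
      ∀ j ≤ k, l2 (fun i => orbit F M u0 j i - orbit G M v0 j i) ≤ c * ε * √n := by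
  set τ := √(8 * ((k : ℝ) + 1) ^ 3 * T) with hτ
  have hτ0 : 0 ≤ τ := Real.sqrt_nonneg _
  -- The moment hypothesis refers to the full horizon `k`, which stays fixed while the induction
  -- runs over `m`.
  suffices H : ∀ m ≤ k, ∃ c, 0 ≤ c ∧ ∀ (n : ℕ) (F G : (k : ℕ) → (Fin (k + 1) → ℝ) → ℝ) (ε : ℝ)
      (M : Matrix (Fin n) (Fin n) ℝ) (u0 v0 : Fin n → ℝ), 0 ≤ ε →
      (∀ j < k, LipschitzWith (L j) (G j)) →
      (∀ j < k, ∀ x, |F j x - G j x| ≤ ε * (1 + (|F j x| + ‖x‖) ^ 2)) →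
      (∀ i, |u0 i - v0 i| ≤ ε * u0 i ^ 2) → opN M ≤ K → orbitMoment F k u0 M ≤ T →
      ∀ j ≤ m, l2 (fun i => orbit F M u0 j i - orbit G M v0 j i) ≤ c * ε * √n from H k le_rfl
  intro m
  induction m with
  | zero =>
    refine fun _ => ⟨τ, hτ0, fun n F G ε M u0 v0 hε _ _ h0 _ hM j hj => ?_⟩
    rw [Nat.le_zero.1 hj, orbit_zero, orbit_zero]
    calc _ ≤ l2 (fun i => ε * siteSize F k u0 M i ^ 2) := l2_mono_of_le fun i => by
          refine (h0 i).trans (mul_le_mul_of_nonneg_left ?_ hε)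
          rw [← sq_abs]
          exact pow_le_pow_left₀ (abs_nonneg _) (abs_init_le_siteSize i) 2
      _ ≤ ε * (τ * √n) := by
          rw [l2_smul, abs_of_nonneg hε]
          exact mul_le_mul_of_nonneg_left (l2_siteSize_sq_le hT hM) hε
      _ = _ := by ring
  | succ m ih =>
    intro hm
    obtain ⟨c, hc, h⟩ := ih (by omega)
    have hL : (0 : ℝ) ≤ L m := (L m).2
    refine ⟨c + (1 + τ + L m * (K * c + m * c)), by positivity,
      fun n F G ε M u0 v0 hε hG hFG h0 hMK hM j hj => ?_⟩
    have IH := h n F G ε M u0 v0 hε hG hFG h0 hMK hM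
    have hs : 0 ≤ √(n : ℝ) := Real.sqrt_nonneg _
    rcases Nat.of_le_succ hj with hj | rfl
    · refine (IH j hj).trans ?_
      gcongr
      exact le_add_of_nonneg_right (by positivity)
    · set u := orbit F M u0 with hu
      set v := orbit G M v0 with hv
      have e : (fun i => u (m + 1) i - v (m + 1) i) = fun i =>
          (F m (orbitArg m ((M *ᵥ u m) i) fun a => u a i) -
            G m (orbitArg m ((M *ᵥ u m) i) fun a => u a i)) +
          (G m (orbitArg m ((M *ᵥ u m) i) fun a => u a i) -
            G m (orbitArg m ((M *ᵥ v m) i) fun a => v a i)) := by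
        funext i
        rw [hu, hv, orbit_succ', orbit_succ']; ring
      have h1 : l2 (fun i => F m (orbitArg m ((M *ᵥ u m) i) fun a => u a i) -
            G m (orbitArg m ((M *ᵥ u m) i) fun a => u a i)) ≤ ε * (√n + τ * √n) := by
        calc _ ≤ l2 (fun i => ε * (1 + siteSize F k u0 M i ^ 2)) := l2_mono_of_le fun i => by
              refine (hFG m (by omega) _).trans (mul_le_mul_of_nonneg_left ?_ hε)
              refine add_le_add le_rfl (pow_le_pow_left₀ (by positivity) ?_ 2)
              have := abs_orbit_add_norm_orbitArg_le (F := F) (M := M) (u0 := u0) hm i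
              rwa [orbit_succ'] at this
          _ ≤ _ := by
              rw [l2_smul, abs_of_nonneg hε]
              refine mul_le_mul_of_nonneg_left ((l2_add _ _).trans
                (add_le_add ?_ (l2_siteSize_sq_le hT hM))) hε
              simp [l2_const]
      have h2 : l2 (fun i => (M *ᵥ u m) i - (M *ᵥ v m) i) ≤ K * (c * ε * √n) := by
        have e2 : (fun i => (M *ᵥ u m) i - (M *ᵥ v m) i) = M *ᵥ (fun i => u m i - v m i) := by
          rw [show (fun i => u m i - v m i) = u m - v m from rfl, Matrix.mulVec_sub]; rfl
        rw [e2]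
        exact (l2_mulVec_le M _).trans (mul_le_mul hMK (IH m le_rfl) (l2_nonneg _) hK)
      have h3 : ∑ a ∈ Finset.range m, l2 (fun i => u a i - v a i) ≤ m * (c * ε * √n) := by
        refine (Finset.sum_le_card_nsmul _ _ _ fun a ha =>
          IH a (Finset.mem_range.1 ha).le).trans_eq ?_
        simp
      have h4 := l2_lipschitz_sub_le (hG m (by omega)) (M *ᵥ u m) (M *ᵥ v m) u v
      have h5 : L m * (l2 (fun i => (M *ᵥ u m) i - (M *ᵥ v m) i) +
          ∑ a ∈ Finset.range m, l2 (fun i => u a i - v a i)) ≤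
          L m * (K * (c * ε * √n) + m * (c * ε * √n)) := by gcongr
      rw [e]
      refine (l2_add _ _).trans ?_
      have h6 : 0 ≤ c * ε * √n := by positivity
      linarith

theorem exists_abs_average_sub_le (L : ℕ → ℝ≥0) (L' : ℝ≥0) (b : ℝ) {K T : ℝ} (hK : 0 ≤ K)
    (hT : 0 ≤ T) (k : ℕ) :
    ∃ c, 0 ≤ c ∧ ∀ (n : ℕ) (F G : (k : ℕ) → (Fin (k + 1) → ℝ) → ℝ)
      (φ ψ : (Fin (k + 1) → ℝ) → ℝ) (ε : ℝ)
      (M : Matrix (Fin n) (Fin n) ℝ) (u0 v0 : Fin n → ℝ), 0 ≤ ε →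
      (∀ j < k, LipschitzWith (L j) (G j)) →
      (∀ j < k, ∀ x, |F j x - G j x| ≤ ε * (1 + (|F j x| + ‖x‖) ^ 2)) →
      (∀ i, |u0 i - v0 i| ≤ ε * u0 i ^ 2) → opN M ≤ K → orbitMoment F k u0 M ≤ T →
      LipschitzWith L' φ → |φ 0| ≤ b → LipschitzWith L' ψ →
      (∀ x, |φ x - ψ x| ≤ ε * (1 + (|φ x| + ‖x‖) ^ 2)) →
      |(n : ℝ)⁻¹ * ∑ i, φ (fun j => orbit F M u0 j i) -
        (n : ℝ)⁻¹ * ∑ i, ψ (fun j => orbit G M v0 j i)| ≤ c * ε := by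
  obtain ⟨c, hc, h⟩ := exists_l2_orbit_sub_le L hK hT k
  set τ := √(8 * ((k : ℝ) + 1) ^ 3 * T) with hτ
  have hτ0 : 0 ≤ τ := Real.sqrt_nonneg _
  have hL : (0 : ℝ) ≤ L' := L'.2
  refine ⟨1 + 2 * b ^ 2 + 2 * (L' + 1) ^ 2 * τ + L' * ((k + 1) * c), by positivity,
    fun n F G φ ψ ε M u0 v0 hε hG hFG h0 hMK hM hφ hb hψ hφψ => ?_⟩
  rcases Nat.eq_zero_or_pos n with rfl | hn
  · simp; positivity
  have hn' : (0 : ℝ) < n := by exact_mod_cast hn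
  have hs : 0 < √(n : ℝ) := Real.sqrt_pos.2 hn'
  have IH := h n F G ε M u0 v0 hε hG hFG h0 hMK hM
  set u := orbit F M u0 with hu
  set v := orbit G M v0 with hv
  have h1 : l2 (fun i => φ (fun j => u j i) - ψ (fun j => u j i)) ≤
      ε * (√n * (1 + 2 * b ^ 2) + 2 * (L' + 1) ^ 2 * (τ * √n)) := by
    calc _ ≤ l2 (fun i => ε * ((1 + 2 * b ^ 2) + 2 * (L' + 1) ^ 2 * siteSize F k u0 M i ^ 2)) :=
          l2_mono_of_le fun i => by
            refine (hφψ _).trans (mul_le_mul_of_nonneg_left ?_ hε)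
            set x : Fin (k + 1) → ℝ := fun j => u j i with hx
            have hxS : ‖x‖ ≤ siteSize F k u0 M i := norm_orbit_le_siteSize i
            have h2 : |φ x| ≤ b + L' * ‖x‖ := by
              have h3 := hφ.norm_sub_le x 0
              rw [sub_zero, Real.norm_eq_abs] at h3
              linarith [abs_sub_abs_le_abs_sub (φ x) (φ 0)]
            have h4 : |φ x| + ‖x‖ ≤ b + (L' + 1) * siteSize F k u0 M i := by
              have := mul_le_mul_of_nonneg_left hxS (show (0 : ℝ) ≤ L' + 1 by positivity)
              linarith
            have h5 := pow_le_pow_left₀ (by positivity) h4 2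
            have h6 := sq_nonneg (b - (L' + 1) * siteSize F k u0 M i)
            nlinarith
      _ ≤ _ := by
          rw [l2_smul, abs_of_nonneg hε]
          refine mul_le_mul_of_nonneg_left ((l2_add _ _).trans (add_le_add ?_ ?_)) hε
          · rw [l2_const, abs_of_nonneg (by positivity), Fintype.card_fin]
          · rw [l2_smul, abs_of_nonneg (by positivity)]
            exact mul_le_mul_of_nonneg_left (l2_siteSize_sq_le hT hM) (by positivity)
  have h2 : l2 (fun i => ψ (fun j => u j i) - ψ (fun j => v j i)) ≤
      L' * ((k + 1) * (c * ε * √n)) := by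
    calc _ ≤ l2 (fun i => (L' : ℝ) * ∑ j : Fin (k + 1), |u j i - v j i|) := l2_mono_of_le fun i =>
          (hψ.norm_sub_le _ _).trans (mul_le_mul_of_nonneg_left (norm_pi_le_sum _) hL)
      _ = L' * l2 (fun i => ∑ j : Fin (k + 1), |u j i - v j i|) := by
          rw [l2_smul, abs_of_nonneg hL]
      _ ≤ L' * ∑ j : Fin (k + 1), l2 (fun i => |u j i - v j i|) := by
          gcongr; exact l2_sum _ _
      _ ≤ L' * ∑ j : Fin (k + 1), c * ε * √n := by
          gcongr with j
          rw [l2_abs]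
          exact IH j (Nat.lt_succ_iff.1 j.2)
      _ = _ := by simp
  have h3 := (l2_add (fun i => φ (fun j => u j i) - ψ (fun j => u j i))
    (fun i => ψ (fun j => u j i) - ψ (fun j => v j i))).trans (add_le_add h1 h2)
  simp only [sub_add_sub_cancel] at h3
  have h4 := abs_sum_le_l2 fun i => φ (fun j => u j i) - ψ (fun j => v j i)
  rw [Fintype.card_fin] at h4
  rw [← mul_sub, ← Finset.sum_sub_distrib, abs_mul, abs_of_pos (inv_pos.2 hn'),
    inv_mul_le_iff₀ hn']
  refine (h4.trans (mul_le_mul_of_nonneg_left h3 hs.le)).trans_eq ?_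
  have h5 : √(n : ℝ) * √n = n := Real.mul_self_sqrt hn'.le
  linear_combination ((1 + 2 * b ^ 2 + 2 * (L' + 1) ^ 2 * τ + L' * ((k + 1) * c)) * ε) * h5

end stability

/-- A vector with the entries of absolute value larger than `B` replaced by zero. -/
noncomputable def truncVec {n : ℕ} (B : ℝ) (u : Fin n → ℝ) (i : Fin n) : ℝ :=
  if |u i| ≤ B then u i else 0

theorem abs_truncVec_le {n : ℕ} {B : ℝ} (hB : 0 ≤ B) (u : Fin n → ℝ) (i : Fin n) :
    |truncVec B u i| ≤ B := by
  unfold truncVec; split_ifs with h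
  · exact h
  · simpa using hB

theorem abs_sub_truncVec_le {n : ℕ} {B ε : ℝ} (hε : 0 < ε) (hB : ε⁻¹ ≤ B) (u : Fin n → ℝ)
    (i : Fin n) : |u i - truncVec B u i| ≤ ε * u i ^ 2 := by
  unfold truncVec; split_ifs with h
  · simp; positivity
  · have h1 : ε⁻¹ ≤ |u i| := hB.trans (not_le.1 h).le
    rw [inv_le_iff_one_le_mul₀ hε] at h1
    rw [sub_zero, ← sq_abs]
    nlinarith [abs_nonneg (u i)]

theorem exists_truncated_average {F : (k : ℕ) → (Fin (k + 1) → ℝ) → ℝ} {L : ℕ → ℝ≥0}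
    (hF : ∀ k, LipschitzWith (L k) (F k)) {k : ℕ} {φ : (Fin (k + 1) → ℝ) → ℝ} {L' : ℝ≥0}
    (hφ : LipschitzWith L' φ) {K T η : ℝ} (hK : 0 ≤ K) (hT : 0 ≤ T) (hη : 0 < η) :
    ∃ (G : (k : ℕ) → (Fin (k + 1) → ℝ) → ℝ) (ψ : (Fin (k + 1) → ℝ) → ℝ) (KG : ℕ → ℝ)
      (Kψ B B' : ℝ), (∀ j, SmoothBdd (G j) (KG j)) ∧ (∀ j x, |G j x| ≤ B) ∧ SmoothBdd ψ Kψ ∧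
      (∀ x, |ψ x| ≤ B') ∧ 0 ≤ B ∧
      ∀ (n : ℕ) (M : Matrix (Fin n) (Fin n) ℝ) (u0 : Fin n → ℝ), opN M ≤ K →
        orbitMoment F k u0 M ≤ T →
        |(n : ℝ)⁻¹ * ∑ i, φ (fun j => orbit F M u0 j i) -
          (n : ℝ)⁻¹ * ∑ i, ψ (fun j => orbit G M (truncVec B u0) j i)| ≤ η := by
  obtain ⟨c, hc, h⟩ := exists_abs_average_sub_le (fun j => max (L j) 1) (max L' 1) |φ 0| hK hT k
  set ε := η / (c + 1) with hε
  have hε0 : 0 < ε := by positivity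
  choose g Kg Bg hg1 hg2 hg3 hg4 using fun j => exists_truncation (hF j) hε0 (inv_pos.2 hε0)
  choose K₀ hK₀ using fun j => exists_smoothBdd_of_hasCompactSupport
    (E := Fin (j + 1) → ℝ) (h := fun _ => (0 : ℝ)) contDiff_const HasCompactSupport.zero
  obtain ⟨ψ, Kψ, B', hψ1, hψ2, hψ3, hψ4⟩ := exists_truncation hφ hε0 (inv_pos.2 hε0)
  have hB0 : 0 ≤ ∑ j ∈ Finset.range k, |Bg j| := Finset.sum_nonneg fun _ _ => abs_nonneg _
  -- The sum dominates the bounds of the functions in use. The summand `ε⁻¹` makes the truncation of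
  -- the initial vector cost at most `ε * u i ^ 2`.
  set B := ∑ j ∈ Finset.range k, |Bg j| + ε⁻¹ with hB
  have hB0' : 0 ≤ B := by positivity
  -- The functions with index `k` and beyond do not enter the orbit up to time `k`; setting them to
  -- zero gives one bound `B` for all indices.
  refine ⟨fun j => if j < k then g j else fun _ => 0, ψ, fun j => if j < k then Kg j else K₀ j, Kψ,
    B, B', fun j => ?_, fun j x => ?_, hψ1, hψ3, hB0', fun n M u0 hMK hM => ?_⟩
  · by_cases hj : j < k
    · simp only [hj, if_true]; exact hg1 j
    · simp only [hj, if_false]; exact hK₀ j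
  · by_cases hj : j < k
    · simp only [hj, if_true]
      refine (hg3 j x).trans ((le_abs_self _).trans ?_)
      have := Finset.single_le_sum (f := fun j => |Bg j|) (fun _ _ => abs_nonneg _)
        (Finset.mem_range.2 hj)
      have h2 : 0 < ε⁻¹ := inv_pos.2 hε0
      rw [hB]; linarith
    · simp only [hj, if_false, abs_zero]; exact hB0'
  · have hlast : c * ε ≤ η := by
      rw [hε, mul_div_assoc', div_le_iff₀ (by positivity)]
      nlinarith
    refine (h n F (fun j => if j < k then g j else fun _ => 0) φ ψ ε M u0 (truncVec B u0) hε0.le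
      (fun j hj => ?_) (fun j hj x => ?_) (fun i => abs_sub_truncVec_le hε0 ?_ u0 i) hMK hM
      (hφ.weaken (le_max_left _ _)) le_rfl hψ2 (fun x => ?_)).trans hlast
    · simp only [hj, if_true]; exact hg2 j
    · simp only [hj, if_true]
      refine (hg4 j x).trans_eq ?_
      rw [div_inv_eq_mul]; ring
    · rw [hB]; linarith
    · refine (hψ4 x).trans_eq ?_
      rw [div_inv_eq_mul]; ring

end GenAMP

namespace GenAMP

/-! ### Comparison for fixed data -/

theorem tendsto_inv_sqrt_nat : Tendsto (fun n : ℕ => (√(n : ℝ))⁻¹) atTop (𝓝 0) :=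
  tendsto_inv_atTop_zero.comp (Real.tendsto_sqrt_atTop.comp tendsto_natCast_atTop_atTop)

theorem tendsto_inv_sqrt_mul_log :
    Tendsto (fun n : ℕ => (√(n : ℝ))⁻¹ * (1 + Real.log ((n : ℝ) ^ 2))) atTop (𝓝 0) := by
  have h1 : Tendsto (fun x : ℝ => Real.log x / √x) atTop (𝓝 0) := by
    have := (isLittleO_log_rpow_atTop (show (0 : ℝ) < 1 / 2 by norm_num)).tendsto_div_nhds_zero
    simpa only [Real.sqrt_eq_rpow] using this
  have h2 := (h1.comp tendsto_natCast_atTop_atTop).const_mul 2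
  have h3 := tendsto_inv_sqrt_nat.add h2
  rw [mul_zero, add_zero] at h3
  refine h3.congr fun n => ?_
  simp only [Function.comp, Real.log_pow]
  push_cast
  ring

section empAverage
variable {n k : ℕ} {F : (k : ℕ) → (Fin (k + 1) → ℝ) → ℝ} {φ : (Fin (k + 1) → ℝ) → ℝ}

theorem continuous_empAverage (hF : ∀ k, Continuous (F k)) (hφ : Continuous φ) :
    Continuous fun q : (Fin n → ℝ) × Matrix (Fin n) (Fin n) ℝ × Matrix (Fin n) (Fin n) ℝ =>
      empAverage F k φ q.1 q.2.1 q.2.2 := by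
  unfold empAverage
  refine continuous_const.mul (continuous_finsetSum _ fun i _ => hφ.comp (continuous_pi fun j => ?_))
  have h : Continuous fun q : (Fin n → ℝ) × Matrix (Fin n) (Fin n) ℝ × Matrix (Fin n) (Fin n) ℝ =>
      (hatMatrix q.2.2 q.2.1, q.1) := by
    unfold hatMatrix; fun_prop
  exact (continuous_apply i).comp ((continuous_orbit hF j).comp h)

theorem continuous_empAverage_symM (hF : ∀ k, Continuous (F k)) (hφ : Continuous φ)
    (u0 : Fin n → ℝ) (Z : Matrix (Fin n) (Fin n) ℝ) :
    Continuous fun x : Pair n → ℝ => empAverage F k φ u0 Z (symM x) :=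
  (continuous_empAverage hF hφ).comp (f := fun x : Pair n → ℝ => (u0, Z, symM x))
    (by unfold symM; fun_prop)

theorem abs_empAverage_le {B : ℝ} (hB : ∀ x, |φ x| ≤ B) (u0 : Fin n → ℝ)
    (Z X : Matrix (Fin n) (Fin n) ℝ) : |empAverage F k φ u0 Z X| ≤ B := by
  have hB0 : 0 ≤ B := (abs_nonneg _).trans (hB 0)
  rcases Nat.eq_zero_or_pos n with rfl | hn
  · simpa [empAverage] using hB0
  have hn' : (0 : ℝ) < n := by exact_mod_cast hn
  rw [empAverage, abs_mul, abs_of_pos (inv_pos.2 hn'), inv_mul_le_iff₀ hn']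
  refine (Finset.abs_sum_le_sum_abs _ _).trans
    ((Finset.sum_le_card_nsmul _ _ _ fun i _ => hB _).trans_eq ?_)
  simp

end empAverage

section chebyshev
variable {α β : Type*} [MeasurableSpace α] [MeasurableSpace β] {μ : Measure α} {ν : Measure β}
  [IsProbabilityMeasure μ] [IsProbabilityMeasure ν] {f : α → ℝ} {g : β → ℝ}

/-- Chebyshev's inequality for the difference of two independent bounded variables. -/
theorem sq_mul_measureReal_le_variance {B : ℝ} (hf : Measurable f) (hg : Measurable g)
    (hfB : ∀ x, |f x| ≤ B) (hgB : ∀ x, |g x| ≤ B) {a : ℝ} (ha : 0 ≤ a) :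
    a ^ 2 * (μ.prod ν).real {p | a ≤ |f p.1 - g p.2|} ≤
      (∫ x, f x ^ 2 ∂μ - (∫ x, f x ∂μ) ^ 2) + (∫ y, g y ^ 2 ∂ν - (∫ y, g y ∂ν) ^ 2) +
        (∫ x, f x ∂μ - ∫ y, g y ∂ν) ^ 2 := by
  have hf1 : Integrable f μ := Integrable.of_bound hf.aestronglyMeasurable B (ae_of_all _ hfB)
  have hg1 : Integrable g ν := Integrable.of_bound hg.aestronglyMeasurable B (ae_of_all _ hgB)
  have hf2 : Integrable (fun x => f x ^ 2) μ :=
    Integrable.of_bound (hf.pow_const 2).aestronglyMeasurable (B ^ 2) (ae_of_all _ fun x => by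
      rw [norm_pow]; exact pow_le_pow_left₀ (norm_nonneg _) (hfB x) 2)
  have hg2 : Integrable (fun x => g x ^ 2) ν :=
    Integrable.of_bound (hg.pow_const 2).aestronglyMeasurable (B ^ 2) (ae_of_all _ fun x => by
      rw [norm_pow]; exact pow_le_pow_left₀ (norm_nonneg _) (hgB x) 2)
  have e : ∀ p : α × β, (f p.1 - g p.2) ^ 2 = f p.1 ^ 2 + g p.2 ^ 2 - 2 * (f p.1 * g p.2) :=
    fun p => by ring
  have i1 : Integrable (fun p : α × β => f p.1 ^ 2) (μ.prod ν) := hf2.comp_fst ν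
  have i2 : Integrable (fun p : α × β => g p.2 ^ 2) (μ.prod ν) := hg2.comp_snd μ
  have i3 : Integrable (fun p : α × β => 2 * (f p.1 * g p.2)) (μ.prod ν) :=
    (hf1.mul_prod hg1).const_mul 2
  have hint : Integrable (fun p : α × β => (f p.1 - g p.2) ^ 2) (μ.prod ν) := by
    simp only [e]; exact (i1.fun_add i2).sub i3
  have hM := mul_meas_ge_le_integral_of_nonneg (ae_of_all _ fun p : α × β =>
    sq_nonneg (f p.1 - g p.2)) hint (a ^ 2)
  have hval : ∫ p, (f p.1 - g p.2) ^ 2 ∂(μ.prod ν) =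
      ∫ x, f x ^ 2 ∂μ + ∫ y, g y ^ 2 ∂ν - 2 * ((∫ x, f x ∂μ) * ∫ y, g y ∂ν) := by
    simp only [e]
    rw [integral_sub (i1.fun_add i2) i3, integral_add i1 i2, integral_const_mul, integral_prod_mul,
      integral_fun_fst (fun x => f x ^ 2), integral_fun_snd (fun y => g y ^ 2)]
    simp
  have hset : {p : α × β | a ≤ |f p.1 - g p.2|} ⊆ {p | a ^ 2 ≤ (f p.1 - g p.2) ^ 2} :=
    fun p hp => by
      change a ^ 2 ≤ _
      rw [← sq_abs (f p.1 - g p.2)]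
      exact pow_le_pow_left₀ ha hp 2
  have h1 := mul_le_mul_of_nonneg_left (measureReal_mono (μ := μ.prod ν) hset) (sq_nonneg a)
  rw [hval] at hM
  linarith

end chebyshev

/-- The two variances and the squared difference of the means all tend to zero. The constants
involve the data only through the bounds on `u0` and on the norm of `Z`. -/
theorem exists_sq_mul_measureReal_le {G : (k : ℕ) → (Fin (k + 1) → ℝ) → ℝ} {B B' κ : ℝ} {KG : ℕ → ℝ}
    (hG : ∀ k, SmoothBdd (G k) (KG k)) (hGB : ∀ k x, |G k x| ≤ B) {k : ℕ}
    {ψ : (Fin (k + 1) → ℝ) → ℝ} {Kψ : ℝ} (hψ : SmoothBdd ψ Kψ) (hψB : ∀ x, |ψ x| ≤ B')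
    (s : ℝ≥0) :
    ∃ C₁ C₂ : ℝ, ∀ (n : ℕ) (μ ν : Pair n → Measure ℝ) [∀ m, IsProbabilityMeasure (μ m)]
      [∀ m, IsProbabilityMeasure (ν m)], 0 < n → (∀ m, StdSubgaussian s (μ m)) →
      (∀ m, StdSubgaussian s (ν m)) → ∀ (u0 : Fin n → ℝ) (Z : Matrix (Fin n) (Fin n) ℝ),
      (∀ l, |u0 l| ≤ B) → (n : ℝ)⁻¹ * opN Z ≤ 1 + κ → ∀ a, 0 ≤ a →
        a ^ 2 * ((Measure.pi μ).prod (Measure.pi ν)).real {p | a ≤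
          |empAverage G k ψ u0 Z (symM p.1) - empAverage G k ψ u0 Z (symM p.2)|} ≤
        C₁ * (√(n : ℝ))⁻¹ + (C₂ * ((√(n : ℝ))⁻¹ * (1 + Real.log ((n : ℝ) ^ 2)))) ^ 2 := by
  obtain ⟨C, hC, p, h⟩ := exists_entryBounds hG hGB k hψ
  set M₁ := opMoment s (1 + κ) (2 * p + 4) with hM₁
  set M₂ := opMoment s (1 + κ) (p + 4) with hM₂
  set C₁ := C ^ 2 * (2 * M₁ + 4 ^ (p + 1) * (3 ^ (2 * p + 4) *
        (M₁ + 2 * momentBound s (2 * p + 4)))) with hC₁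
  set C₂ := C * ((momentBound s 3 + 1) * M₂ +
        2 ^ (p + 2) * 3 ^ (p + 4) * (M₂ + 2 * momentBound s (p + 4))) with hC₂
  refine ⟨2 * C₁, C₂, fun n μ ν _ _ hn hμ hν u0 Z hu hZ a ha => ?_⟩
  have hE := h n Z u0 hu
  have hGc : ∀ k, Continuous (G k) := fun k => (hG k).smooth.continuous
  have hm := (continuous_empAverage_symM (n := n) hGc hψ.smooth.continuous u0 Z).measurable
  have hB : ∀ x : Pair n → ℝ, |empAverage G k ψ u0 Z (symM x)| ≤ B' := fun x =>
    abs_empAverage_le hψB u0 Z _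
  have hℓ1 : ∀ x : Pair n → ℝ, 1 ≤ 1 + opN (hatMatrix (symM x) Z) := fun x =>
    le_add_of_nonneg_right (opN_nonneg _)
  have v1 := hE.variance_le hC hℓ1 one_add_opN_update_le hn hμ hm hB
    (integrable_one_add_opN_pow hn hμ hZ _) (integral_one_add_opN_pow_le hn hμ hZ _)
  have v2 := hE.variance_le hC hℓ1 one_add_opN_update_le hn hν hm hB
    (integrable_one_add_opN_pow hn hν hZ _) (integral_one_add_opN_pow_le hn hν hZ _)
  have hpw : ∀ (S : Finset (Pair n)) m, StdSubgaussian s (S.piecewise ν μ m) := fun S =>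
    StdSubgaussian.piecewise hμ hν S
  have v3 := hE.abs_integral_pi_sub_le hC hℓ1 one_add_opN_update_le hn hμ hν hm hB
    (fun S => integrable_one_add_opN_pow hn (hpw S) hZ _)
    (fun S => integral_one_add_opN_pow_le hn (hpw S) hZ _)
  have hch := sq_mul_measureReal_le_variance (μ := Measure.pi μ) (ν := Measure.pi ν) hm hm hB hB ha
  rw [abs_sub_comm] at v3
  have v4 := pow_le_pow_left₀ (abs_nonneg _) v3 2
  rw [sq_abs] at v4
  refine hch.trans ?_
  rw [← hM₁, ← hC₁] at v1 v2
  rw [← hM₂, ← hC₂] at v4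
  linarith

/-- The order of choice matters: the levels `K`, `T` from tightness, then the truncated functions,
which do not depend on `n`, and then the threshold `N`. Outside two exceptional events of
probability at most `δ / 4`, each truncation costs `ε / 4`, and the truncated averages differ by `ε
/ 2` with probability at most `δ / 2`. -/
theorem exists_compare {F : (k : ℕ) → (Fin (k + 1) → ℝ) → ℝ} {L : ℕ → ℝ≥0}
    (hF : ∀ k, LipschitzWith (L k) (F k)) {k : ℕ} {φ : (Fin (k + 1) → ℝ) → ℝ} {L' : ℝ≥0}
    (hφ : LipschitzWith L' φ) (s : ℝ≥0) {κ ε δ : ℝ} (hκ : 0 ≤ κ) (hε : 0 < ε) (hδ : 0 < δ) :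
    ∃ N : ℕ, ∀ n, N ≤ n → ∀ (μ ν : Pair n → Measure ℝ) [∀ m, IsProbabilityMeasure (μ m)]
      [∀ m, IsProbabilityMeasure (ν m)], (∀ m, StdSubgaussian s (μ m)) →
      (∀ m, StdSubgaussian s (ν m)) → ∀ (u0 : Fin n → ℝ) (Z : Matrix (Fin n) (Fin n) ℝ),
      GoodData κ u0 Z → ((Measure.pi μ).prod (Measure.pi ν)).real {p | ε ≤
        |empAverage F k φ u0 Z (symM p.1) - empAverage F k φ u0 Z (symM p.2)|} ≤ δ := by
  obtain ⟨K, T, hK, hT, htight⟩ := exists_tight hF s hκ (show 0 < δ / 4 by linarith) k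
  obtain ⟨G, ψ, KG, Kψ, B, B', hG, hGB, hψ, hψB, hB, htr⟩ :=
    exists_truncated_average hF hφ hK hT (show 0 < ε / 4 by linarith)
  obtain ⟨C₁, C₂, hsm⟩ := exists_sq_mul_measureReal_le (κ := κ) hG hGB hψ hψB s
  have hlim : Tendsto (fun n : ℕ => C₁ * (√(n : ℝ))⁻¹ +
      (C₂ * ((√(n : ℝ))⁻¹ * (1 + Real.log ((n : ℝ) ^ 2)))) ^ 2) atTop (𝓝 0) := by
    have := (tendsto_inv_sqrt_nat.const_mul C₁).add
      ((tendsto_inv_sqrt_mul_log.const_mul C₂).pow 2)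
    simpa using this
  obtain ⟨N, hN⟩ := eventually_atTop.1
    (hlim.eventually_le_const (show 0 < (ε / 2) ^ 2 * (δ / 2) by positivity))
  refine ⟨max N 1, fun n hn μ ν _ _ hμ hν u0 Z hd => ?_⟩
  have hn0 : 0 < n := lt_of_lt_of_le one_pos ((le_max_right _ _).trans hn)
  set P := (Measure.pi μ).prod (Measure.pi ν) with hP
  set bad : Set (Pair n → ℝ) := {x | ¬(opN (hatMatrix (symM x) Z) ≤ K ∧
    orbitMoment F k u0 (hatMatrix (symM x) Z) ≤ T)} with hbad
  have h1 := htight n μ hn0 hμ u0 Z hd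
  have h2 := htight n ν hn0 hν u0 Z hd
  have h3 := (hsm n μ ν hn0 hμ hν (truncVec B u0) Z (abs_truncVec_le hB u0)
    (hd.opN_signal_le hκ) (ε / 2) (by linarith)).trans (hN n ((le_max_left _ _).trans hn))
  have h4 := le_of_mul_le_mul_left h3 (by positivity)
  have h5 : P.real (bad ×ˢ Set.univ) ≤ δ / 4 := by
    rw [hP, measureReal_prod_prod, probReal_univ, mul_one]; exact h1
  have h6 : P.real (Set.univ ×ˢ bad) ≤ δ / 4 := by
    rw [hP, measureReal_prod_prod, probReal_univ, one_mul]; exact h2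
  have hgood : ∀ x, x ∉ bad → |empAverage F k φ u0 Z (symM x) -
      empAverage G k ψ (truncVec B u0) Z (symM x)| ≤ ε / 4 := fun x hx => by
    have hx' : opN (hatMatrix (symM x) Z) ≤ K ∧ orbitMoment F k u0 (hatMatrix (symM x) Z) ≤ T :=
      not_not.1 hx
    exact htr n _ u0 hx'.1 hx'.2
  have hsub : {p : (Pair n → ℝ) × (Pair n → ℝ) | ε ≤
      |empAverage F k φ u0 Z (symM p.1) - empAverage F k φ u0 Z (symM p.2)|} ⊆
      (bad ×ˢ Set.univ ∪ Set.univ ×ˢ bad) ∪ {p | ε / 2 ≤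
        |empAverage G k ψ (truncVec B u0) Z (symM p.1) -
          empAverage G k ψ (truncVec B u0) Z (symM p.2)|} := fun p hp => by
    by_cases hb1 : p.1 ∈ bad
    · exact Or.inl (Or.inl ⟨hb1, trivial⟩)
    by_cases hb2 : p.2 ∈ bad
    · exact Or.inl (Or.inr ⟨trivial, hb2⟩)
    refine Or.inr ?_
    have g1 := abs_le.1 (hgood p.1 hb1)
    have g2 := abs_le.1 (hgood p.2 hb2)
    change ε ≤ |_| at hp
    change ε / 2 ≤ |_|
    rw [le_abs] at hp ⊢
    rcases hp with hp | hp
    · left; linarith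
    · right; linarith
  refine (measureReal_mono hsub).trans ((measureReal_union_le _ _).trans ?_)
  have := measureReal_union_le (μ := P) (bad ×ˢ Set.univ) (Set.univ ×ˢ bad)
  linarith

end GenAMP

namespace GenAMP

/-! ### Laws of the noise matrices -/

theorem StdSubgaussian.mono {s s' : ℝ≥0} {μ : Measure ℝ} (h : StdSubgaussian s μ) (hs : s ≤ s') :
    StdSubgaussian s' μ :=
  ⟨h.prob, h.mean, h.second, hasSubgaussianMGF_mono h.subgaussian hs⟩

theorem stdSubgaussian_map {Ω : Type*} [MeasurableSpace Ω] {P : Measure Ω} [IsProbabilityMeasure P]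
    {X : Ω → ℝ} {s : ℝ≥0} (hX : Measurable X) (h0 : ∫ ω, X ω ∂P = 0) (h1 : variance X P = 1)
    (hs : HasSubgaussianMGF X s P) : StdSubgaussian s (P.map X) where
  prob := Measure.isProbabilityMeasure_map hX.aemeasurable
  mean := by rw [integral_map hX.aemeasurable (by fun_prop)]; exact h0
  second := by
    rw [integral_map hX.aemeasurable (by fun_prop)]
    have h2 := variance_eq_sub (hs.memLp 2)
    rw [h1, h0] at h2
    simpa using h2.symm
  subgaussian := (HasSubgaussianMGF.id_map_iff hX.aemeasurable).2 hs

theorem stdSubgaussian_gaussianReal : StdSubgaussian 1 (gaussianReal 0 1) := by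
  have h := stdSubgaussian_map (P := gaussianReal 0 1) (s := 1) measurable_id
    (by simp) (by simp)
    ⟨fun t => integrable_exp_mul_gaussianReal t, fun t => by rw [mgf_id_gaussianReal]; simp⟩
  rwa [Measure.map_id] at h

section noise
variable {Ω : Type*} [MeasurableSpace Ω] {P : Measure Ω} [IsProbabilityMeasure P] {n : ℕ}
  {A : Ω → Matrix (Fin n) (Fin n) ℝ}

/-- The entries of a matrix on and above the diagonal. -/
def upperEntries {n : ℕ} (M : Matrix (Fin n) (Fin n) ℝ) (m : Pair n) : ℝ := M m.1.1 m.1.2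

theorem symM_upperEntries {M : Matrix (Fin n) (Fin n) ℝ} (h : M.IsSymm) :
    symM (upperEntries M) = M := by
  funext i j
  simp only [symM, upperEntries, pairOf]
  rcases le_total i j with hij | hij
  · rw [min_eq_left hij, max_eq_right hij]
  · rw [min_eq_right hij, max_eq_left hij]; exact h.apply i j

theorem IsSymmIndep.map_upperEntries (h : IsSymmIndep P A) :
    P.map (fun ω => upperEntries (A ω)) =
      Measure.pi fun m : Pair n => P.map fun ω => A ω m.1.1 m.1.2 :=
  (iIndepFun_iff_map_fun_eq_pi_map fun m : Pair n => (h.measurable m.1.1 m.1.2).aemeasurable).1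
    h.indep

theorem IsSubgaussianNoise.stdSubgaussian {σ : ℝ≥0} (h : IsSubgaussianNoise P σ A) (i j : Fin n) :
    StdSubgaussian (σ ^ 2) (P.map fun ω => A ω i j) :=
  stdSubgaussian_map (h.measurable i j) (h.mean_zero i j) (h.unit_variance i j) (h.subgaussian i j)

end noise

/-! ### Random data -/

theorem pow_four_le_exp {σ : ℝ} (hσ : 0 < σ) (t : ℝ) :
    t ^ 4 ≤ 24 * σ ^ 4 * Real.exp (|t| / σ) := by
  have h := Real.pow_div_factorial_le_exp (|t| / σ) (by positivity) 4
  rw [div_pow, Even.pow_abs (by decide), show ((4 : ℕ).factorial : ℝ) = 24 by norm_num [Nat.factorial],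
    div_div, div_le_iff₀ (by positivity)] at h
  linarith

/-- Markov's inequality for the sum of fourth powers, each of mean at most `4! * σ ^ 4 * C`. No
independence between the variables is needed. -/
theorem measure_lt_sum_pow_four_le {Ω ι : Type*} [MeasurableSpace Ω] {P : Measure Ω} [Fintype ι]
    [Nonempty ι] {f : ι → Ω → ℝ} {σ C : ℝ≥0} (hσ : 0 < σ) (hf : ∀ i, Measurable (f i))
    (h : ∀ i, ∫⁻ ω, ENNReal.ofReal (Real.exp (|f i ω| / σ)) ∂P ≤ C) {κ : ℝ} (hκ : 0 < κ) :
    P {ω | κ * Fintype.card ι < ∑ i, f i ω ^ 4} ≤ ENNReal.ofReal (24 * σ ^ 4 * C / κ) := by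
  have hN : (0 : ℝ) < Fintype.card ι := by exact_mod_cast Fintype.card_pos
  have h1 : ∫⁻ ω, ENNReal.ofReal (∑ i, f i ω ^ 4) ∂P ≤
      ENNReal.ofReal (Fintype.card ι * (24 * σ ^ 4 * C)) := by
    calc _ = ∫⁻ ω, ∑ i, ENNReal.ofReal (f i ω ^ 4) ∂P := by
          refine lintegral_congr fun ω => ENNReal.ofReal_sum_of_nonneg fun i _ => by positivity
      _ = ∑ i, ∫⁻ ω, ENNReal.ofReal (f i ω ^ 4) ∂P :=
          lintegral_finsetSum _ fun i _ => ((hf i).pow_const 4).ennreal_ofReal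
      _ ≤ ∑ _i : ι, ENNReal.ofReal (24 * σ ^ 4) * C := by
          refine Finset.sum_le_sum fun i _ => ?_
          calc _ ≤ ∫⁻ ω, ENNReal.ofReal (24 * σ ^ 4) * ENNReal.ofReal (Real.exp (|f i ω| / σ)) ∂P := by
                refine lintegral_mono fun ω => ?_
                rw [← ENNReal.ofReal_mul (by positivity)]
                exact ENNReal.ofReal_le_ofReal (pow_four_le_exp (by exact_mod_cast hσ) _)
            _ ≤ _ := by
                rw [lintegral_const_mul' _ _ ENNReal.ofReal_ne_top]
                gcongr
                exact h i
      _ = _ := by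
          rw [Finset.sum_const, Finset.card_univ, nsmul_eq_mul, ENNReal.ofReal_mul hN.le,
            ENNReal.ofReal_natCast, ENNReal.ofReal_mul (p := 24 * (σ : ℝ) ^ 4) (by positivity),
            ENNReal.ofReal_coe_nnreal]
  have hm : Measurable fun ω => ENNReal.ofReal (∑ i, f i ω ^ 4) :=
    (Finset.measurable_fun_sum _ fun i _ => (hf i).pow_const 4).ennreal_ofReal
  have h2 := mul_meas_ge_le_lintegral (μ := P) hm (ENNReal.ofReal (κ * Fintype.card ι))
  have hpos : 0 < κ * Fintype.card ι := by positivity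
  have h3 : P {ω | κ * Fintype.card ι < ∑ i, f i ω ^ 4} ≤
      P {ω | ENNReal.ofReal (κ * Fintype.card ι) ≤ ENNReal.ofReal (∑ i, f i ω ^ 4)} :=
    measure_mono fun ω hω => ENNReal.ofReal_le_ofReal (le_of_lt hω)
  refine h3.trans ?_
  rw [← ENNReal.mul_le_mul_iff_right (ENNReal.ofReal_pos.2 hpos).ne' ENNReal.ofReal_ne_top]
  refine (h2.trans h1).trans (le_of_eq ?_)
  rw [← ENNReal.ofReal_mul hpos.le]
  congr 1
  field_simp

section data
variable {Ω : Type*} [MeasurableSpace Ω] {P : Measure Ω} {n : ℕ}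

/-- The space of pairs of an initial vector and a signal. -/
abbrev Data (n : ℕ) : Type := (Fin n → ℝ) × (Fin n → Fin n → ℝ)

theorem measurableSet_goodData (κ : ℝ) :
    MeasurableSet {d : Data n | GoodData κ d.1 (Matrix.of d.2)} := by
  have h : {d : Data n | GoodData κ d.1 (Matrix.of d.2)} =
      {d | ∑ i, d.1 i ^ 4 ≤ κ * n} ∩ {d | ∑ i, ∑ j, d.2 i j ^ 4 ≤ κ * n ^ 2} := by
    ext d
    exact ⟨fun h => ⟨h.init, h.signal⟩, fun h => ⟨h.1, h.2⟩⟩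
  rw [h]
  exact (measurableSet_le (by fun_prop) measurable_const).inter
    (measurableSet_le (by fun_prop) measurable_const)

theorem IsInitialData.measure_not_goodData_le {σ C : ℝ≥0} (hσ : 0 < σ) (hn : 0 < n)
    {u0 : Ω → Fin n → ℝ} {Z : Ω → Matrix (Fin n) (Fin n) ℝ} (h : IsInitialData P σ C u0 Z)
    {κ : ℝ} (hκ : 0 < κ) :
    P {ω | ¬GoodData κ (u0 ω) (Z ω)} ≤ 2 * ENNReal.ofReal (24 * σ ^ 4 * C / κ) := by
  have : Nonempty (Fin n) := ⟨⟨0, hn⟩⟩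
  have h1 := measure_lt_sum_pow_four_le hσ h.measurable_init h.exp_init_le hκ
  have h2 := measure_lt_sum_pow_four_le (f := fun (p : Fin n × Fin n) ω => Z ω p.1 p.2) hσ
    (fun p => h.measurable_signal p.1 p.2) (fun p => h.exp_signal_le p.1 p.2) hκ
  have hsub : {ω | ¬GoodData κ (u0 ω) (Z ω)} ⊆
      {ω | κ * Fintype.card (Fin n) < ∑ i, u0 ω i ^ 4} ∪
      {ω | κ * Fintype.card (Fin n × Fin n) < ∑ p : Fin n × Fin n, Z ω p.1 p.2 ^ 4} :=
    fun ω hω => by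
      by_contra hc
      rw [Set.mem_union, not_or, Set.mem_ofPred_eq, Set.mem_ofPred_eq, not_lt, not_lt] at hc
      refine hω ⟨?_, ?_⟩
      · simpa using hc.1
      · have := hc.2
        rw [Fintype.sum_prod_type] at this
        simpa [sq] using this
  refine (measure_mono hsub).trans ((measure_union_le _ _).trans ?_)
  rw [two_mul]
  exact add_le_add h1 h2

variable [IsProbabilityMeasure P]

theorem map_data_upperEntries {A : Ω → Matrix (Fin n) (Fin n) ℝ}
    {u0 : Ω → Fin n → ℝ} {Z : Ω → Matrix (Fin n) (Fin n) ℝ} (hA : IsSymmIndep P A)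
    (hD : Measurable fun ω => ((u0 ω, fun i j => Z ω i j) : Data n))
    (hind : IndepOfData P A u0 Z) :
    P.map (fun ω => (((u0 ω, fun i j => Z ω i j) : Data n), upperEntries (A ω))) =
      (P.map fun ω => ((u0 ω, fun i j => Z ω i j) : Data n)).prod
        (Measure.pi fun m : Pair n => P.map fun ω => A ω m.1.1 m.1.2) := by
  have hX : Measurable fun ω => upperEntries (A ω) :=
    measurable_pi_iff.2 fun m => hA.measurable _ _
  have h1 : IndepFun (fun ω => upperEntries (A ω))
      (fun ω => ((u0 ω, fun i j => Z ω i j) : Data n)) P :=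
    hind.comp (φ := fun (a : Fin n → Fin n → ℝ) (m : Pair n) => a m.1.1 m.1.2) (ψ := id)
      (by fun_prop) measurable_id
  rw [(indepFun_iff_map_prod_eq_prod_map_map hD.aemeasurable hX.aemeasurable).1 h1.symm,
    hA.map_upperEntries]

/-- The set where the empirical averages for two noise matrices differ by at least `ε`. -/
def compareSet {n : ℕ} (F : (k : ℕ) → (Fin (k + 1) → ℝ) → ℝ) (k : ℕ)
    (φ : (Fin (k + 1) → ℝ) → ℝ) (ε : ℝ) : Set (Data n × (Pair n → ℝ) × (Pair n → ℝ)) :=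
  {q | ε ≤ |empAverage F k φ q.1.1 (Matrix.of q.1.2) (symM q.2.1) -
      empAverage F k φ q.1.1 (Matrix.of q.1.2) (symM q.2.2)|}

theorem measurableSet_compareSet {F : (k : ℕ) → (Fin (k + 1) → ℝ) → ℝ}
    (hF : ∀ k, Continuous (F k)) {k : ℕ} {φ : (Fin (k + 1) → ℝ) → ℝ} (hφ : Continuous φ) (ε : ℝ) :
    MeasurableSet (compareSet (n := n) F k φ ε) := by
  have c1 : Continuous fun q : Data n × (Pair n → ℝ) × (Pair n → ℝ) =>
      empAverage F k φ q.1.1 (Matrix.of q.1.2) (symM q.2.1) :=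
    (continuous_empAverage hF hφ).comp (f := fun q : Data n × (Pair n → ℝ) × (Pair n → ℝ) =>
      (q.1.1, Matrix.of q.1.2, symM q.2.1)) (by unfold symM; fun_prop)
  have c2 : Continuous fun q : Data n × (Pair n → ℝ) × (Pair n → ℝ) =>
      empAverage F k φ q.1.1 (Matrix.of q.1.2) (symM q.2.2) :=
    (continuous_empAverage hF hφ).comp (f := fun q : Data n × (Pair n → ℝ) × (Pair n → ℝ) =>
      (q.1.1, Matrix.of q.1.2, symM q.2.2)) (by unfold symM; fun_prop)
  exact measurableSet_le measurable_const (c1.sub c2).abs.measurable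

theorem prod_apply_le_of_fiber {α β : Type*} [MeasurableSpace α] [MeasurableSpace β]
    {μ : Measure α} [IsProbabilityMeasure μ] {ν : Measure β} [IsProbabilityMeasure ν]
    {E : Set (α × β)} (hE : MeasurableSet E) {S : Set α} (hS : MeasurableSet S) {δ : ℝ}
    (h : ∀ a ∈ S, ν.real (Prod.mk a ⁻¹' E) ≤ δ) :
    (μ.prod ν) E ≤ ENNReal.ofReal δ + μ Sᶜ := by
  rw [Measure.prod_apply hE]
  calc _ ≤ ∫⁻ d, (ENNReal.ofReal δ + Sᶜ.indicator 1 d) ∂μ := by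
        refine lintegral_mono fun d => ?_
        by_cases hd : d ∈ S
        · refine le_add_right ?_
          rw [← ofReal_measureReal]
          exact ENNReal.ofReal_le_ofReal (h d hd)
        · refine le_add_left ?_
          rw [Set.indicator_of_mem (show d ∈ Sᶜ from hd)]
          exact prob_le_one
    _ = _ := by
        rw [lintegral_add_left measurable_const, lintegral_indicator_one hS.compl, lintegral_const,
          measure_univ, mul_one]

/-- The second factor `ρ` carries an auxiliary noise matrix. By independence the data, the noise and
the auxiliary matrix have a product law, so the estimate for fixed data applies on each fibre over
good data; bad data are charged to the last term. -/
theorem measure_compare_le {F : (k : ℕ) → (Fin (k + 1) → ℝ) → ℝ} (hF : ∀ k, Continuous (F k))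
    {k : ℕ} {φ : (Fin (k + 1) → ℝ) → ℝ} (hφ : Continuous φ) {A : Ω → Matrix (Fin n) (Fin n) ℝ}
    {u0 : Ω → Fin n → ℝ} {Z : Ω → Matrix (Fin n) (Fin n) ℝ} (hA : IsSymmIndep P A)
    (hu : ∀ i, Measurable fun ω => u0 ω i) (hZ : ∀ i j, Measurable fun ω => Z ω i j)
    (hind : IndepOfData P A u0 Z) (ρ : Measure (Pair n → ℝ)) [IsProbabilityMeasure ρ]
    {κ ε δ : ℝ}
    (h : ∀ (u : Fin n → ℝ) (z : Matrix (Fin n) (Fin n) ℝ), GoodData κ u z →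
      ((Measure.pi fun m : Pair n => P.map fun ω => A ω m.1.1 m.1.2).prod ρ).real {p | ε ≤
        |empAverage F k φ u z (symM p.1) - empAverage F k φ u z (symM p.2)|} ≤ δ) :
    (P.prod ρ) {p | ε ≤ |empAverage F k φ (u0 p.1) (Z p.1) (A p.1) -
        empAverage F k φ (u0 p.1) (Z p.1) (symM p.2)|} ≤
      ENNReal.ofReal δ + P {ω | ¬GoodData κ (u0 ω) (Z ω)} := by
  have hD : Measurable fun ω => ((u0 ω, fun i j => Z ω i j) : Data n) :=
    (measurable_pi_iff.2 hu).prodMk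
      (measurable_pi_iff.2 fun i => measurable_pi_iff.2 fun j => hZ i j)
  have hX : Measurable fun ω => upperEntries (A ω) :=
    measurable_pi_iff.2 fun m => hA.measurable _ _
  have hDX := map_data_upperEntries hA hD hind
  have hprob : ∀ m : Pair n, IsProbabilityMeasure (P.map fun ω => A ω m.1.1 m.1.2) := fun m =>
    Measure.isProbabilityMeasure_map (hA.measurable _ _).aemeasurable
  generalize hμ : (Measure.pi fun m : Pair n => P.map fun ω => A ω m.1.1 m.1.2) = μ at h hDX
  have hμp : IsProbabilityMeasure μ := by rw [← hμ]; infer_instance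
  have hDp := Measure.isProbabilityMeasure_map (μ := P) hD.aemeasurable
  have hE := measurableSet_compareSet (n := n) hF hφ ε
  have hmap : Measurable fun p : Ω × (Pair n → ℝ) =>
      (((u0 p.1, fun i j => Z p.1 i j) : Data n), upperEntries (A p.1), p.2) :=
    (hD.comp measurable_fst).prodMk ((hX.comp measurable_fst).prodMk measurable_snd)
  have hlaw : (P.prod ρ).map (fun p =>
      (((u0 p.1, fun i j => Z p.1 i j) : Data n), upperEntries (A p.1), p.2)) =
      (P.map fun ω => ((u0 ω, fun i j => Z ω i j) : Data n)).prod (μ.prod ρ) := by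
    rw [← Measure.prodAssoc_prod, ← hDX]
    nth_rw 2 [← Measure.map_id (μ := ρ)]
    rw [Measure.map_prod_map _ _ (hD.prodMk hX) measurable_id,
      Measure.map_map MeasurableEquiv.prodAssoc.measurable ((hD.prodMk hX).prodMap measurable_id)]
    rfl
  have hset : {p : Ω × (Pair n → ℝ) | ε ≤ |empAverage F k φ (u0 p.1) (Z p.1) (A p.1) -
        empAverage F k φ (u0 p.1) (Z p.1) (symM p.2)|} =
      (fun p => (((u0 p.1, fun i j => Z p.1 i j) : Data n), upperEntries (A p.1), p.2)) ⁻¹'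
        compareSet F k φ ε := by
    ext p
    have e : symM (upperEntries (A p.1)) = A p.1 := symM_upperEntries (hA.symm p.1)
    rw [Set.mem_preimage, compareSet, Set.mem_ofPred_eq, Set.mem_ofPred_eq, e]
    rfl
  have hS := measurableSet_goodData (n := n) κ
  rw [hset, ← Measure.map_apply hmap hE, hlaw]
  refine (prod_apply_le_of_fiber hE hS fun d hd => h d.1 (Matrix.of d.2) hd).trans_eq ?_
  rw [Measure.map_apply hD hS.compl]
  rfl

end data

end GenAMP

/-! ### Comparison with a common auxiliary Gaussian matrix -/

theorem theorem1 {Ω : ℕ → Type*} [∀ n, MeasurableSpace (Ω n)] (P : ∀ n, Measure (Ω n))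
    [∀ n, IsProbabilityMeasure (P n)]
    (F : (k : ℕ) → (Fin (k + 1) → ℝ) → ℝ) (hF : ∀ k, ∃ L : ℝ≥0, LipschitzWith L (F k))
    (σ C : ℝ≥0) (hσ : 0 < σ)
    (u0 : ∀ n, Ω n → Fin n → ℝ) (Z A G : ∀ n, Ω n → Matrix (Fin n) (Fin n) ℝ)
    (hdata : ∀ n, 1 ≤ n → GenAMP.IsInitialData (P n) σ C (u0 n) (Z n))
    (hA : ∀ n, 1 ≤ n → GenAMP.IsSubgaussianNoise (P n) σ (A n))
    (hG : ∀ n, 1 ≤ n → GenAMP.IsGaussianNoise (P n) (G n))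
    (hA_indep : ∀ n, 1 ≤ n → GenAMP.IndepOfData (P n) (A n) (u0 n) (Z n))
    (hG_indep : ∀ n, 1 ≤ n → GenAMP.IndepOfData (P n) (G n) (u0 n) (Z n))
    (k : ℕ) (φ : (Fin (k + 1) → ℝ) → ℝ) (hφ : ∃ L : ℝ≥0, LipschitzWith L φ) :
    ∀ ε : ℝ, 0 < ε →
      Tendsto (fun n => P n {ω | ε ≤ |GenAMP.empAverage F k φ (u0 n ω) (Z n ω) (A n ω)
        - GenAMP.empAverage F k φ (u0 n ω) (Z n ω) (G n ω)|}) atTop (𝓝 0) := by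
  intro ε hε
  choose L hL using hF
  obtain ⟨L', hL'⟩ := hφ
  rw [ENNReal.tendsto_atTop_zero]
  intro δ hδ
  obtain ⟨δ', hδ'0, hδ'⟩ := ENNReal.lt_iff_exists_nnreal_btwn.1 hδ
  have hδ0 : (0 : ℝ) < δ' := by exact_mod_cast hδ'0
  set c : ℝ := 24 * σ ^ 4 * C with hc
  have hc0 : 0 ≤ c := by positivity
  -- Chosen so that the probability of bad data, at most `2 * (c / κ)`, is at most `δ' / 4`.
  set κ : ℝ := 8 * (c + 1) / δ' with hκ
  have hκ0 : 0 < κ := by positivity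
  -- A common variance proxy for the given noise and for the standard normal law.
  set s : ℝ≥0 := max (σ ^ 2) 1 with hs
  obtain ⟨N, hN⟩ := GenAMP.exists_compare hL hL' s hκ0.le (half_pos hε)
    (show (0 : ℝ) < δ' / 4 by positivity)
  refine ⟨max N 1, fun n hn => ?_⟩
  have hn1 : 1 ≤ n := (le_max_right _ _).trans hn
  have hnN : N ≤ n := (le_max_left _ _).trans hn
  have hFc : ∀ k, Continuous (F k) := fun k => (hL k).continuous
  have hd := hdata n hn1
  set ν : GenAMP.Pair n → Measure ℝ := fun _ => gaussianReal 0 1 with hν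
  have hνs : ∀ m, GenAMP.StdSubgaussian s (ν m) := fun m =>
    GenAMP.stdSubgaussian_gaussianReal.mono (le_max_right _ _)
  have hpA : ∀ m : GenAMP.Pair n, IsProbabilityMeasure ((P n).map fun ω => A n ω m.1.1 m.1.2) :=
    fun m => Measure.isProbabilityMeasure_map ((hA n hn1).measurable _ _).aemeasurable
  have hpG : ∀ m : GenAMP.Pair n, IsProbabilityMeasure ((P n).map fun ω => G n ω m.1.1 m.1.2) :=
    fun m => Measure.isProbabilityMeasure_map ((hG n hn1).measurable _ _).aemeasurable
  have hA' := GenAMP.measure_compare_le hFc hL'.continuous (hA n hn1).toIsSymmIndep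
    hd.measurable_init hd.measurable_signal (hA_indep n hn1) (Measure.pi ν)
    (hN n hnN _ ν (fun m => ((hA n hn1).stdSubgaussian m.1.1 m.1.2).mono (le_max_left _ _)) hνs)
  have hG' := GenAMP.measure_compare_le hFc hL'.continuous (hG n hn1).toIsSymmIndep
    hd.measurable_init hd.measurable_signal (hG_indep n hn1) (Measure.pi ν)
    (hN n hnN _ ν (fun m => by rw [(hG n hn1).law]; exact hνs m) hνs)
  have hbad : P n {ω | ¬GenAMP.GoodData κ (u0 n ω) (Z n ω)} ≤ ENNReal.ofReal (δ' / 4) := by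
    refine (hd.measure_not_goodData_le hσ hn1 hκ0).trans ?_
    rw [← hc, show (2 : ℝ≥0∞) = ENNReal.ofReal 2 by simp, ← ENNReal.ofReal_mul (by norm_num)]
    refine ENNReal.ofReal_le_ofReal ?_
    rw [hκ]
    field_simp
    linarith
  -- The event is lifted to a product space with an independent Gaussian matrix. If the averages for
  -- `A` and `G` differ by `ε`, one of them differs by `ε / 2` from that of the auxiliary matrix.
  -- Each of these two events costs `δ' / 4` for the comparison and `δ' / 4` for bad data.
  set R := (P n).prod (Measure.pi ν) with hR
  have hfst : P n {ω | ε ≤ |GenAMP.empAverage F k φ (u0 n ω) (Z n ω) (A n ω)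
        - GenAMP.empAverage F k φ (u0 n ω) (Z n ω) (G n ω)|} =
      R ({ω | ε ≤ |GenAMP.empAverage F k φ (u0 n ω) (Z n ω) (A n ω)
        - GenAMP.empAverage F k φ (u0 n ω) (Z n ω) (G n ω)|} ×ˢ Set.univ) := by
    rw [hR, Measure.prod_prod, measure_univ, mul_one]
  rw [hfst]
  have hsub : ({ω | ε ≤ |GenAMP.empAverage F k φ (u0 n ω) (Z n ω) (A n ω)
        - GenAMP.empAverage F k φ (u0 n ω) (Z n ω) (G n ω)|} ×ˢ
          (Set.univ : Set (GenAMP.Pair n → ℝ))) ⊆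
      {p | ε / 2 ≤ |GenAMP.empAverage F k φ (u0 n p.1) (Z n p.1) (A n p.1) -
        GenAMP.empAverage F k φ (u0 n p.1) (Z n p.1) (GenAMP.symM p.2)|} ∪
      {p | ε / 2 ≤ |GenAMP.empAverage F k φ (u0 n p.1) (Z n p.1) (G n p.1) -
        GenAMP.empAverage F k φ (u0 n p.1) (Z n p.1) (GenAMP.symM p.2)|} := fun p hp => by
    have h1 : ε ≤ |_| := hp.1
    by_contra hcon
    rw [Set.mem_union, not_or, Set.mem_ofPred_eq, Set.mem_ofPred_eq, not_le, not_le] at hcon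
    have h2 := abs_lt.1 hcon.1
    have h3 := abs_lt.1 hcon.2
    rcases le_abs.1 h1 with h1 | h1 <;> linarith
  refine ((measure_mono hsub).trans (measure_union_le _ _)).trans ?_
  refine (add_le_add (hA'.trans (add_le_add_right hbad _))
    (hG'.trans (add_le_add_right hbad _))).trans (le_trans (le_of_eq ?_) hδ'.le)
  have h4 : 0 ≤ (δ' : ℝ) / 4 := by positivity
  rw [← ENNReal.ofReal_add h4 h4, ← ENNReal.ofReal_add (by positivity) (by positivity),
    ← ENNReal.ofReal_coe_nnreal]
  congr 1
  ring
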